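/- **Definitions.** *Monoids and model spaces.* A *weakly toric* monoid is one isomorphic to a finitely generated submonoid $P\subseteq\mathbb Z^n$ that is saturated: if $p$ lies in the subgroup generated by $P$ and $mp\in P$ for some integer $m\ge1$, then $p\in P$. A *face* of a monoid $P$ is a submonoid $F\subseteq P$ such that $p,q\in P$, $p+q\in F$ imply $p,q\in F$; $\operatorname{rank}P$ is the rank of the subgroup generated by $P$. Let $X_P=\operatorname{Hom}(P,([0,\infty),\cdot))$, with the weakest topology making all $\lambda_p:x\mapsto x(p)$ $(p\in P)$ continuous. The *support* of $x\in X_P$ is the face $\{p\in P:x(p)\ne0\}$, and the *depth* of $x$ is $\operatorname{rank}P$ minus the rank of its support. On an open subset of $X_P$, a function to $\mathbb R$ is *smooth* if it is locally of the form $G(\lambda_{p_1},\dots,\lambda_{p_m})$ with $p_i\in P$ and $G\in C^\infty(\mathbb R^m)$; a function to $[0,\infty)$ is *smooth* if locally it is either $0$ or of the form $\lambda_p\cdot h$ with $p\in P$ and $h$ smooth and positive. A continuous map to an open subset of $X_Q$ is *smooth* if its composition with each $\lambda_q:X_Q\to[0,\infty)$, $q\in Q$, is smooth. *Manifolds with g-corners.*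 A *manifold with g-corners of mixed dimension* is a Hausdorff, second countable space $X$ with an atlas of charts, homeomorphisms from open subsets of model spaces $X_P$ ($P$ weakly toric) onto open subsets of $X$, such that the changes of coordinates are smooth. (It is a *manifold with g-corners of dimension $n$* if $\operatorname{rank}P=n$ for all charts.) Smooth functions to $\mathbb R$ and to $[0,\infty)$, smooth maps, and depth are defined through charts. Write $S^k(X)$ for the set of points of depth $k$, and let the *interior* $X^\circ$ be the set of points where all $\lambda_p$ are positive in a chart. A smooth map $f:X\to Y$ is *interior* if $f(X^\circ)\subseteq Y^\circ$; a smooth function to $[0,\infty)$ is *interior* if it is positive on the interior. *Corners.* A *local $k$-corner component* $\gamma$ of $X$ at $x$ is a compatible choice, for all (sufficiently small) open neighbourhoods $V$ of $x$, of a connected component $\gamma_V$ of $V\cap S^k(X)$ with $x\in\overline{\gamma_V}$; compatible means $x\in\overline{\gamma_V\cap\gamma_{V'}}$ for all $V,V'$. The *corners* of $X$ are $C(X)=\coprod_{k\ge0}C_k(X)$, where $C_k(X)$ is the set of pairs $(x,\gamma)$ with $x\in X$ and $\gamma$ a local $k$-corner component at $x$. Each chart $\phi:U\to X$ with $U\subseteq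 X_P$ and each face $F$ of $P$ give a chart on $C(X)$: its image is the set of those $(x,\gamma)$ with $x\in\phi(U)$ for which $\gamma$ is locally given by $\{\phi(u):u\in U,\ \operatorname{supp}u=F\}$, and its inverse takes $(x,\gamma)$ to $\phi^{-1}(x)|_F\in X_F$. Give $C(X)$ the topology and atlas defined by these charts. For a smooth map $f:X\to Y$, the *corner map* $C(f):C(X)\to C(Y)$ sends $(x,\gamma)$ to $(f(x),f_*\gamma)$, where $f_*\gamma$ is the local corner component at $f(x)$ with $f(\gamma_V)\subseteq(f_*\gamma)_{V'}$ whenever $V,V'$ are open neighbourhoods of $x,f(x)$ with $f(V)\subseteq V'$. *B-tangent and b-normal spaces.* For $x\in X$ let $C^\infty_x(X)$ be the algebra of germs at $x$ of smooth functions to $\mathbb R$, and $\mathcal I_x(X)$ the multiplicative monoid of germs at $x$ of interior smooth functions to $[0,\infty)$. Let ${}^bT_xX$ be the vector space of pairs $(v,v')$ with $v:C^\infty_x(X)\to\mathbb R$ linear, $v':\mathcal I_x(X)\to(\mathbb R,+)$ a monoid morphism, $v(ab)=v(a)b(x)+a(x)v(b)$, $v'(e^a)=v(a)$ and $v(b)=b(x)\,v'(b)$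 for $b\in\mathcal I_x(X)$. Let ${}^b\tilde N_xX$ be the vector space of monoid morphisms $\mathcal I_x(X)\to(\mathbb R,+)$, and $\tilde M_xX$ the monoid of monoid morphisms $\mathcal I_x(X)\to(\mathbb N,+)$, that vanish on all germs $b$ with $b(x)>0$. For an interior map $f$, composition with $f^*$ gives ${}^bT_xf:{}^bT_xX\to{}^bT_{f(x)}Y$, ${}^b\tilde N_xf:{}^b\tilde N_xX\to{}^b\tilde N_{f(x)}Y$ and $\tilde M_xf:\tilde M_xX\to\tilde M_{f(x)}Y$. *Transversality.* Interior maps $g:X\to Z$ and $h:Y\to Z$ of manifolds with g-corners of mixed dimension are *b-transverse* if ${}^bT_xg\oplus{}^bT_yh:{}^bT_xX\oplus{}^bT_yY\to{}^bT_zZ$ is surjective for all $x\in X$, $y\in Y$ with $g(x)=h(y)=z$. They are *c-transverse* if they are b-transverse and for all such $x,y$ the map ${}^b\tilde N_xg\oplus{}^b\tilde N_yh:{}^b\tilde N_xX\oplus{}^b\tilde N_yY\to{}^b\tilde N_zZ$ is surjective and the submonoid $\{(\lambda,\mu)\in\tilde M_xX\times\tilde M_yY:\tilde M_xg(\lambda)=\tilde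 M_yh(\mu)\}$ is not contained in any proper face of $\tilde M_xX\times\tilde M_yY$. **Theorem.** Let $g:X\to Z$ and $h:Y\to Z$ be interior maps of manifolds with g-corners, possibly of mixed dimension. Then $C(X)$, $C(Y)$, $C(Z)$ are manifolds with g-corners of mixed dimension, and $C(g):C(X)\to C(Z)$ and $C(h):C(Y)\to C(Z)$ are interior maps. If $g,h$ are b-transverse, then so are $C(g),C(h)$; if $g,h$ are c-transverse, then so are $C(g),C(h)$. -/

import Mathlib

open Set Filter Topology
open scoped ContDiff NNReal

namespace GCorners

/-! ### Monoids -/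

/-- `F` is a face of the monoid `P` (both submonoids of an ambient commutative monoid). -/
def IsFaceOf {M : Type*} [AddCommMonoid M] (F P : AddSubmonoid M) : Prop :=
  F ≤ P ∧ ∀ p ∈ P, ∀ q ∈ P, p + q ∈ F → p ∈ F ∧ q ∈ F

/-- A submonoid of `ℤⁿ` is weakly toric if it is finitely generated and saturated. Such a submonoid
is automatically integral and torsion-free, and its group completion is the subgroup of `ℤⁿ` that
it generates. -/
structure IsWeaklyToric {n : ℕ} (P : AddSubmonoid (Fin n → ℤ)) : Prop where
  fg : P.FG
  saturated : ∀ p ∈ AddSubgroup.closure (P : Set (Fin n → ℤ)), ∀ m : ℕ, 1 ≤ m → m • p ∈ P → p ∈ P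

/-- The rank of the subgroup generated by `P`. -/
noncomputable def rank {n : ℕ} (P : AddSubmonoid (Fin n → ℤ)) : ℕ :=
  Module.finrank ℤ (Submodule.span ℤ (P : Set (Fin n → ℤ)))

/-! ### The model spaces `X_P` -/

/-- The model space `X_P`: the set of monoid morphisms from `P` to `([0,∞), ·)`. -/
@[ext]
structure ModelSpace {n : ℕ} (P : AddSubmonoid (Fin n → ℤ)) where
  toFun : P → ℝ≥0
  map_zero : toFun 0 = 1
  map_add : ∀ p q, toFun (p + q) = toFun p * toFun q

namespace ModelSpace

variable {n : ℕ} {P F : AddSubmonoid (Fin n → ℤ)}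

/-- The weakest topology for which all evaluations `λ_p : x ↦ x(p)` are continuous. -/
instance : TopologicalSpace (ModelSpace P) :=
  TopologicalSpace.induced ModelSpace.toFun inferInstance

/-- The support `{p ∈ P : x(p) ≠ 0}` of `x`, a face of `P`. -/
def supp (x : ModelSpace P) : AddSubmonoid (Fin n → ℤ) where
  carrier := {p | ∃ h : p ∈ P, x.toFun ⟨p, h⟩ ≠ 0}
  zero_mem' := ⟨P.zero_mem, by
    have h : x.toFun ⟨0, P.zero_mem⟩ = 1 := x.map_zero
    rw [h]; exact one_ne_zero⟩
  add_mem' := by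
    rintro p q ⟨hp, hp0⟩ ⟨hq, hq0⟩
    refine ⟨P.add_mem hp hq, ?_⟩
    have h : x.toFun ⟨p + q, P.add_mem hp hq⟩ = x.toFun ⟨p, hp⟩ * x.toFun ⟨q, hq⟩ :=
      x.map_add ⟨p, hp⟩ ⟨q, hq⟩
    rw [h]; exact mul_ne_zero hp0 hq0

/-- The depth of `x` in `X_P`: the codimension of the face `supp x` of `P`. -/
noncomputable def depth (x : ModelSpace P) : ℕ := rank P - rank x.supp

/-- Restriction of a morphism to a submonoid `F` of `P`. For a face `F`, this is the inverse of the
inclusion `X_F → X_P` (extension by zero) on the image of that inclusion. -/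
def restrict (h : F ≤ P) (x : ModelSpace P) : ModelSpace F where
  toFun p := x.toFun ⟨p, h p.2⟩
  map_zero := x.map_zero
  map_add p q := x.map_add ⟨p, h p.2⟩ ⟨q, h q.2⟩

end ModelSpace

/-! ### Generalized charts -/

/-- The data of a generalized chart `(P, U, φ)` on `X`, recorded by its inverse: `source` is `φ(U)`,
and `coord` is `φ⁻¹ : φ(U) → U ⊆ X_P` (the values of `coord` outside `source` are irrelevant). -/
structure GChart (X : Type*) where
  n : ℕ
  P : AddSubmonoid (Fin n → ℤ)
  source : Set X
  coord : X → ModelSpace P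

namespace GChart

variable {X : Type*} [TopologicalSpace X]

/-- `P` is weakly toric, and `coord` is a homeomorphism from the open set `source`
to an open subset of `X_P`. -/
structure IsValid (c : GChart X) : Prop where
  weaklyToric : IsWeaklyToric c.P
  isOpen_source : IsOpen c.source
  isOpenEmbedding : IsOpenEmbedding (c.source.domRestrict c.coord)

/-- The real function `a` is smooth near `x`, in the coordinates of the chart `c`: near `x` it is a
smooth function of finitely many of the functions `λ_r`, `r ∈ P`. -/
def SmoothReal (c : GChart X) (a : X → ℝ) (x : X) : Prop :=
  ∃ (m : ℕ) (r : Fin m → c.P) (g : (Fin m → ℝ) → ℝ), ContDiff ℝ ∞ g ∧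
    ∀ᶠ y in 𝓝 x, a y = g fun i => ((c.coord y).toFun (r i) : ℝ)

/-- The function `b` to `[0,∞)` is smooth near `x`, in the coordinates of the chart `c`: near `x`
either `b = 0`, or `b = λ_p · h` with `p ∈ P` and `h` a smooth positive function. -/
def SmoothNN (c : GChart X) (b : X → ℝ≥0) (x : X) : Prop :=
  (∀ᶠ y in 𝓝 x, b y = 0) ∨
    ∃ (p : c.P) (h : X → ℝ), c.SmoothReal h x ∧ (∀ᶠ y in 𝓝 x, 0 < h y) ∧
      ∀ᶠ y in 𝓝 x, (b y : ℝ) = (c.coord y).toFun p * h y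

/-- Smoothness of the change of coordinates from `c` to `d`. -/
def SmoothTransition (c d : GChart X) : Prop :=
  ∀ x ∈ c.source ∩ d.source, ∀ q : d.P, c.SmoothNN (fun y => (d.coord y).toFun q) x

end GChart

/-- A set of generalized charts on `X`. -/
class GCAtlas (X : Type*) where
  charts : Set (GChart X)

/-- `X`, with the given set of charts as atlas, is a manifold with g-corners, possibly of mixed
dimension: the charts are not required to have the same dimension `rank P`. The atlas is not
required to be maximal; all notions below depend only on the maximal atlas that contains it. -/
class IsGCManifold (X : Type*) [TopologicalSpace X] [GCAtlas X] : Prop where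
  t2 : T2Space X
  secondCountable : SecondCountableTopology X
  isValid : ∀ c ∈ GCAtlas.charts (X := X), c.IsValid
  cover : ∀ x : X, ∃ c ∈ GCAtlas.charts (X := X), x ∈ c.source
  compatible : ∀ c ∈ GCAtlas.charts (X := X), ∀ d ∈ GCAtlas.charts (X := X), c.SmoothTransition d

section Maps

variable {X Y : Type*} [TopologicalSpace X] [GCAtlas X] [TopologicalSpace Y] [GCAtlas Y]

/-- `a : X → ℝ` is smooth near `x`. -/
def SmoothRealAt (a : X → ℝ) (x : X) : Prop :=
  ∀ c ∈ GCAtlas.charts (X := X), x ∈ c.source → c.SmoothReal a x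

/-- The interior `X°` of `X`: the points with all coordinates `λ_p` positive. -/
def interiorPts (X : Type*) [GCAtlas X] : Set X :=
  {x | ∃ c ∈ GCAtlas.charts (X := X), x ∈ c.source ∧ ∀ p, 0 < (c.coord x).toFun p}

/-- `b : X → [0,∞)` is an interior map near `x`: it is smooth, and positive on `X°`. -/
def InteriorFunAt (b : X → ℝ≥0) (x : X) : Prop :=
  (∀ c ∈ GCAtlas.charts (X := X), x ∈ c.source → c.SmoothNN b x) ∧
    ∀ᶠ y in 𝓝 x, y ∈ interiorPts X → 0 < b y

/-- `f : X → Y` is a smooth map. -/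
structure IsSmoothMap (f : X → Y) : Prop where
  continuous : Continuous f
  smooth : ∀ c ∈ GCAtlas.charts (X := X), ∀ d ∈ GCAtlas.charts (X := Y), ∀ x ∈ c.source,
    f x ∈ d.source → ∀ q : d.P, c.SmoothNN (fun y => (d.coord (f y)).toFun q) x

/-- `f : X → Y` is an interior map. -/
structure IsInteriorMap (f : X → Y) : Prop extends IsSmoothMap f where
  mapsTo : MapsTo f (interiorPts X) (interiorPts Y)

/-! ### The depth stratification, corners, and the corner functor -/

/-- The depth of `x` in `X`. All charts at `x` give the same value. -/
noncomputable def depth (x : X) : ℕ :=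
  sInf {k | ∃ c ∈ GCAtlas.charts (X := X), x ∈ c.source ∧ (c.coord x).depth = k}

/-- The depth `k` stratum `S^k(X)`. -/
def stratum (X : Type*) [GCAtlas X] (k : ℕ) : Set X := {x | depth x = k}

/-- A local `k`-corner component of `X` at `x`: a choice, for each open neighbourhood `V` of `x`, of
a connected component of `V ∩ S^k(X)` with `x` in its closure, these choices being compatible.
(A compatible choice for all sufficiently small `V` extends uniquely to one for all `V`.) -/
@[ext]
structure LocalCorner (x : X) (k : ℕ) where
  comp : TopologicalSpace.OpenNhdsOf x → Set X
  isComponent : ∀ V : TopologicalSpace.OpenNhdsOf x, ∃ w ∈ (V : Set X) ∩ stratum X k,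
    comp V = connectedComponentIn ((V : Set X) ∩ stratum X k) w
  mem_closure : ∀ V, x ∈ closure (comp V)
  compatible : ∀ V V', x ∈ closure (comp V ∩ comp V')

/-- The local corner component at `x` given by the stratum that contains `x`. -/
def LocalCorner.through (x : X) : LocalCorner x (depth x) where
  comp V := connectedComponentIn ((V : Set X) ∩ stratum X (depth x)) x
  isComponent V := ⟨x, ⟨V.mem, rfl⟩, rfl⟩
  mem_closure V := subset_closure (mem_connectedComponentIn ⟨V.mem, rfl⟩)
  compatible V V' := subset_closure
    ⟨mem_connectedComponentIn ⟨V.mem, rfl⟩, mem_connectedComponentIn ⟨V'.mem, rfl⟩⟩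

/-- The corners `C(X) = ∐ₖ C_k(X)`: pairs `(x, γ)` of a point of `X` and a local `k`-corner component
of `X` at `x`, for some `k`. -/
structure Corners (X : Type*) [TopologicalSpace X] [GCAtlas X] where
  pt : X
  codim : ℕ
  comp : LocalCorner pt codim

/-- The chart on `C(X)` given by a chart `c = (P, U, φ)` on `X` and a face `F` of `P`. Its source
consists of the `(x, γ)` such that `γ` is locally the stratum `φ(U ∩ {u : supp u = F})`, and its
coordinate map sends `(x, γ)` to the restriction of `φ⁻¹(x)` to `F`. -/
def cornerChart (c : GChart X) (F : AddSubmonoid (Fin c.n → ℤ)) (hF : IsFaceOf F c.P) :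
    GChart (Corners X) where
  n := c.n
  P := F
  source := {ξ | ξ.pt ∈ c.source ∧
    ∀ V, ξ.pt ∈ closure (ξ.comp.comp V ∩ {y | y ∈ c.source ∧ (c.coord y).supp = F})}
  coord ξ := (c.coord ξ.pt).restrict hF.1

/-- The atlas on `C(X)`. -/
instance : GCAtlas (Corners X) where
  charts := {e | ∃ c ∈ GCAtlas.charts (X := X), ∃ F, ∃ hF : IsFaceOf F c.P, e = cornerChart c F hF}

/-- The topology on `C(X)` for which the charts are homeomorphisms of open sets: it is generated by
the preimages of open sets under the charts. -/
instance : TopologicalSpace (Corners X) :=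
  TopologicalSpace.generateFrom {S | ∃ e ∈ GCAtlas.charts (X := Corners X),
    ∃ O : Set (ModelSpace e.P), IsOpen O ∧ S = e.source ∩ e.coord ⁻¹' O}

/-- `η = (f(x), f_*(γ))` for `ξ = (x, γ)`: if `V` is a neighbourhood of `x` and `V'` one of `f(x)`
with `f(V) ⊆ V'`, then the component of `V ∩ S^k(X)` given by `γ` is mapped into the component
of `V' ∩ S^l(Y)` given by `f_*(γ)`. -/
def IsPushforward (f : X → Y) (ξ : Corners X) (η : Corners Y) : Prop :=
  f ξ.pt = η.pt ∧ ∀ (V : TopologicalSpace.OpenNhdsOf ξ.pt) (V' : TopologicalSpace.OpenNhdsOf η.pt),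
    MapsTo f V V' → MapsTo f (ξ.comp.comp V) (η.comp.comp V')

open Classical in
/-- The corner map `C(f) : C(X) → C(Y)`, `(x, γ) ↦ (f(x), f_*(γ))`. For a smooth map `f` of manifolds
with g-corners there is exactly one such point of `C(Y)`; the last line is a dummy value for
other maps. -/
noncomputable def cornerMap (f : X → Y) (ξ : Corners X) : Corners Y :=
  if h : ∃ η, IsPushforward f ξ η then h.choose
  else ⟨f ξ.pt, depth (f ξ.pt), LocalCorner.through (f ξ.pt)⟩

end Maps

/-! ### Helper facts on smooth functions in a chart -/

namespace GChart

variable {X : Type*} [TopologicalSpace X] {c : GChart X} {x : X}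

lemma SmoothReal.of_fintype {ι : Type} [Fintype ι] {a : X → ℝ} (r : ι → c.P)
    (g : (ι → ℝ) → ℝ) (hg : ContDiff ℝ ∞ g)
    (h : ∀ᶠ y in 𝓝 x, a y = g fun i => ((c.coord y).toFun (r i) : ℝ)) : c.SmoothReal a x := by
  let e := Fintype.equivFin ι
  refine ⟨Fintype.card ι, fun i => r (e.symm i), fun v => g fun i => v (e i), ?_, ?_⟩
  · exact hg.comp (contDiff_pi.2 fun i => contDiff_apply ℝ ℝ (e i))
  · filter_upwards [h] with y hy
    simpa using hy

lemma SmoothReal.comp {m : ℕ} {a : Fin m → X → ℝ} (ha : ∀ i, c.SmoothReal (a i) x)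
    {g : (Fin m → ℝ) → ℝ} (hg : ContDiff ℝ ∞ g) {b : X → ℝ}
    (hb : ∀ᶠ y in 𝓝 x, b y = g fun i => a i y) : c.SmoothReal b x := by
  choose k r u hu h using ha
  refine SmoothReal.of_fintype (ι := Σ i : Fin m, Fin (k i)) (fun j => r j.1 j.2)
    (fun v => g fun i => u i fun j => v ⟨i, j⟩) ?_ ?_
  · refine hg.comp (contDiff_pi.2 fun i => (hu i).comp (contDiff_pi.2 fun j => ?_))
    exact contDiff_apply ℝ ℝ _
  · filter_upwards [hb, Filter.eventually_all.2 h] with y hy hy'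
    rw [hy]
    congr 1
    funext i
    exact hy' i

lemma SmoothReal.comp₁ {a b : X → ℝ} (ha : c.SmoothReal a x) {g : ℝ → ℝ} (hg : ContDiff ℝ ∞ g)
    (hb : ∀ᶠ y in 𝓝 x, b y = g (a y)) : c.SmoothReal b x :=
  SmoothReal.comp (m := 1) (a := fun _ => a) (fun _ => ha) (g := fun v => g (v 0))
    (hg.comp (contDiff_apply ℝ ℝ _)) hb

lemma SmoothReal.comp₂ {a₁ a₂ b : X → ℝ} (h₁ : c.SmoothReal a₁ x) (h₂ : c.SmoothReal a₂ x)
    {g : ℝ × ℝ → ℝ} (hg : ContDiff ℝ ∞ g)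
    (hb : ∀ᶠ y in 𝓝 x, b y = g (a₁ y, a₂ y)) : c.SmoothReal b x :=
  SmoothReal.comp (m := 2) (a := ![a₁, a₂]) (fun i => by fin_cases i <;> assumption)
    (g := fun v => g (v 0, v 1))
    (hg.comp ((contDiff_apply ℝ ℝ _).prodMk (contDiff_apply ℝ ℝ _))) (by simpa using hb)

lemma SmoothReal.const (t : ℝ) : c.SmoothReal (fun _ => t) x :=
  ⟨0, Fin.elim0, fun _ => t, contDiff_const, Eventually.of_forall fun _ => rfl⟩

lemma SmoothReal.coordinate (p : c.P) :
    c.SmoothReal (fun y => ((c.coord y).toFun p : ℝ)) x :=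
  ⟨1, fun _ => p, fun v => v 0, contDiff_apply ℝ ℝ _, Eventually.of_forall fun _ => rfl⟩

lemma SmoothNN.toReal {b : X → ℝ≥0} (hb : c.SmoothNN b x) :
    c.SmoothReal (fun y => (b y : ℝ)) x := by
  rcases hb with hb | ⟨p, h, hh, -, hb⟩
  · exact SmoothReal.comp₁ (SmoothReal.const (c := c) (x := x) 0) contDiff_id
      (by filter_upwards [hb] with y hy; simp [hy])
  · exact SmoothReal.comp₂ (SmoothReal.coordinate p) hh (g := fun v => v.1 * v.2)
      (contDiff_fst.mul contDiff_snd) hb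

/-- A positive smooth multiple of a smooth function to `[0,∞)` is smooth. -/
lemma SmoothNN.mul_pos {a b : X → ℝ≥0} (ha : c.SmoothNN a x) {u : X → ℝ} (hu : c.SmoothReal u x)
    (hu0 : ∀ᶠ y in 𝓝 x, 0 < u y) (hb : ∀ᶠ y in 𝓝 x, (b y : ℝ) = a y * u y) : c.SmoothNN b x := by
  rcases ha with ha | ⟨p, h, hh, hh0, ha⟩
  · left
    filter_upwards [ha, hb] with y hy hy'
    rw [hy] at hy'
    simpa using hy'
  · refine Or.inr ⟨p, fun y => h y * u y, ?_, ?_, ?_⟩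
    · exact SmoothReal.comp₂ hh hu (g := fun v => v.1 * v.2) (contDiff_fst.mul contDiff_snd)
        (Eventually.of_forall fun _ => rfl)
    · filter_upwards [hh0, hu0] with y h1 h2 using _root_.mul_pos h1 h2
    · filter_upwards [ha, hb] with y h1 h2
      rw [h2, h1, mul_assoc]

lemma SmoothNN.mul {a b : X → ℝ≥0} (ha : c.SmoothNN a x) (hb : c.SmoothNN b x) :
    c.SmoothNN (fun y => a y * b y) x := by
  rcases ha with ha | ⟨p, h, hh, hh0, ha⟩
  · left
    filter_upwards [ha] with y hy
    simp [hy]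
  · rcases hb with hb | ⟨q, u, hu, hu0, hb⟩
    · left
      filter_upwards [hb] with y hy
      simp [hy]
    · refine Or.inr ⟨p + q, fun y => h y * u y, ?_, ?_, ?_⟩
      · exact SmoothReal.comp₂ hh hu (g := fun v => v.1 * v.2) (contDiff_fst.mul contDiff_snd)
          (Eventually.of_forall fun _ => rfl)
      · filter_upwards [hh0, hu0] with y h1 h2 using _root_.mul_pos h1 h2
      · filter_upwards [ha, hb] with y h1 h2
        rw [(c.coord y).map_add]
        push_cast
        rw [h1, h2]
        ring

/-- Positive smooth functions are smooth as functions to `[0,∞)`. -/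
lemma SmoothReal.toNN {u : X → ℝ} (hu : c.SmoothReal u x) (hu0 : ∀ᶠ y in 𝓝 x, 0 < u y)
    {b : X → ℝ≥0} (hb : ∀ᶠ y in 𝓝 x, (b y : ℝ) = u y) : c.SmoothNN b x :=
  Or.inr ⟨0, u, hu, hu0, by
    filter_upwards [hb] with y hy
    rw [hy, (c.coord y).map_zero]
    simp⟩

end GChart

/-! ### Germs -/

section Germs

variable {X : Type*} [TopologicalSpace X] [GCAtlas X]

/-- `C^∞_x(X)`: the germs at `x` of smooth functions to `ℝ`. -/
def SmoothGerm (x : X) : Submodule ℝ (Germ (𝓝 x) ℝ) where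
  carrier := {a | ∃ f : X → ℝ, SmoothRealAt f x ∧ (f : Germ (𝓝 x) ℝ) = a}
  zero_mem' := ⟨fun _ => 0, fun c _ _ => GChart.SmoothReal.const 0, rfl⟩
  add_mem' := by
    rintro _ _ ⟨f, hf, rfl⟩ ⟨g, hg, rfl⟩
    exact ⟨f + g, fun c hc hx => GChart.SmoothReal.comp₂ (hf c hc hx) (hg c hc hx)
      (g := fun v => v.1 + v.2) (contDiff_fst.add contDiff_snd)
      (Eventually.of_forall fun _ => rfl), rfl⟩
  smul_mem' := by
    rintro t _ ⟨f, hf, rfl⟩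
    exact ⟨t • f, fun c hc hx => GChart.SmoothReal.comp₁ (hf c hc hx)
      (g := fun v => t * v) (contDiff_const.mul contDiff_id)
      (Eventually.of_forall fun _ => rfl), rfl⟩

variable {x : X}

/-- The product of two germs of smooth functions. -/
def SmoothGerm.mul (a b : SmoothGerm x) : SmoothGerm x :=
  ⟨(a : Germ (𝓝 x) ℝ) * (b : Germ (𝓝 x) ℝ), by
    obtain ⟨_, f, hf, rfl⟩ := a
    obtain ⟨_, g, hg, rfl⟩ := b
    exact ⟨f * g, fun c hc hx => GChart.SmoothReal.comp₂ (hf c hc hx) (hg c hc hx)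
      (g := fun v => v.1 * v.2) (contDiff_fst.mul contDiff_snd)
      (Eventually.of_forall fun _ => rfl), rfl⟩⟩

/-- `ev : C^∞_x(X) → ℝ`. -/
def SmoothGerm.ev (a : SmoothGerm x) : ℝ := (a : Germ (𝓝 x) ℝ).value

/-- `I_x(X)`: the monoid of germs at `x` of interior functions to `[0,∞)`, under multiplication. -/
def InteriorGerm (x : X) : Submonoid (Germ (𝓝 x) ℝ≥0) where
  carrier := {b | ∃ f : X → ℝ≥0, InteriorFunAt f x ∧ (f : Germ (𝓝 x) ℝ≥0) = b}
  one_mem' := ⟨fun _ => 1, ⟨fun c _ _ => GChart.SmoothReal.toNN (GChart.SmoothReal.const 1)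
    (Eventually.of_forall fun _ => one_pos) (Eventually.of_forall fun _ => rfl),
    Eventually.of_forall fun _ _ => one_pos⟩, rfl⟩
  mul_mem' := by
    rintro _ _ ⟨f, hf, rfl⟩ ⟨g, hg, rfl⟩
    refine ⟨f * g, ⟨fun c hc hx => (hf.1 c hc hx).mul (hg.1 c hc hx), ?_⟩, rfl⟩
    filter_upwards [hf.2, hg.2] with y h1 h2 hy using mul_pos (h1 hy) (h2 hy)

/-- `ev : I_x(X) → [0,∞)`. -/
def InteriorGerm.ev (b : InteriorGerm x) : ℝ≥0 := (b : Germ (𝓝 x) ℝ≥0).value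

/-- `inc : I_x(X) → C^∞_x(X)`. -/
def InteriorGerm.inc (b : InteriorGerm x) : SmoothGerm x :=
  ⟨(b : Germ (𝓝 x) ℝ≥0).map (fun t : ℝ≥0 => (t : ℝ)), by
    obtain ⟨_, f, hf, rfl⟩ := b
    exact ⟨fun y => (f y : ℝ), fun c hc hx => (hf.1 c hc hx).toReal, rfl⟩⟩

/-- `exp : C^∞_x(X) → I_x(X)`. -/
noncomputable def SmoothGerm.exp (a : SmoothGerm x) : InteriorGerm x :=
  ⟨(a : Germ (𝓝 x) ℝ).map (fun t : ℝ => (⟨Real.exp t, (Real.exp_pos t).le⟩ : ℝ≥0)), by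
    obtain ⟨_, f, hf, rfl⟩ := a
    exact ⟨fun y => ⟨Real.exp (f y), (Real.exp_pos _).le⟩,
      ⟨fun c hc hx => GChart.SmoothReal.toNN (u := fun y => Real.exp (f y))
        (GChart.SmoothReal.comp₁ (hf c hc hx) Real.contDiff_exp (Eventually.of_forall fun _ => rfl))
        (Eventually.of_forall fun _ => Real.exp_pos _) (Eventually.of_forall fun _ => rfl),
      Eventually.of_forall fun y _ => Real.exp_pos (f y)⟩, rfl⟩⟩

/-! ### B-tangent spaces, b-normal spaces and monoids at a point -/

/-- The b-tangent space `ᵇT_xX`: pairs `(v, v')` of a derivation `v` of `C^∞_x(X)` at `x` and a monoid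
morphism `v' : I_x(X) → (ℝ, +)` with `v' ∘ exp = v` and `v ∘ inc = ev · v'`. -/
noncomputable def BTangent (x : X) :
    Submodule ℝ ((SmoothGerm x →ₗ[ℝ] ℝ) × (Additive (InteriorGerm x) →+ ℝ)) where
  carrier := {v | (∀ a b, v.1 (SmoothGerm.mul a b) = v.1 a * SmoothGerm.ev b + SmoothGerm.ev a * v.1 b) ∧
    (∀ a, v.2 (Additive.ofMul (SmoothGerm.exp a)) = v.1 a) ∧
    ∀ b, v.1 (InteriorGerm.inc b) = InteriorGerm.ev b * v.2 (Additive.ofMul b)}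
  zero_mem' := by simp
  add_mem' := by
    rintro v w ⟨h1, h2, h3⟩ ⟨k1, k2, k3⟩
    refine ⟨fun a b => ?_, fun a => ?_, fun b => ?_⟩
    · simp only [Prod.fst_add, LinearMap.add_apply, h1, k1]; ring
    · simp [h2, k2]
    · simp only [Prod.fst_add, Prod.snd_add, LinearMap.add_apply, AddMonoidHom.add_apply, h3, k3]
      ring
  smul_mem' := by
    rintro t v ⟨h1, h2, h3⟩
    refine ⟨fun a b => ?_, fun a => ?_, fun b => ?_⟩
    · simp only [Prod.smul_fst, LinearMap.smul_apply, smul_eq_mul, h1]; ring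
    · simp [h2]
    · simp only [Prod.smul_fst, Prod.smul_snd, LinearMap.smul_apply, AddMonoidHom.smul_apply,
        smul_eq_mul, h3]
      ring

/-- The b-normal space `ᵇÑ_xX`: monoid morphisms `I_x(X) → (ℝ, +)` that vanish on the germs `b` with
`b(x) > 0`. -/
noncomputable def BNormal (x : X) : Submodule ℝ (Additive (InteriorGerm x) →+ ℝ) where
  carrier := {α | ∀ b : InteriorGerm x, 0 < InteriorGerm.ev b → α (Additive.ofMul b) = 0}
  zero_mem' := fun _ _ => rfl
  add_mem' := fun hα hβ b hb => by simp [hα b hb, hβ b hb]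
  smul_mem' := fun t _ hα b hb => by simp [hα b hb]

/-- The monoid `M̃_xX`: monoid morphisms `I_x(X) → ℕ` that vanish on the germs `b` with `b(x) > 0`. -/
def NormalMonoid (x : X) : AddSubmonoid (Additive (InteriorGerm x) →+ ℕ) where
  carrier := {α | ∀ b : InteriorGerm x, 0 < InteriorGerm.ev b → α (Additive.ofMul b) = 0}
  zero_mem' := fun _ _ => rfl
  add_mem' := fun hα hβ b hb => by simp [hα b hb, hβ b hb]

end Germs

/-! ### Functoriality under interior maps -/

section Pullback

variable {X Z : Type*} [TopologicalSpace X] [GCAtlas X] [TopologicalSpace Z] [GCAtlas Z]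

lemma IsInteriorMap.tendsto {f : X → Z} (hf : IsInteriorMap f) {x : X} {z : Z} (hz : f x = z) :
    Tendsto f (𝓝 x) (𝓝 z) := hz ▸ hf.continuous.tendsto x

variable [IsGCManifold Z]

lemma IsInteriorMap.smoothRealAt_comp {f : X → Z} (hf : IsInteriorMap f) {x : X} {z : Z}
    (hz : f x = z) {a : Z → ℝ} (ha : SmoothRealAt a z) : SmoothRealAt (a ∘ f) x := by
  intro c hc hx
  obtain ⟨d, hd, hzd⟩ := IsGCManifold.cover z
  obtain ⟨m, r, g, hg, h⟩ := ha d hd hzd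
  exact GChart.SmoothReal.comp
    (fun i => (hf.smooth c hc d hd x hx (hz ▸ hzd) (r i)).toReal) hg ((hf.tendsto hz).eventually h)

lemma IsInteriorMap.interiorFunAt_comp {f : X → Z} (hf : IsInteriorMap f) {x : X} {z : Z}
    (hz : f x = z) {b : Z → ℝ≥0} (hb : InteriorFunAt b z) : InteriorFunAt (b ∘ f) x := by
  refine ⟨fun c hc hx => ?_, ?_⟩
  · obtain ⟨d, hd, hzd⟩ := IsGCManifold.cover z
    rcases hb.1 d hd hzd with h0 | ⟨p, h, ⟨m, r, g, hg, hh⟩, hh0, hbh⟩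
    · exact Or.inl ((hf.tendsto hz).eventually h0)
    · refine (hf.smooth c hc d hd x hx (hz ▸ hzd) p).mul_pos (u := h ∘ f) ?_
        ((hf.tendsto hz).eventually hh0) ((hf.tendsto hz).eventually hbh)
      exact GChart.SmoothReal.comp
        (fun i => (hf.smooth c hc d hd x hx (hz ▸ hzd) (r i)).toReal) hg
        ((hf.tendsto hz).eventually hh)
  · filter_upwards [(hf.tendsto hz).eventually hb.2] with y hy hyX using hy (hf.mapsTo hyX)

/-- The pullback `f^* : C^∞_z(Z) → C^∞_x(X)`, `[a] ↦ [a ∘ f]`, for `z = f(x)`. -/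
def pullSmooth {f : X → Z} (hf : IsInteriorMap f) {x : X} {z : Z} (hz : f x = z) :
    SmoothGerm z →ₗ[ℝ] SmoothGerm x where
  toFun a := ⟨(a : Germ (𝓝 z) ℝ).compTendsto f (hf.tendsto hz), by
    obtain ⟨_, a, ha, rfl⟩ := a
    exact ⟨a ∘ f, hf.smoothRealAt_comp hz ha, rfl⟩⟩
  map_add' := by
    rintro ⟨_, a, ha, rfl⟩ ⟨_, b, hb, rfl⟩
    rfl
  map_smul' := by
    rintro t ⟨_, a, ha, rfl⟩
    rfl

/-- The pullback `f^* : I_z(Z) → I_x(X)`, `[b] ↦ [b ∘ f]`, for `z = f(x)`. -/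
def pullInterior {f : X → Z} (hf : IsInteriorMap f) {x : X} {z : Z} (hz : f x = z) :
    InteriorGerm z →* InteriorGerm x where
  toFun b := ⟨(b : Germ (𝓝 z) ℝ≥0).compTendsto f (hf.tendsto hz), by
    obtain ⟨_, b, hb, rfl⟩ := b
    exact ⟨b ∘ f, hf.interiorFunAt_comp hz hb, rfl⟩⟩
  map_one' := rfl
  map_mul' := by
    rintro ⟨_, a, ha, rfl⟩ ⟨_, b, hb, rfl⟩
    rfl

lemma pullSmooth_mul {f : X → Z} (hf : IsInteriorMap f) {x : X} {z : Z} (hz : f x = z)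
    (a b : SmoothGerm z) :
    pullSmooth hf hz (SmoothGerm.mul a b) =
      SmoothGerm.mul (pullSmooth hf hz a) (pullSmooth hf hz b) := by
  obtain ⟨_, a, ha, rfl⟩ := a
  obtain ⟨_, b, hb, rfl⟩ := b
  rfl

lemma pullSmooth_ev {f : X → Z} (hf : IsInteriorMap f) {x : X} {z : Z} (hz : f x = z)
    (a : SmoothGerm z) : SmoothGerm.ev (pullSmooth hf hz a) = SmoothGerm.ev a := by
  obtain ⟨_, a, ha, rfl⟩ := a
  subst hz
  rfl

lemma pullInterior_ev {f : X → Z} (hf : IsInteriorMap f) {x : X} {z : Z} (hz : f x = z)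
    (b : InteriorGerm z) : InteriorGerm.ev (pullInterior hf hz b) = InteriorGerm.ev b := by
  obtain ⟨_, b, hb, rfl⟩ := b
  subst hz
  rfl

lemma pullInterior_exp {f : X → Z} (hf : IsInteriorMap f) {x : X} {z : Z} (hz : f x = z)
    (a : SmoothGerm z) :
    pullInterior hf hz (SmoothGerm.exp a) = SmoothGerm.exp (pullSmooth hf hz a) := by
  obtain ⟨_, a, ha, rfl⟩ := a
  rfl

lemma pullSmooth_inc {f : X → Z} (hf : IsInteriorMap f) {x : X} {z : Z} (hz : f x = z)
    (b : InteriorGerm z) :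
    pullSmooth hf hz (InteriorGerm.inc b) = InteriorGerm.inc (pullInterior hf hz b) := by
  obtain ⟨_, b, hb, rfl⟩ := b
  rfl

/-- `ᵇT_xf : ᵇT_xX → ᵇT_zZ`, `(v, v') ↦ (v ∘ f^*, v' ∘ f^*)`, for `z = f(x)`. -/
noncomputable def bTangentMap {f : X → Z} (hf : IsInteriorMap f) {x : X} {z : Z} (hz : f x = z) :
    BTangent x →ₗ[ℝ] BTangent z where
  toFun v := ⟨(v.1.1 ∘ₗ pullSmooth hf hz, v.1.2.comp (pullInterior hf hz).toAdditive), by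
    obtain ⟨⟨v, v'⟩, h1, h2, h3⟩ := v
    refine ⟨fun a b => ?_, fun a => ?_, fun b => ?_⟩
    · change v _ = v _ * _ + _ * v _
      rw [pullSmooth_mul, ← pullSmooth_ev hf hz a, ← pullSmooth_ev hf hz b]
      exact h1 _ _
    · change v' (Additive.ofMul (pullInterior hf hz (SmoothGerm.exp a))) = v _
      rw [pullInterior_exp]
      exact h2 _
    · change v _ = _ * v' (Additive.ofMul (pullInterior hf hz b))
      rw [pullSmooth_inc, ← pullInterior_ev hf hz b]
      exact h3 _⟩
  map_add' _ _ := rfl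
  map_smul' _ _ := rfl

/-- `ᵇÑ_xf : ᵇÑ_xX → ᵇÑ_zZ`, `α ↦ α ∘ f^*`, for `z = f(x)`. -/
noncomputable def bNormalMap {f : X → Z} (hf : IsInteriorMap f) {x : X} {z : Z} (hz : f x = z) :
    BNormal x →ₗ[ℝ] BNormal z where
  toFun α := ⟨α.1.comp (pullInterior hf hz).toAdditive, fun b hb =>
    α.2 (pullInterior hf hz b) (by rwa [pullInterior_ev])⟩
  map_add' _ _ := rfl
  map_smul' _ _ := rfl

/-- `M̃_xf : M̃_xX → M̃_zZ`, `α ↦ α ∘ f^*`, for `z = f(x)`. -/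
def normalMonoidMap {f : X → Z} (hf : IsInteriorMap f) {x : X} {z : Z} (hz : f x = z) :
    NormalMonoid x →+ NormalMonoid z where
  toFun α := ⟨α.1.comp (pullInterior hf hz).toAdditive, fun b hb =>
    α.2 (pullInterior hf hz b) (by rwa [pullInterior_ev])⟩
  map_zero' := rfl
  map_add' _ _ := rfl

end Pullback

/-! ### Transversality -/

section Transverse

variable {X Y Z : Type*} [TopologicalSpace X] [GCAtlas X] [TopologicalSpace Y] [GCAtlas Y]
  [TopologicalSpace Z] [GCAtlas Z] [IsGCManifold Z] {g : X → Z} {h : Y → Z}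

/-- The interior maps `g : X → Z` and `h : Y → Z` are b-transverse. -/
def BTransverse (hg : IsInteriorMap g) (hh : IsInteriorMap h) : Prop :=
  ∀ (x : X) (y : Y) (z : Z) (hx : g x = z) (hy : h y = z),
    Function.Surjective ((bTangentMap hg hx).coprod (bTangentMap hh hy))

/-- The interior maps `g : X → Z` and `h : Y → Z` are c-transverse. -/
def CTransverse (hg : IsInteriorMap g) (hh : IsInteriorMap h) : Prop :=
  BTransverse hg hh ∧
  ∀ (x : X) (y : Y) (z : Z) (hx : g x = z) (hy : h y = z),
    Function.Surjective ((bNormalMap hg hx).coprod (bNormalMap hh hy)) ∧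
    ∀ F : AddSubmonoid (NormalMonoid x × NormalMonoid y), IsFaceOf F ⊤ →
      (∀ p : NormalMonoid x × NormalMonoid y,
        normalMonoidMap hg hx p.1 = normalMonoidMap hh hy p.2 → p ∈ F) → F = ⊤

end Transverse

end GCorners

namespace GCorners

/-! ### Homomorphisms from submonoids of abelian groups -/

section Extension

variable {A : Type*} [AddCommGroup A]

/-! The proof reads everything in charts, where corners become faces and transversality becomes
linear algebra on spaces of homomorphisms.

Fix a chart with monoid `P` at `x`. The strata near `x` are the sets of points with support a given
face, and `x` adheres to the stratum of `F` exactly when its support is contained in `F`. Each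
stratum meets arbitrarily small neighbourhoods in connected sets, because weighted geometric means
join points of equal support (`ModelSpace.exists_nhds_isPreconnected`). So local corner components
at `x` correspond to the faces `F` containing the support of `x` (`exists_inFace`,
`exists_corner_inFace`, `InFace.ext`). Near such a corner, `C(X)` is the closed stratum `X_F` inside
`X_P` (`nhds_corner`), and smooth functions restrict to it. Hence `C(X)` is a manifold with
g-corners. A smooth map preserves the order of supports locally, so it sends strata into strata;
this gives the corner map, which is interior even when the original map is only smooth.

Infinitesimally, every interior germ is `λ_p · exp e`. Differentiation along flows of constant
logarithmic velocity identifies the b-tangent space at `x` with `Hom(P, ℝ)` (`bTangent_ext`,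
`exists_bTangent`), the b-normal space with the homomorphisms to `ℝ` that vanish on the support of
`x`, and the normal monoid with the same for `ℕ` (`exists_hom_of_coordGerm`). That these do not
depend on the presentation of a germ is `SmoothExpr.logDeriv_unique`. The dimension of the b-normal
space is the depth, which is therefore independent of the chart (`finrank_bNormal`).

At a corner with face `F`, `P` is replaced by `F`. If `f` pulls `λ_q` back to `λ_p · exp e`, then
for `q` in the target face `p` lies in `F`, and the corner map pulls `λ_q` back to `λ_p · exp
(e|_F)` (`pull_coordGerm_corner`). So restriction of homomorphisms to faces intertwines the maps
induced by `f` and by `C(f)`. For values in `ℝ` restriction is surjective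
(`restrictHom_surjective`), and surjectivity passes to the corners. For values in `ℕ` it is
surjective only up to positive multiples (`IsFaceOf.exists_nat_extension`), which is enough for the
condition on faces because a face contains `p` as soon as it contains a positive multiple of `p`. -/

lemma lift_subtype_injective (F : AddSubmonoid A) :
    Function.Injective (Algebra.GrothendieckAddGroup.lift F.subtype) := by
  rw [injective_iff_map_eq_zero]
  intro x hx
  rw [Algebra.GrothendieckAddGroup.lift_apply, sub_eq_zero] at hx
  -- Write `x` as a formal difference of two elements of `F`. They are equal in `A`, hence in `F`,
  -- and then `x` cancels to zero.
  have h := (AddLocalization.addMonoidOf (⊤ : AddSubmonoid F)).sec_spec' x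
  rw [Subtype.ext hx] at h
  exact left_eq_add.mp h

/-- Homomorphisms from a submonoid to a divisible group extend to the ambient group. -/
lemma exists_hom_extension {Q : Type*} [AddCommGroup Q] [DivisibleBy Q ℤ] (F : AddSubmonoid A)
    (θ : F →+ Q) : ∃ θ' : A →+ Q, ∀ p : F, θ' p = θ p := by
  -- A divisible group is injective, and the group completion of `F` embeds into `A`.
  obtain ⟨θ', h⟩ := (Module.Baer.of_divisible Q).extension_property_addMonoidHom
    (Algebra.GrothendieckAddGroup.lift F.subtype) (lift_subtype_injective F)
    (Algebra.GrothendieckAddGroup.lift θ)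
  refine ⟨θ', fun p => ?_⟩
  have h1 := DFunLike.congr_fun h (Algebra.GrothendieckAddGroup.of p)
  have h3 : Algebra.GrothendieckAddGroup.lift F.subtype
      (Algebra.GrothendieckAddGroup.of p) = p :=
    DFunLike.congr_fun (Algebra.GrothendieckAddGroup.lift.symm_apply_apply F.subtype) p
  have h4 : Algebra.GrothendieckAddGroup.lift θ
      (Algebra.GrothendieckAddGroup.of p) = θ p :=
    DFunLike.congr_fun (Algebra.GrothendieckAddGroup.lift.symm_apply_apply θ) p
  rw [AddMonoidHom.comp_apply, h3, h4] at h1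
  exact h1

lemma exists_add_eq_of_mem_closure (F : AddSubmonoid A) {x : A}
    (hx : x ∈ AddSubgroup.closure (F : Set A)) : ∃ f ∈ F, ∃ f' ∈ F, x + f' = f := by
  induction hx using AddSubgroup.closure_induction with
  | mem x hx => exact ⟨x, hx, 0, F.zero_mem, add_zero x⟩
  | zero => exact ⟨0, F.zero_mem, 0, F.zero_mem, add_zero 0⟩
  | add x y _ _ hx hy =>
    obtain ⟨f, hf, f', hf', h⟩ := hx
    obtain ⟨k, hk, k', hk', h'⟩ := hy
    exact ⟨f + k, F.add_mem hf hk, f' + k', F.add_mem hf' hk', by rw [← h, ← h']; abel⟩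
  | neg x _ hx =>
    obtain ⟨f, hf, f', hf', h⟩ := hx
    exact ⟨f', hf', f, hf, by rw [← h]; abel⟩

end Extension

/-- Gordan's theorem: finitely many elements of an abelian group without a nontrivial relation with
coefficients in `ℕ` lie in an open half space. -/
theorem exists_hom_pos (k : ℕ) : ∀ {V : Type*} [AddCommGroup V] (s : Fin k → V),
    (∀ n : Fin k → ℕ, ∑ i, n i • s i = 0 → n = 0) → ∃ ℓ : V →+ ℚ, ∀ i, 0 < ℓ (s i) := by
  induction k with
  | zero => exact fun s _ => ⟨0, fun i => i.elim0⟩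
  | succ k ih =>
    intro V _ s hs
    -- If a nontrivial combination of the other vectors is a multiple of `s 0`, the multiple is
    -- positive and positivity at `s 0` follows from positivity on the others. If not, the others
    -- stay independent over `ℕ` modulo `s 0`, and induction applies in the quotient.
    by_cases hrel : ∃ n : Fin k → ℕ, n ≠ 0 ∧ ∃ m : ℤ, ∑ i, n i • s i.succ = m • s 0
    · obtain ⟨n, hn, m, hm⟩ := hrel
      have hm0 : 0 < m := by
        by_contra! hle
        have h := hs (Fin.cons m.natAbs n) (by
          have h2 : ((m.natAbs : ℤ)) = -m := by omega
          rw [Fin.sum_univ_succ]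
          simp only [Fin.cons_zero, Fin.cons_succ]
          rw [hm, ← natCast_zsmul, h2]
          simp)
        exact hn (funext fun i => by simpa using congrFun h i.succ)
      obtain ⟨ℓ, hℓ⟩ := ih (fun i => s i.succ) (fun n hn => by
        have h := hs (Fin.cons 0 n) (by rw [Fin.sum_univ_succ]; simpa using hn)
        exact funext fun i => by simpa using congrFun h i.succ)
      refine ⟨ℓ, Fin.cases ?_ hℓ⟩
      have h1 : (m : ℚ) * ℓ (s 0) = ∑ i, (n i : ℚ) * ℓ (s i.succ) := by
        have := congrArg ℓ hm
        simpa using this.symm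
      have h2 : 0 < ∑ i, (n i : ℚ) * ℓ (s i.succ) := by
        obtain ⟨i, hi⟩ := Function.ne_iff.1 hn
        refine Finset.sum_pos' (fun i _ => mul_nonneg (Nat.cast_nonneg _) (hℓ i).le)
          ⟨i, Finset.mem_univ _, mul_pos ?_ (hℓ i)⟩
        exact_mod_cast Nat.pos_of_ne_zero hi
      rw [← h1] at h2
      exact (mul_pos_iff_of_pos_left (by exact_mod_cast hm0)).1 h2
    · push Not at hrel
      obtain ⟨ℓ, hℓ⟩ := ih (V := V ⧸ AddSubgroup.zmultiples (s 0))
        (fun i => (s i.succ : V ⧸ AddSubgroup.zmultiples (s 0))) (fun n hn => by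
          by_contra h0
          have : ((∑ i, n i • s i.succ : V) : V ⧸ AddSubgroup.zmultiples (s 0)) = 0 := by
            rw [← hn]
            exact map_sum (QuotientAddGroup.mk' (AddSubgroup.zmultiples (s 0))) _ _
          rw [QuotientAddGroup.eq_zero_iff, AddSubgroup.mem_zmultiples_iff] at this
          obtain ⟨m, hm⟩ := this
          exact hrel n h0 m hm.symm)
      have hinj : Function.Injective (zmultiplesHom V (s 0)) := by
        rw [injective_iff_map_eq_zero]
        intro m hm
        have hm' : m.natAbs • s 0 = 0 := by
          rcases Int.natAbs_eq m with h | h <;> rw [h] at hm <;> simpa using hm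
        have h := hs (Fin.cons m.natAbs 0) (by rw [Fin.sum_univ_succ]; simpa using hm')
        simpa using congrFun h 0
      obtain ⟨φ, hφ⟩ := (Module.Baer.of_divisible ℚ).extension_property_addMonoidHom
        (zmultiplesHom V (s 0)) hinj (Int.castAddHom ℚ)
      have hφ1 : φ (s 0) = 1 := by simpa using DFunLike.congr_fun hφ 1
      have hN : ∀ i : Fin k, ∃ N : ℕ, ∀ M ≥ N, 0 < M * ℓ (s i.succ) + φ (s i.succ) := fun i => by
        obtain ⟨N, hN⟩ := exists_nat_gt (-φ (s i.succ) / ℓ (s i.succ))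
        refine ⟨N, fun M hM => ?_⟩
        have : (N : ℚ) ≤ M := by exact_mod_cast hM
        have h := (div_lt_iff₀ (hℓ i)).1 (hN.trans_le this)
        linarith
      choose N hN using hN
      -- `φ` takes the value 1 at `s 0`, where the functional from the quotient vanishes. On the
      -- other vectors that functional is positive, so a large multiple of it outweighs `φ`.
      refine ⟨(∑ i, N i) • ℓ.comp (QuotientAddGroup.mk' _) + φ, Fin.cases ?_ fun i => ?_⟩
      · have : (QuotientAddGroup.mk' (AddSubgroup.zmultiples (s 0))) (s 0) = 0 := by
          simp
        rw [AddMonoidHom.add_apply, AddMonoidHom.nsmul_apply, AddMonoidHom.comp_apply, this]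
        simp [hφ1]
      · have := hN i (∑ i, N i) (Finset.single_le_sum (fun _ _ => Nat.zero_le _) (Finset.mem_univ i))
        simpa using this

/-- Only the values on the standard basis matter, so the product of their denominators works. -/
lemma exists_clear_denominators {n : ℕ} (θ : (Fin n → ℤ) →+ ℚ) :
    ∃ d : ℕ, 0 < d ∧ ∃ ℓ : (Fin n → ℤ) →+ ℤ, ∀ a, (ℓ a : ℚ) = d * θ a := by
  let d : ℕ := ∏ i, (θ (Pi.single i 1)).den
  have hd : ∀ i, ∃ z : ℤ, (z : ℚ) = d * θ (Pi.single i 1) := fun i => by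
    obtain ⟨e, he⟩ := Finset.dvd_prod_of_mem (fun i => (θ (Pi.single i 1)).den) (Finset.mem_univ i)
    refine ⟨e * (θ (Pi.single i 1)).num, ?_⟩
    have h1 : (d : ℚ) = (θ (Pi.single i 1)).den * e := by exact_mod_cast he
    rw [h1]
    push_cast
    rw [mul_comm _ (e : ℚ), mul_assoc, Rat.den_mul_eq_num]
  choose z hz using hd
  refine ⟨d, Finset.prod_pos fun i _ => Rat.den_pos _,
    { toFun := fun a => ∑ i, a i * z i, map_zero' := by simp,
      map_add' := fun a b => by simp [add_mul, Finset.sum_add_distrib] }, fun a => ?_⟩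
  have ha : a = ∑ i, a i • Pi.single (M := fun _ => ℤ) i 1 := by
    simpa using pi_eq_sum_univ' a
  conv_rhs => rw [ha]
  simp only [map_sum, map_zsmul, AddMonoidHom.coe_mk, ZeroHom.coe_mk, Finset.mul_sum]
  push_cast
  refine Finset.sum_congr rfl fun i _ => ?_
  rw [hz, zsmul_eq_mul]
  ring

/-! ### Faces -/

section Faces

variable {n : ℕ} {P F G : AddSubmonoid (Fin n → ℤ)}

lemma IsFaceOf.refl (P : AddSubmonoid (Fin n → ℤ)) : IsFaceOf P P :=
  ⟨le_rfl, fun _ hp _ hq _ => ⟨hp, hq⟩⟩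

lemma IsFaceOf.of_le (hF : IsFaceOf F P) (hG : IsFaceOf G P) (h : F ≤ G) : IsFaceOf F G :=
  ⟨h, fun p hp q hq hpq => hF.2 p (hG.1 hp) q (hG.1 hq) hpq⟩

/-- If a sum of generators lies in a face, then so does each summand. Hence a face is determined by
the generators it contains; faces inherit finite generation and are finite in number. -/
lemma IsFaceOf.closure_inter (hF : IsFaceOf F P) {S : Set (Fin n → ℤ)}
    (hS : AddSubmonoid.closure S = P) : AddSubmonoid.closure (S ∩ F) = F := by
  refine le_antisymm (AddSubmonoid.closure_le.2 inter_subset_right) fun p hp => ?_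
  have h : ∀ q ∈ AddSubmonoid.closure S, q ∈ F → q ∈ AddSubmonoid.closure (S ∩ F) := by
    intro q hq
    induction hq using AddSubmonoid.closure_induction with
    | mem x hx => exact fun h => AddSubmonoid.subset_closure ⟨hx, h⟩
    | zero => exact fun _ => zero_mem _
    | add x y hx hy ihx ihy =>
      intro h
      have h2 := hF.2 x (hS ▸ hx) y (hS ▸ hy) h
      exact add_mem (ihx h2.1) (ihy h2.2)
  exact h p (hS ▸ hF.1 hp) hp

lemma IsFaceOf.fg (hF : IsFaceOf F P) (hP : P.FG) : F.FG := by
  classical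
  obtain ⟨S, hS⟩ := hP
  refine ⟨S.filter (· ∈ F), ?_⟩
  rw [← hF.closure_inter hS]
  congr 1
  ext x
  simp [hF.closure_inter hS]

lemma IsFaceOf.isWeaklyToric (hF : IsFaceOf F P) (hP : IsWeaklyToric P) : IsWeaklyToric F where
  fg := hF.fg hP.fg
  saturated p hp m hm h := by
    have h1 : p ∈ P := hP.saturated p (AddSubgroup.closure_mono hF.1 hp) m hm (hF.1 h)
    obtain ⟨k, rfl⟩ : ∃ k, m = k + 1 := ⟨m - 1, by omega⟩
    rw [add_smul, one_smul] at h
    exact (hF.2 _ (P.nsmul_mem h1 k) p h1 h).2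

lemma countable_faces (hP : P.FG) : {F | IsFaceOf F P}.Countable := by
  obtain ⟨S, hS⟩ := hP
  have : MapsTo (fun F : AddSubmonoid (Fin n → ℤ) => (S : Set (Fin n → ℤ)) ∩ F) {F | IsFaceOf F P}
      (𝒫 (S : Set (Fin n → ℤ))) := fun F _ => inter_subset_left
  refine (Set.Finite.of_injOn this ?_ (S.finite_toSet.powerset)).countable
  intro F hF G hG h
  rw [← hF.closure_inter hS, ← hG.closure_inter hS]
  exact congrArg _ h

/-- A face of a finitely generated monoid is cut out by a supporting hyperplane. -/
theorem IsFaceOf.exists_hom (hF : IsFaceOf F P) (hP : P.FG) :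
    ∃ ℓ : (Fin n → ℤ) →+ ℤ, (∀ p ∈ P, 0 ≤ ℓ p) ∧ ∀ p ∈ P, ℓ p = 0 ↔ p ∈ F := by
  classical
  obtain ⟨S, hS⟩ := hP
  let T := S.filter (· ∉ F)
  let K := AddSubgroup.closure (F : Set (Fin n → ℤ))
  let s : Fin T.card → Fin n → ℤ := fun i => T.equivFin.symm i
  have hsT : ∀ i, s i ∈ T := fun i => (T.equivFin.symm i).2
  have hsP : ∀ i, s i ∈ P := fun i => by
    rw [← hS]
    exact AddSubmonoid.subset_closure (Finset.mem_filter.1 (hsT i)).1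
  have hsF : ∀ i, s i ∉ F := fun i => (Finset.mem_filter.1 (hsT i)).2
  -- Gordan's theorem is applied modulo the subgroup generated by `F`. A nontrivial relation there,
  -- after adding an element of `F`, would put a sum involving a generator outside `F` into `F`,
  -- against the face property.
  obtain ⟨θ, hθ⟩ := exists_hom_pos T.card (fun i => (s i : (Fin n → ℤ) ⧸ K)) (fun m hm => by
    have h : ((∑ i, m i • s i : Fin n → ℤ) : (Fin n → ℤ) ⧸ K) = 0 := by
      rw [← hm]
      exact map_sum (QuotientAddGroup.mk' K) _ _
    rw [QuotientAddGroup.eq_zero_iff] at h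
    obtain ⟨f, hf, f', hf', h⟩ := exists_add_eq_of_mem_closure F h
    by_contra hm0
    obtain ⟨j, hj⟩ := Function.ne_iff.1 hm0
    obtain ⟨k, hk⟩ : ∃ k, m j = k + 1 := ⟨m j - 1, by simp at hj; omega⟩
    refine hsF j (hF.2 (s j) (hsP j)
      (k • s j + ∑ i ∈ Finset.univ.erase j, m i • s i + f') ?_ ?_).1
    · exact add_mem (add_mem (P.nsmul_mem (hsP j) k)
        (sum_mem fun i _ => P.nsmul_mem (hsP i) _)) (hF.1 hf')
    · rw [← Finset.add_sum_erase _ _ (Finset.mem_univ j), hk, add_smul, one_smul] at h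
      have : s j + (k • s j + ∑ i ∈ Finset.univ.erase j, m i • s i + f') = f := by
        rw [← h]; abel
      rw [this]; exact hf)
  obtain ⟨d, hd, ℓ, hℓ⟩ := exists_clear_denominators (θ.comp (QuotientAddGroup.mk' K))
  have hF0 : ∀ p ∈ F, ℓ p = 0 := fun p hp => by
    have h : (QuotientAddGroup.mk' K) p = 0 := by
      rw [QuotientAddGroup.mk'_apply, QuotientAddGroup.eq_zero_iff]
      exact AddSubgroup.subset_closure hp
    have := hℓ p
    rw [AddMonoidHom.comp_apply, h] at this
    simpa using this
  have hpos : ∀ p ∈ T, 0 < ℓ p := fun p hp => by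
    have h1 := hθ (T.equivFin ⟨p, hp⟩)
    have h2 := hℓ p
    simp only [s, Equiv.symm_apply_apply] at h1
    have h3 : (0 : ℚ) < d * θ (p : (Fin n → ℤ) ⧸ K) := mul_pos (by exact_mod_cast hd) h1
    have h4 : (0 : ℚ) < ℓ p := by rw [h2]; exact h3
    exact_mod_cast h4
  have key : ∀ p ∈ AddSubmonoid.closure (S : Set (Fin n → ℤ)), 0 ≤ ℓ p ∧ (ℓ p = 0 → p ∈ F) := by
    intro p hp
    induction hp using AddSubmonoid.closure_induction with
    | mem x hx =>
      by_cases hxF : x ∈ F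
      · exact ⟨(hF0 x hxF).ge, fun _ => hxF⟩
      · have := hpos x (Finset.mem_filter.2 ⟨hx, hxF⟩)
        exact ⟨this.le, fun h => absurd h this.ne'⟩
    | zero => exact ⟨by simp, fun _ => F.zero_mem⟩
    | add x y _ _ ihx ihy =>
      rw [map_add]
      exact ⟨add_nonneg ihx.1 ihy.1, fun h =>
        F.add_mem (ihx.2 (by linarith [ihx.1, ihy.1])) (ihy.2 (by linarith [ihx.1, ihy.1]))⟩
  rw [hS] at key
  exact ⟨ℓ, fun p hp => (key p hp).1, fun p hp => ⟨(key p hp).2, hF0 p⟩⟩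

/-- Restriction of additive homomorphisms to a submonoid. -/
def restrictHom {M : Type*} [AddCommMonoid M] (h : F ≤ P) (α : P →+ M) : F →+ M :=
  α.comp (AddSubmonoid.inclusion h)

/-- Divisibility of `ℝ`. This lets b-tangent and b-normal vectors at a corner of the target be
lifted to its base point, where transversality is assumed. -/
lemma restrictHom_surjective (h : F ≤ P) :
    Function.Surjective (restrictHom h : (P →+ ℝ) → (F →+ ℝ)) := by
  intro θ
  obtain ⟨θ', hθ'⟩ := exists_hom_extension F θ
  exact ⟨θ'.comp P.subtype, AddMonoidHom.ext hθ'⟩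

/-- Restriction of real valued homomorphisms to a submonoid, as a linear map. -/
def restrictLinear (h : F ≤ P) : (P →+ ℝ) →ₗ[ℝ] (F →+ ℝ) where
  toFun := restrictHom h
  map_add' _ _ := rfl
  map_smul' _ _ := rfl

/-- Homomorphisms to `ℝ` from a submonoid and from its integral span agree. -/
noncomputable def spanHomEquiv (P : AddSubmonoid (Fin n → ℤ)) :
    (Submodule.span ℤ (P : Set (Fin n → ℤ)) →ₗ[ℤ] ℝ) ≃ₗ[ℝ] (P →+ ℝ) :=
  LinearEquiv.ofBijective
    { toFun := fun f =>
        { toFun := fun p => f ⟨p, Submodule.subset_span p.2⟩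
          map_zero' := f.map_zero
          map_add' := fun p q => f.map_add ⟨p, Submodule.subset_span p.2⟩
            ⟨q, Submodule.subset_span q.2⟩ }
      map_add' := fun _ _ => rfl
      map_smul' := fun _ _ => rfl }
    (by
      constructor
      · intro f f' h
        ext ⟨x, hx⟩
        induction hx using Submodule.span_induction with
        | mem x hx => exact DFunLike.congr_fun h ⟨x, hx⟩
        | zero => exact f.map_zero.trans f'.map_zero.symm
        | add x y hx hy ihx ihy =>
          exact ((f.map_add ⟨x, hx⟩ ⟨y, hy⟩).trans (congrArg₂ _ ihx ihy)).trans
            (f'.map_add ⟨x, hx⟩ ⟨y, hy⟩).symm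
        | smul a x hx ihx =>
          exact ((f.map_smul a ⟨x, hx⟩).trans (congrArg _ ihx)).trans (f'.map_smul a ⟨x, hx⟩).symm
      · intro θ
        obtain ⟨θ', hθ'⟩ := exists_hom_extension P θ
        exact ⟨θ'.toIntLinearMap ∘ₗ (Submodule.span ℤ (P : Set (Fin n → ℤ))).subtype,
          AddMonoidHom.ext hθ'⟩)

instance (P : AddSubmonoid (Fin n → ℤ)) : FiniteDimensional ℝ (P →+ ℝ) :=
  Module.Finite.equiv (spanHomEquiv P)

lemma finrank_hom (P : AddSubmonoid (Fin n → ℤ)) : Module.finrank ℝ (P →+ ℝ) = rank P := by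
  rw [← (spanHomEquiv P).finrank_eq, Module.finrank_linearMap_self]
  rfl

lemma rank_mono (h : F ≤ P) : rank F ≤ rank P := by
  rw [← finrank_hom, ← finrank_hom]
  exact LinearMap.finrank_le_finrank_of_surjective (f := restrictLinear h)
    (restrictHom_surjective h)

lemma finrank_ker_restrictLinear (h : F ≤ P) :
    Module.finrank ℝ (LinearMap.ker (restrictLinear h)) = rank P - rank F := by
  have h1 := LinearMap.finrank_range_add_finrank_ker (restrictLinear h)
  rw [LinearMap.range_eq_top.2 (restrictHom_surjective h), finrank_top, finrank_hom,
    finrank_hom] at h1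
  omega

/-- With equal ranks the restriction `Hom(P, ℝ) → Hom(F, ℝ)` is injective. The supporting functional
of `F` restricts to zero, so it vanishes on all of `P`; but it vanishes only on `F`. -/
lemma IsFaceOf.eq_of_rank_eq (hF : IsFaceOf F P) (hP : P.FG) (h : rank F = rank P) : F = P := by
  refine le_antisymm hF.1 fun p hp => ?_
  obtain ⟨ℓ, -, h0⟩ := hF.exists_hom hP
  have hinj : LinearMap.ker (restrictLinear hF.1) = ⊥ := by
    rw [← Submodule.finrank_eq_zero (R := ℝ), finrank_ker_restrictLinear, h, Nat.sub_self]
  let α : P →+ ℝ := (Int.castAddHom ℝ).comp (ℓ.comp P.subtype)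
  have hα : α ∈ LinearMap.ker (restrictLinear hF.1) := by
    refine LinearMap.mem_ker.2 (AddMonoidHom.ext fun q => ?_)
    have := (h0 q (hF.1 q.2)).2 q.2
    change ((ℓ q : ℤ) : ℝ) = 0
    rw [this, Int.cast_zero]
  rw [hinj, Submodule.mem_bot] at hα
  have : ((ℓ p : ℤ) : ℝ) = 0 := DFunLike.congr_fun hα ⟨p, hp⟩
  exact (h0 p hp).1 (by exact_mod_cast this)

/-- A multiple of every homomorphism from a face to `ℕ` extends to the monoid. -/
lemma IsFaceOf.exists_nat_extension (hF : IsFaceOf F P) (hP : P.FG) (α : F →+ ℕ) :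
    ∃ d : ℕ, 0 < d ∧ ∃ β : P →+ ℕ, restrictHom hF.1 β = d • α := by
  obtain ⟨θ, hθ⟩ := exists_hom_extension F ((Nat.castAddMonoidHom ℚ).comp α)
  obtain ⟨d, hd, m, hm⟩ := exists_clear_denominators θ
  obtain ⟨ℓ, h1, h2⟩ := hF.exists_hom hP
  have hmF : ∀ p : F, m p = d * α p := fun p => by
    have := hm p
    rw [hθ p] at this
    simp only [AddMonoidHom.comp_apply, Nat.coe_castAddMonoidHom] at this
    exact_mod_cast this
  obtain ⟨S, hS⟩ := hP
  let N : ℕ := ∑ s ∈ S, (m s).natAbs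
  -- On generators in `F` the correction vanishes and `m` is already `d * α ≥ 0`. On the others `ℓ`
  -- is a positive integer and `N` exceeds every `|m s|`, so the correction dominates.
  have key : ∀ p ∈ AddSubmonoid.closure (S : Set (Fin n → ℤ)), 0 ≤ m p + N * ℓ p := by
    intro p hp
    induction hp using AddSubmonoid.closure_induction with
    | mem x hx =>
      have hxP : x ∈ P := hS ▸ AddSubmonoid.subset_closure hx
      rcases (h1 x hxP).eq_or_lt with h | h
      · have hxF := (h2 x hxP).1 h.symm
        rw [← h, hmF ⟨x, hxF⟩]
        positivity
      · have hN : (m x).natAbs ≤ N :=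
          Finset.single_le_sum (f := fun s => (m s).natAbs) (fun _ _ => Nat.zero_le _) hx
        have h3 : (N : ℤ) ≤ N * ℓ x := le_mul_of_one_le_right (by positivity) h
        omega
    | zero => simp
    | add x y _ _ ihx ihy => rw [map_add, map_add]; linarith
  rw [hS] at key
  let β : P →+ ℕ :=
    { toFun := fun p => (m p + N * ℓ p).toNat
      map_zero' := by simp
      map_add' := fun p q => by
        rw [← Int.toNat_add (key p p.2) (key q q.2)]
        congr 1
        push_cast
        rw [map_add, map_add]
        ring }
  refine ⟨d, hd, β, AddMonoidHom.ext fun p => ?_⟩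
  change (m p + N * ℓ p).toNat = d • α p
  rw [(h2 p (hF.1 p.2)).2 p.2, hmF p, mul_zero, add_zero, smul_eq_mul]
  exact_mod_cast Int.toNat_natCast (d * α p)

end Faces

/-! ### Topology of the model spaces -/

namespace ModelSpace

variable {n : ℕ} {P F G : AddSubmonoid (Fin n → ℤ)}

lemma mem_supp_iff {x : ModelSpace P} (p : P) : (p : Fin n → ℤ) ∈ x.supp ↔ x.toFun p ≠ 0 :=
  ⟨fun ⟨_, h⟩ => h, fun h => ⟨p.2, h⟩⟩

lemma supp_le (x : ModelSpace P) : x.supp ≤ P := fun _ ⟨h, _⟩ => h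

lemma map_eq_zero {x : ModelSpace P} {p : P} (h : (p : Fin n → ℤ) ∉ x.supp) : x.toFun p = 0 :=
  not_not.1 fun h0 => h ((mem_supp_iff p).2 h0)

lemma supp_isFaceOf (x : ModelSpace P) : IsFaceOf x.supp P := by
  refine ⟨x.supp_le, fun p hp q hq h => ?_⟩
  have h1 := (mem_supp_iff (x := x) (⟨p, hp⟩ + ⟨q, hq⟩)).1 h
  rw [x.map_add] at h1
  exact ⟨⟨hp, left_ne_zero_of_mul h1⟩, ⟨hq, right_ne_zero_of_mul h1⟩⟩

lemma continuous_toFun : Continuous (toFun : ModelSpace P → P → ℝ≥0) := continuous_induced_dom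

lemma continuous_eval (p : P) : Continuous fun x : ModelSpace P => x.toFun p :=
  (continuous_apply p).comp continuous_toFun

lemma tendsto_iff {ι : Type*} {l : Filter ι} {f : ι → ModelSpace P} {x : ModelSpace P} :
    Tendsto f l (𝓝 x) ↔ ∀ p, Tendsto (fun i => (f i).toFun p) l (𝓝 (x.toFun p)) := by
  rw [(Topology.IsInducing.mk rfl : IsInducing (toFun : ModelSpace P → P → ℝ≥0)).tendsto_nhds_iff,
    tendsto_pi_nhds]
  rfl

lemma continuous_iff {T : Type*} [TopologicalSpace T] {f : T → ModelSpace P} :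
    Continuous f ↔ ∀ p, Continuous fun t => (f t).toFun p := by
  simp only [continuous_iff_continuousAt, ContinuousAt, tendsto_iff]
  exact forall_comm

instance : SecondCountableTopology (ModelSpace P) :=
  TopologicalSpace.secondCountableTopology_induced _ _ toFun

/-- Extension by zero from a face. -/
noncomputable def extendZero (hF : IsFaceOf F P) (w : ModelSpace F) : ModelSpace P := by
  classical
  exact
  { toFun := fun p => if h : (p : Fin n → ℤ) ∈ F then w.toFun ⟨p, h⟩ else 0
    map_zero := by
      rw [dif_pos (show ((0 : P) : Fin n → ℤ) ∈ F from F.zero_mem)]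
      exact w.map_zero
    map_add := fun p q => by
      by_cases hp : (p : Fin n → ℤ) ∈ F
      · by_cases hq : (q : Fin n → ℤ) ∈ F
        · rw [dif_pos (show ((p + q : P) : Fin n → ℤ) ∈ F from F.add_mem hp hq), dif_pos hp,
            dif_pos hq]
          exact w.map_add ⟨p, hp⟩ ⟨q, hq⟩
        · rw [dif_neg (show ((p + q : P) : Fin n → ℤ) ∉ F from fun h => hq (hF.2 p p.2 q q.2 h).2), dif_neg hq, mul_zero]
      · rw [dif_neg (show ((p + q : P) : Fin n → ℤ) ∉ F from fun h => hp (hF.2 p p.2 q q.2 h).1), dif_neg hp, zero_mul] }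

lemma extendZero_apply (hF : IsFaceOf F P) (w : ModelSpace F) (p : P)
    (h : (p : Fin n → ℤ) ∈ F) : (extendZero hF w).toFun p = w.toFun ⟨p, h⟩ := dif_pos h

lemma extendZero_apply_of_notMem (hF : IsFaceOf F P) (w : ModelSpace F) (p : P)
    (h : (p : Fin n → ℤ) ∉ F) : (extendZero hF w).toFun p = 0 := dif_neg h

lemma supp_extendZero (hF : IsFaceOf F P) (w : ModelSpace F) :
    (extendZero hF w).supp = w.supp := by
  ext p
  constructor
  · rintro ⟨h, h0⟩
    have hpF : p ∈ F := by
      by_contra hp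
      exact h0 (extendZero_apply_of_notMem hF w ⟨p, h⟩ hp)
    exact ⟨hpF, by rwa [extendZero_apply hF w ⟨p, h⟩ hpF] at h0⟩
  · rintro ⟨h, h0⟩
    exact ⟨hF.1 h, by rwa [extendZero_apply hF w ⟨p, hF.1 h⟩ h]⟩

lemma restrict_extendZero (hF : IsFaceOf F P) (w : ModelSpace F) :
    (extendZero hF w).restrict hF.1 = w :=
  ModelSpace.ext (funext fun p => extendZero_apply hF w ⟨p, hF.1 p.2⟩ p.2)

lemma extendZero_restrict (hF : IsFaceOf F P) {x : ModelSpace P} (h : x.supp ≤ F) :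
    extendZero hF (x.restrict hF.1) = x := by
  refine ModelSpace.ext (funext fun p => ?_)
  by_cases hp : (p : Fin n → ℤ) ∈ F
  · exact extendZero_apply hF _ p hp
  · rw [extendZero_apply_of_notMem hF _ p hp, map_eq_zero fun h' => hp (h h')]

lemma continuous_extendZero (hF : IsFaceOf F P) : Continuous (extendZero hF) := by
  refine continuous_iff.2 fun p => ?_
  by_cases hp : (p : Fin n → ℤ) ∈ F
  · simp only [extendZero_apply hF _ p hp]
    exact continuous_eval _
  · simp only [extendZero_apply_of_notMem hF _ p hp]
    exact continuous_const

lemma continuous_restrict (h : F ≤ P) : Continuous (restrict h) :=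
  continuous_iff.2 fun p => continuous_eval (⟨p, h p.2⟩ : P)

/-- The exponential as a function to `[0,∞)`. -/
noncomputable def expNN (t : ℝ) : ℝ≥0 := ⟨Real.exp t, (Real.exp_pos t).le⟩

@[simp] lemma coe_expNN (t : ℝ) : (expNN t : ℝ) = Real.exp t := rfl

/-- The interior point with logarithmic coordinates `θ`. -/
noncomputable def ofHom (θ : P →+ ℝ) : ModelSpace P where
  toFun p := expNN (θ p)
  map_zero := by ext; simp
  map_add p q := by ext; simp [Real.exp_add]

lemma supp_ofHom (θ : P →+ ℝ) : (ofHom θ).supp = P := by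
  refine le_antisymm (supp_le _) fun p hp => ⟨hp, fun h => ?_⟩
  exact (Real.exp_pos (θ ⟨p, hp⟩)).ne' (congrArg NNReal.toReal h)

/-- The logarithm of `x`, as a homomorphism on its support. -/
noncomputable def logHom (x : ModelSpace P) : x.supp →+ ℝ where
  toFun p := Real.log (x.toFun ⟨p, x.supp_le p.2⟩)
  map_zero' := by
    have : x.toFun ⟨((0 : x.supp) : Fin n → ℤ), x.supp_le (0 : x.supp).2⟩ = 1 := x.map_zero
    rw [this]; simp
  map_add' p q := by
    have h1 : x.toFun ⟨((p + q : x.supp) : Fin n → ℤ), x.supp_le (p + q).2⟩ =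
      x.toFun ⟨p, x.supp_le p.2⟩ * x.toFun ⟨q, x.supp_le q.2⟩ :=
      x.map_add ⟨p, x.supp_le p.2⟩ ⟨q, x.supp_le q.2⟩
    have hp : x.toFun ⟨p, x.supp_le p.2⟩ ≠ 0 := (mem_supp_iff _).1 p.2
    have hq : x.toFun ⟨q, x.supp_le q.2⟩ ≠ 0 := (mem_supp_iff _).1 q.2
    rw [h1, NNReal.coe_mul, Real.log_mul (by exact_mod_cast hp) (by exact_mod_cast hq)]

/-- Every point lies in the closure of the stratum of each face containing its support. -/
lemma mem_closure_supp_eq (hP : P.FG) (hG : IsFaceOf G P) {x : ModelSpace P} (h : x.supp ≤ G) :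
    x ∈ closure {y | y.supp = G} := by
  obtain ⟨θ, hθ⟩ := exists_hom_extension x.supp x.logHom
  obtain ⟨ℓ, hℓ0, hℓ⟩ := (x.supp_isFaceOf.of_le hG h).exists_hom (hG.fg hP)
  -- These points have logarithm `θ - k ℓ` on `G`, with `ℓ` supporting the face `x.supp` of `G`. On
  -- `x.supp` their values are those of `x`; on the rest of `G` they are positive and decay to zero.
  let w : ℕ → ModelSpace P := fun k => extendZero hG
    (ofHom ((θ - k • (Int.castAddHom ℝ).comp ℓ).comp G.subtype))
  have hw : ∀ k, (w k).supp = G := fun k => by rw [supp_extendZero, supp_ofHom]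
  refine mem_closure_of_tendsto (f := w) (b := atTop) (tendsto_iff.2 fun p => ?_)
    (Eventually.of_forall hw)
  by_cases hpG : (p : Fin n → ℤ) ∈ G
  · have hwp : ∀ k, ((w k).toFun p : ℝ) = Real.exp (θ p - k * ℓ p) := fun k => by
      rw [extendZero_apply hG _ p hpG]
      simp [ofHom]
    rw [← NNReal.tendsto_coe]
    simp only [hwp]
    by_cases hp : (p : Fin n → ℤ) ∈ x.supp
    · have h1 : (0 : ℝ) < x.toFun p :=
        NNReal.coe_pos.2 (pos_iff_ne_zero.2 ((mem_supp_iff p).1 hp))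
      have h2 : θ p = Real.log (x.toFun p) := hθ ⟨p, hp⟩
      rw [(hℓ p hpG).2 hp, h2]
      simp [Real.exp_log h1]
    · rw [map_eq_zero hp, NNReal.coe_zero]
      refine Real.tendsto_exp_atBot.comp ?_
      have hpos : (0 : ℝ) < ℓ p := by
        have := (hℓ0 p hpG).lt_of_ne fun h0 => hp ((hℓ p hpG).1 h0.symm)
        exact_mod_cast this
      refine tendsto_atBot_add_const_left _ (θ p) (f := fun k : ℕ => -((k : ℝ) * ℓ p)) ?_
      exact tendsto_neg_atTop_atBot.comp (tendsto_natCast_atTop_atTop.atTop_mul_const hpos)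
  · have h1 : ∀ k, (w k).toFun p = 0 := fun k => extendZero_apply_of_notMem hG _ p hpG
    simp only [h1, map_eq_zero fun h' => hpG (h h')]
    exact tendsto_const_nhds

/-- The support is lower semicontinuous. -/
lemma eventually_supp_le (hP : P.FG) (x : ModelSpace P) : ∀ᶠ y in 𝓝 x, x.supp ≤ y.supp := by
  obtain ⟨S, hS⟩ := x.supp_isFaceOf.fg hP
  have hS' : ∀ s ∈ S, s ∈ x.supp := fun s hs => hS ▸ AddSubmonoid.subset_closure hs
  have : ∀ᶠ y in 𝓝 x, ∀ s ∈ S, s ∈ y.supp := by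
    refine (Finset.eventually_all S).2 fun s hs => ?_
    obtain ⟨h, h0⟩ := hS' s hs
    filter_upwards [(continuous_eval (⟨s, h⟩ : P)).continuousAt.eventually_ne h0] with y hy
    exact ⟨h, hy⟩
  filter_upwards [this] with y hy
  rw [← hS]
  exact AddSubmonoid.closure_le.2 hy

/-- The weighted geometric mean of two points. -/
noncomputable def geomMean (x y : ModelSpace P) (s : ℝ) : ModelSpace P where
  toFun p := x.toFun p ^ (1 - s) * y.toFun p ^ s
  map_zero := by simp [x.map_zero, y.map_zero]
  map_add p q := by
    rw [x.map_add, y.map_add, NNReal.mul_rpow, NNReal.mul_rpow]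
    ring

lemma geomMean_zero (x y : ModelSpace P) : geomMean x y 0 = x :=
  ModelSpace.ext (funext fun p => by simp [geomMean])

lemma geomMean_one (x y : ModelSpace P) : geomMean x y 1 = y :=
  ModelSpace.ext (funext fun p => by simp [geomMean])

lemma geomMean_apply_of_eq_zero {x y : ModelSpace P} {p : P} (hx : x.toFun p = 0)
    (hy : y.toFun p = 0) (s : ℝ) : (geomMean x y s).toFun p = 0 := by
  change x.toFun p ^ (1 - s) * y.toFun p ^ s = 0
  rw [hx, hy]
  by_cases hs : s = 0
  · simp [hs]
  · simp [NNReal.zero_rpow hs]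

lemma supp_geomMean {x y : ModelSpace P} (hx : x.supp = F) (hy : y.supp = F) (s : ℝ) :
    (geomMean x y s).supp = F := by
  ext p
  constructor
  · rintro ⟨hp, h⟩
    by_contra hpF
    exact h (geomMean_apply_of_eq_zero (map_eq_zero (p := ⟨p, hp⟩) (hx ▸ hpF))
      (map_eq_zero (p := ⟨p, hp⟩) (hy ▸ hpF)) s)
  · intro h
    obtain ⟨hp, h1⟩ := hx ▸ h
    have h2 := (mem_supp_iff (x := y) ⟨p, hp⟩).1 (hy ▸ h)
    exact ⟨hp, mul_ne_zero (by simp [NNReal.rpow_eq_zero_iff, h1])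
      (by simp [NNReal.rpow_eq_zero_iff, h2])⟩

/-- Equality of supports is essential: `s ↦ 0 ^ s` jumps at `s = 0`. When both values vanish
together, the product is identically zero, since `1 - s` and `s` are not both zero. -/
lemma continuous_geomMean {x y : ModelSpace P} (h : x.supp = y.supp) :
    Continuous (geomMean x y) := by
  refine continuous_iff.2 fun p => ?_
  by_cases hx : x.toFun p = 0
  · have hy : y.toFun p = 0 := map_eq_zero (h ▸ fun h' => (mem_supp_iff p).1 h' hx)
    simp only [geomMean_apply_of_eq_zero hx hy]
    exact continuous_const
  · have hy : y.toFun p ≠ 0 := (mem_supp_iff p).1 (h ▸ (mem_supp_iff p).2 hx)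
    refine Continuous.mul ?_ ?_ <;> rw [continuous_iff_continuousAt] <;> intro s
    · exact (NNReal.continuousAt_rpow (Or.inl hx)).comp
        (f := fun s : ℝ => (x.toFun p, 1 - s)) (by fun_prop)
    · exact (NNReal.continuousAt_rpow (Or.inl hy)).comp
        (f := fun s : ℝ => (y.toFun p, s)) (by fun_prop)

lemma rpow_mul_rpow_self (a : ℝ≥0) (s : ℝ) : a ^ (1 - s) * a ^ s = a := by
  by_cases ha : a = 0
  · by_cases hs : s = 0
    · simp [hs]
    · simp [ha, NNReal.zero_rpow hs]
  · rw [← NNReal.rpow_add ha]; simp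

/-- A geometric mean lies between the minimum and the maximum, so boxes of intervals are stable
under the paths that connect a stratum. -/
lemma geomMean_mem {I : Set ℝ≥0} (hI : I.OrdConnected) {x y : ModelSpace P} {p : P}
    (hx : x.toFun p ∈ I) (hy : y.toFun p ∈ I) {s : ℝ} (hs : s ∈ Icc (0 : ℝ) 1) :
    (geomMean x y s).toFun p ∈ I := by
  refine hI.uIcc_subset hx hy ⟨?_, ?_⟩
  · conv_lhs => rw [← rpow_mul_rpow_self (x.toFun p ⊓ y.toFun p) s]
    exact mul_le_mul' (NNReal.rpow_le_rpow inf_le_left (by linarith [hs.2]))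
      (NNReal.rpow_le_rpow inf_le_right hs.1)
  · conv_rhs => rw [← rpow_mul_rpow_self (x.toFun p ⊔ y.toFun p) s]
    exact mul_le_mul' (NNReal.rpow_le_rpow le_sup_left (by linarith [hs.2]))
      (NNReal.rpow_le_rpow le_sup_right hs.1)

/-- Every point has arbitrarily small open neighbourhoods that meet each stratum in a
connected set. -/
lemma exists_nhds_isPreconnected {x : ModelSpace P} {V : Set (ModelSpace P)} (hV : V ∈ 𝓝 x) :
    ∃ W ⊆ V, IsOpen W ∧ x ∈ W ∧ ∀ F, IsPreconnected (W ∩ {y | y.supp = F}) := by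
  rw [nhds_induced, nhds_pi, mem_comap] at hV
  obtain ⟨t, ht, htV⟩ := hV
  obtain ⟨I, hI, u, hu, hut⟩ := Filter.mem_pi.1 ht
  have hB : ∀ p, ∃ B ⊆ u p, IsOpen B ∧ x.toFun p ∈ B ∧ B.OrdConnected := fun p => by
    obtain ⟨ε, hε, hb⟩ := Metric.mem_nhds_iff.1 (hu p)
    refine ⟨_, hb, Metric.isOpen_ball, Metric.mem_ball_self hε, ?_⟩
    have : Metric.ball (x.toFun p) ε = NNReal.toReal ⁻¹' Ioo (x.toFun p - ε) (x.toFun p + ε) := by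
      rw [← Real.ball_eq_Ioo]; rfl
    rw [this]
    exact ordConnected_Ioo.preimage_mono NNReal.coe_mono
  choose B hBu hBo hBx hB using hB
  refine ⟨⋂ p ∈ I, (fun y : ModelSpace P => y.toFun p) ⁻¹' B p, ?_, ?_, ?_, fun F => ?_⟩
  · intro y hy
    refine htV (hut ?_)
    intro p hp
    exact hBu p (mem_iInter₂.1 hy p hp)
  · exact hI.isOpen_biInter fun p _ => (hBo p).preimage (continuous_eval p)
  · exact mem_iInter₂.2 fun p _ => hBx p
  -- Two points of the box with the same support are joined by their path of geometric means, which
  -- keeps both the box and the support.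
  · refine isPreconnected_of_forall_pair fun y hy y' hy' =>
      ⟨geomMean y y' '' Icc 0 1, ?_, ⟨0, by simp, geomMean_zero y y'⟩,
        ⟨1, by simp, geomMean_one y y'⟩, isPreconnected_Icc.image _
          (continuous_geomMean (hy.2.trans hy'.2.symm)).continuousOn⟩
    rintro _ ⟨s, hs, rfl⟩
    exact ⟨mem_iInter₂.2 fun p hp => geomMean_mem (hB p) (mem_iInter₂.1 hy.1 p hp)
      (mem_iInter₂.1 hy'.1 p hp) hs, supp_geomMean hy.2 hy'.2 s⟩

/-- The flow of the vector field on `X_P` with constant logarithmic velocity `α`. -/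
noncomputable def flow (α : P →+ ℝ) (x : ModelSpace P) (t : ℝ) : ModelSpace P where
  toFun p := x.toFun p * expNN (t * α p)
  map_zero := by ext; simp [x.map_zero]
  map_add p q := by ext; simp [x.map_add, mul_add, Real.exp_add]; ring

lemma flow_apply (α : P →+ ℝ) (x : ModelSpace P) (t : ℝ) (p : P) :
    ((flow α x t).toFun p : ℝ) = x.toFun p * Real.exp (t * α p) := rfl

lemma flow_zero (α : P →+ ℝ) (x : ModelSpace P) : flow α x 0 = x :=
  ModelSpace.ext (funext fun p => by ext; simp [flow_apply])

lemma continuous_flow (α : P →+ ℝ) (x : ModelSpace P) : Continuous (flow α x) := by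
  refine continuous_iff.2 fun p => ?_
  rw [NNReal.isEmbedding_coe.continuous_iff]
  change Continuous fun t => (x.toFun p : ℝ) * Real.exp (t * α p)
  fun_prop

end ModelSpace

/-! ### Local structure of charts -/

namespace GChart

variable {X : Type*} [TopologicalSpace X] {c : GChart X} {x : X}

/-- The points of the chart with support a given face. -/
def faceStratum (c : GChart X) (F : AddSubmonoid (Fin c.n → ℤ)) : Set X :=
  {y | y ∈ c.source ∧ (c.coord y).supp = F}

namespace IsValid

lemma source_mem_nhds (hc : c.IsValid) (hx : x ∈ c.source) : c.source ∈ 𝓝 x :=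
  hc.isOpen_source.mem_nhds hx

lemma injOn (hc : c.IsValid) : InjOn c.coord c.source :=
  injOn_iff_injective.2 hc.isOpenEmbedding.injective

lemma map_nhds (hc : c.IsValid) (hx : x ∈ c.source) : map c.coord (𝓝 x) = 𝓝 (c.coord x) := by
  have h := hc.isOpenEmbedding.map_nhds_eq ⟨x, hx⟩
  rw [← hc.isOpen_source.nhdsWithin_eq hx, nhdsWithin_eq_map_subtype_coe hx, map_map]
  exact h

lemma continuousAt (hc : c.IsValid) (hx : x ∈ c.source) : ContinuousAt c.coord x :=
  (hc.map_nhds hx).le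

lemma eventually_coord (hc : c.IsValid) (hx : x ∈ c.source) {p : ModelSpace c.P → Prop} :
    (∀ᶠ y in 𝓝 x, p (c.coord y)) ↔ ∀ᶠ u in 𝓝 (c.coord x), p u := by
  rw [← hc.map_nhds hx, eventually_map]

/-- The chart has a continuous local inverse. -/
lemma exists_inverse [Nonempty X] (hc : c.IsValid) : ∃ j : ModelSpace c.P → X,
    (∀ y ∈ c.source, j (c.coord y) = y) ∧ ∀ y ∈ c.source, ContinuousAt j (c.coord y) := by
  have hj : ∀ y ∈ c.source, Function.invFunOn c.coord c.source (c.coord y) = y := fun y hy =>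
    hc.injOn.leftInvOn_invFunOn hy
  refine ⟨Function.invFunOn c.coord c.source, hj, fun y hy => ?_⟩
  rw [ContinuousAt, ← hc.map_nhds hy, tendsto_map'_iff, hj y hy]
  refine tendsto_id.congr' ?_
  filter_upwards [hc.source_mem_nhds hy] with z hz using (hj z hz).symm

lemma mem_closure_faceStratum (hc : c.IsValid) (hx : x ∈ c.source)
    {F : AddSubmonoid (Fin c.n → ℤ)} (hF : IsFaceOf F c.P) (h : (c.coord x).supp ≤ F) :
    x ∈ closure (c.faceStratum F) := by
  refine mem_closure_iff_nhds.2 fun V hV => ?_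
  have h1 : c.coord '' (V ∩ c.source) ∈ 𝓝 (c.coord x) := by
    rw [← hc.map_nhds hx]
    exact image_mem_map (inter_mem hV (hc.source_mem_nhds hx))
  obtain ⟨_, ⟨y, hy, rfl⟩, hyF⟩ := mem_closure_iff_nhds.1
    (ModelSpace.mem_closure_supp_eq hc.weaklyToric.fg hF h) _ h1
  exact ⟨y, hy.1, hy.2, hyF⟩

lemma eventually_supp_le (hc : c.IsValid) (hx : x ∈ c.source) :
    ∀ᶠ y in 𝓝 x, (c.coord x).supp ≤ (c.coord y).supp :=
  (hc.eventually_coord hx).2 (ModelSpace.eventually_supp_le hc.weaklyToric.fg _)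

lemma supp_le_of_mem_closure (hc : c.IsValid) (hx : x ∈ c.source)
    {F : AddSubmonoid (Fin c.n → ℤ)} (h : x ∈ closure (c.faceStratum F)) :
    (c.coord x).supp ≤ F := by
  obtain ⟨y, hy, hyF⟩ := mem_closure_iff_nhds.1 h _ (hc.eventually_supp_le hx)
  exact hy.trans_eq hyF.2

/-- Every point has arbitrarily small open neighbourhoods that meet each stratum in a
connected set. -/
lemma exists_nhds_isPreconnected (hc : c.IsValid) (hx : x ∈ c.source) {V : Set X} (hV : V ∈ 𝓝 x) :
    ∃ W ⊆ V, W ⊆ c.source ∧ IsOpen W ∧ x ∈ W ∧ ∀ F, IsPreconnected (W ∩ c.faceStratum F) := by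
  have : Nonempty X := ⟨x⟩
  obtain ⟨j, hj, hjc⟩ := hc.exists_inverse
  obtain ⟨O, hOV, hO, hxO⟩ := mem_nhds_iff.1 (inter_mem hV (hc.source_mem_nhds hx))
  have h1 : c.coord '' O ∈ 𝓝 (c.coord x) := by
    rw [← hc.map_nhds hx]
    exact image_mem_map (hO.mem_nhds hxO)
  obtain ⟨W, hW, hWo, hxW, hWc⟩ := ModelSpace.exists_nhds_isPreconnected h1
  have himg : ∀ y ∈ c.source, c.coord y ∈ W → y ∈ O := fun y hy hyW => by
    obtain ⟨z, hz, hzy⟩ := hW hyW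
    rwa [← hc.injOn (hOV hz).2 hy hzy]
  refine ⟨c.source ∩ c.coord ⁻¹' W, fun y hy => (hOV (himg y hy.1 hy.2)).1, inter_subset_left,
    ?_, ⟨hx, hxW⟩, fun F => ?_⟩
  · refine isOpen_iff_mem_nhds.2 fun y hy => inter_mem (hc.source_mem_nhds hy.1) ?_
    exact (hc.continuousAt hy.1).preimage_mem_nhds (hWo.mem_nhds hy.2)
  · have : c.source ∩ c.coord ⁻¹' W ∩ c.faceStratum F = j '' (W ∩ {u | u.supp = F}) := by
      ext y
      constructor
      · rintro ⟨⟨h1, h2⟩, -, h3⟩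
        exact ⟨c.coord y, ⟨h2, h3⟩, hj y h1⟩
      · rintro ⟨u, ⟨hu, huF⟩, rfl⟩
        obtain ⟨z, hz, rfl⟩ := hW hu
        rw [hj z (hOV hz).2]
        exact ⟨⟨(hOV hz).2, hu⟩, (hOV hz).2, huF⟩
    rw [this]
    refine (hWc F).image _ fun u hu => ?_
    obtain ⟨z, hz, rfl⟩ := hW hu.1
    exact (hjc z (hOV hz).2).continuousWithinAt

end IsValid

/-- In coordinates, a smooth map sends strata near `x` to strata, and preserves their order. -/
lemma exists_nhds_supp_le {n : ℕ} {Q : AddSubmonoid (Fin n → ℤ)} (hQ : Q.FG)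
    {D : X → ModelSpace Q} (hD : ∀ q, c.SmoothNN (fun y => (D y).toFun q) x) :
    ∃ V, IsOpen V ∧ x ∈ V ∧ ∀ y ∈ V, ∀ y' ∈ V, (c.coord y).supp ≤ (c.coord y').supp →
      (D y).supp ≤ (D y').supp := by
  obtain ⟨S, hS⟩ := hQ
  have hSQ : ∀ s ∈ S, s ∈ Q := fun s hs => hS ▸ AddSubmonoid.subset_closure hs
  have hp : ∀ q : Q, ∃ V ∈ 𝓝 x, ∀ y ∈ V, ∀ y' ∈ V, (c.coord y).supp ≤ (c.coord y').supp →
      (D y).toFun q ≠ 0 → (D y').toFun q ≠ 0 := by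
    intro q
    -- Since `h` is positive, the pullback of `λ_q` vanishes near `x` exactly where `λ_p` does, so
    -- its vanishing depends only on the support in `c`.
    rcases hD q with h0 | ⟨p, h, -, hh0, hb⟩
    · exact ⟨_, h0, fun y hy y' _ _ hne => absurd hy hne⟩
    · refine ⟨_, inter_mem hh0 hb, fun y hy y' hy' hle hne => ?_⟩
      have h1 : (c.coord y).toFun p ≠ 0 := fun h1 => by
        have := hy.2
        simp only [mem_ofPred_eq, h1, NNReal.coe_zero, zero_mul, NNReal.coe_eq_zero] at this
        exact hne this
      have h2 := (ModelSpace.mem_supp_iff p).1 (hle ((ModelSpace.mem_supp_iff p).2 h1))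
      have h3 : ((D y').toFun q : ℝ) ≠ 0 := by
        rw [hy'.2]
        exact mul_ne_zero (by exact_mod_cast h2) hy'.1.ne'
      exact_mod_cast h3
  choose V hV hV' using hp
  -- The neighbourhood found above depends on `q`. A face is generated by the generators of `Q` it
  -- contains, so a finite intersection suffices.
  obtain ⟨W, hW, hWo, hxW⟩ := mem_nhds_iff.1
    ((Filter.biInter_finset_mem (s := fun s : S => V ⟨s, hSQ s s.2⟩) S.attach).2
      fun s _ => hV ⟨s, hSQ s s.2⟩)
  refine ⟨W, hWo, hxW, fun y hy y' hy' hle => ?_⟩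
  have hgen := (D y).supp_isFaceOf.closure_inter hS
  rw [← hgen]
  refine AddSubmonoid.closure_le.2 fun s hs => ⟨hSQ s hs.1, ?_⟩
  exact hV' ⟨s, hSQ s hs.1⟩ y (mem_iInter₂.1 (hW hy) ⟨s, hs.1⟩ (Finset.mem_attach _ _)) y'
    (mem_iInter₂.1 (hW hy') ⟨s, hs.1⟩ (Finset.mem_attach _ _)) hle
    ((ModelSpace.mem_supp_iff ⟨s, hSQ s hs.1⟩).1 hs.2)

end GChart

/-! ### Smooth expressions in the coordinate functions -/

/-- A smooth function of finitely many of the coordinate functions `λ_r` on `X_P`. -/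
structure SmoothExpr {n : ℕ} (P : AddSubmonoid (Fin n → ℤ)) where
  ι : Type
  [fintype : Fintype ι]
  r : ι → P
  g : (ι → ℝ) → ℝ
  contDiff : ContDiff ℝ ∞ g

namespace SmoothExpr

attribute [instance] SmoothExpr.fintype

variable {n : ℕ} {P F : AddSubmonoid (Fin n → ℤ)}

/-- The function on `X_P` given by the expression. -/
def eval (e : SmoothExpr P) (u : ModelSpace P) : ℝ := e.g fun i => (u.toFun (e.r i) : ℝ)

/-- The derivative of the expression along the vector field with logarithmic velocity `α`. -/
noncomputable def deriv (e : SmoothExpr P) (α : P →+ ℝ) (u : ModelSpace P) : ℝ :=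
  fderiv ℝ e.g (fun i => (u.toFun (e.r i) : ℝ)) fun i => (u.toFun (e.r i) : ℝ) * α (e.r i)

lemma continuous_coords (e : SmoothExpr P) :
    Continuous fun (u : ModelSpace P) i => (u.toFun (e.r i) : ℝ) :=
  continuous_pi fun _ => NNReal.continuous_coe.comp (ModelSpace.continuous_eval _)

lemma continuous_eval (e : SmoothExpr P) : Continuous e.eval :=
  e.contDiff.continuous.comp e.continuous_coords

lemma continuous_deriv (e : SmoothExpr P) (α : P →+ ℝ) : Continuous (e.deriv α) := by
  refine ((e.contDiff.continuous_fderiv (by simp)).comp e.continuous_coords).clm_apply ?_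
  exact continuous_pi fun i =>
    (NNReal.continuous_coe.comp (ModelSpace.continuous_eval _)).mul continuous_const

lemma hasDerivAt (e : SmoothExpr P) (α : P →+ ℝ) (u : ModelSpace P) :
    HasDerivAt (fun t => e.eval (ModelSpace.flow α u t)) (e.deriv α u) 0 := by
  have h1 : HasDerivAt (fun (t : ℝ) i => ((ModelSpace.flow α u t).toFun (e.r i) : ℝ))
      (fun i => (u.toFun (e.r i) : ℝ) * α (e.r i)) 0 := by
    rw [hasDerivAt_pi]
    intro i
    simp only [ModelSpace.flow_apply]
    have := (((hasDerivAt_id (0 : ℝ)).mul_const (α (e.r i))).exp).const_mul (u.toFun (e.r i) : ℝ)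
    simpa using this
  have h2 := ((e.contDiff.differentiable (by simp)).differentiableAt
    (x := fun i => ((ModelSpace.flow α u 0).toFun (e.r i) : ℝ))).hasFDerivAt.comp_hasDerivAt 0 h1
  rw [ModelSpace.flow_zero] at h2
  exact h2

/-- The velocity of `λ_r` is `λ_r · α r`, and one of the two factors is zero. Hence b-normal
directions do not see the factor `exp e` of a germ. -/
lemma deriv_eq_zero (e : SmoothExpr P) {α : P →+ ℝ} {u : ModelSpace P}
    (h : ∀ p : P, u.toFun p ≠ 0 → α p = 0) : e.deriv α u = 0 := by
  have : (fun i => (u.toFun (e.r i) : ℝ) * α (e.r i)) = 0 := by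
    funext i
    by_cases h0 : u.toFun (e.r i) = 0
    · simp [h0]
    · simp [h _ h0]
  rw [deriv, this, map_zero]

/-- The sum of two expressions. -/
def add (e e' : SmoothExpr P) : SmoothExpr P where
  ι := e.ι ⊕ e'.ι
  r := Sum.elim e.r e'.r
  g v := e.g (fun i => v (Sum.inl i)) + e'.g (fun i => v (Sum.inr i))
  contDiff := (e.contDiff.comp (contDiff_pi.2 fun _ => contDiff_apply ℝ ℝ _)).add
    (e'.contDiff.comp (contDiff_pi.2 fun _ => contDiff_apply ℝ ℝ _))

lemma eval_add (e e' : SmoothExpr P) (u : ModelSpace P) :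
    (e.add e').eval u = e.eval u + e'.eval u := rfl

lemma deriv_add (e e' : SmoothExpr P) (α : P →+ ℝ) (u : ModelSpace P) :
    (e.add e').deriv α u = e.deriv α u + e'.deriv α u :=
  ((e.add e').hasDerivAt α u).unique ((e.hasDerivAt α u).add (e'.hasDerivAt α u))

open Classical in
/-- Restriction of an expression to the closed stratum `X_F ⊆ X_P` of a face. -/
noncomputable def restrict (e : SmoothExpr P) (F : AddSubmonoid (Fin n → ℤ)) : SmoothExpr F where
  ι := e.ι
  r i := if h : (e.r i : Fin n → ℤ) ∈ F then ⟨e.r i, h⟩ else 0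
  g v := e.g fun i => if (e.r i : Fin n → ℤ) ∈ F then v i else 0
  contDiff := e.contDiff.comp (contDiff_pi.2 fun i => by
    by_cases h : (e.r i : Fin n → ℤ) ∈ F
    · simp only [if_pos h]; exact contDiff_apply ℝ ℝ _
    · simp only [if_neg h]; exact contDiff_const)

lemma eval_restrict (hF : IsFaceOf F P) (e : SmoothExpr P) (w : ModelSpace F) :
    (e.restrict F).eval w = e.eval (ModelSpace.extendZero hF w) := by
  refine congrArg e.g (funext fun i => ?_)
  by_cases h : (e.r i : Fin n → ℤ) ∈ F
  · simp only [restrict, dif_pos h, if_pos h]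
    rw [ModelSpace.extendZero_apply hF w _ h]
  · simp only [if_neg h]
    rw [ModelSpace.extendZero_apply_of_notMem hF w _ h, NNReal.coe_zero]

lemma flow_extendZero (hF : IsFaceOf F P) (α : P →+ ℝ) (w : ModelSpace F) (t : ℝ) :
    ModelSpace.flow α (ModelSpace.extendZero hF w) t =
      ModelSpace.extendZero hF (ModelSpace.flow (restrictHom hF.1 α) w t) := by
  refine ModelSpace.ext (funext fun p => ?_)
  by_cases h : (p : Fin n → ℤ) ∈ F
  · rw [ModelSpace.extendZero_apply hF _ p h]
    change (ModelSpace.extendZero hF w).toFun p * _ = _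
    rw [ModelSpace.extendZero_apply hF _ p h]
    rfl
  · rw [ModelSpace.extendZero_apply_of_notMem hF _ p h]
    change (ModelSpace.extendZero hF w).toFun p * _ = _
    rw [ModelSpace.extendZero_apply_of_notMem hF _ p h, zero_mul]

/-- The flow of `α` preserves the closed stratum `X_F` and is there the flow of the restriction of
`α`. -/
lemma deriv_restrict (hF : IsFaceOf F P) (e : SmoothExpr P) (α : P →+ ℝ) (w : ModelSpace F) :
    (e.restrict F).deriv (restrictHom hF.1 α) w = e.deriv α (ModelSpace.extendZero hF w) := by
  have h := (e.restrict F).hasDerivAt (restrictHom hF.1 α) w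
  simp only [eval_restrict hF, ← flow_extendZero] at h
  exact h.unique (e.hasDerivAt α _)

/-- The logarithmic derivative of a germ `λ_p · exp e` does not depend on its presentation. -/
lemma logDeriv_unique (hP : P.FG) {u₀ : ModelSpace P} {p p' : P} {e e' : SmoothExpr P}
    (h : ∀ᶠ u in 𝓝 u₀, (u.toFun p : ℝ) * Real.exp (e.eval u) =
      u.toFun p' * Real.exp (e'.eval u)) (α : P →+ ℝ) :
    α p + e.deriv α u₀ = α p' + e'.deriv α u₀ := by
  obtain ⟨V, hV, hVo, hu₀⟩ := eventually_nhds_iff.1 h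
  have hcl : u₀ ∈ closure ({u | u.supp = P} ∩ V) := IsOpen.closure_inter hVo
    ⟨ModelSpace.mem_closure_supp_eq hP (IsFaceOf.refl P) u₀.supp_le, hu₀⟩
  -- At interior points the logarithm is defined and can be differentiated along the flow. Interior
  -- points are dense and both sides are continuous, so the identity extends to `u₀`, where `λ_p`
  -- may vanish.
  have key : {u | u.supp = P} ∩ V ⊆ {u | α p + e.deriv α u = α p' + e'.deriv α u} := by
    rintro u ⟨hu, huV⟩
    have hpos : ∀ q : P, (0 : ℝ) < u.toFun q := fun q =>
      NNReal.coe_pos.2 (pos_iff_ne_zero.2 ((ModelSpace.mem_supp_iff q).1 (hu.ge q.2)))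
    have hlog : ∀ (q : P) (k : SmoothExpr P), HasDerivAt
        (fun t => Real.log ((ModelSpace.flow α u t).toFun q *
          Real.exp (k.eval (ModelSpace.flow α u t)))) (α q + k.deriv α u) 0 := fun q k => by
      have h1 : HasDerivAt (fun t => Real.log (u.toFun q) + t * α q +
          k.eval (ModelSpace.flow α u t)) (α q + k.deriv α u) 0 := by
        have h0 : HasDerivAt (fun t => Real.log (u.toFun q) + t * α q) (α q) 0 := by
          simpa using ((hasDerivAt_id (0 : ℝ)).mul_const (α q)).const_add (Real.log (u.toFun q))
        exact h0.add (k.hasDerivAt α u)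
      convert h1 using 2 with t
      rw [ModelSpace.flow_apply, Real.log_mul (mul_pos (hpos q) (Real.exp_pos _)).ne'
        (Real.exp_pos _).ne', Real.log_mul (hpos q).ne' (Real.exp_pos _).ne', Real.log_exp,
        Real.log_exp]
    have hflow : ∀ᶠ t in 𝓝 (0 : ℝ), ModelSpace.flow α u t ∈ V :=
      (ModelSpace.continuous_flow α u).continuousAt.preimage_mem_nhds
        (hVo.mem_nhds (by rwa [ModelSpace.flow_zero]))
    refine (hlog p e).unique ((hlog p' e').congr_of_eventuallyEq ?_)
    filter_upwards [hflow] with t ht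
    rw [hV _ ht]
  have hclosed : IsClosed {u | α p + e.deriv α u = α p' + e'.deriv α u} :=
    isClosed_eq (continuous_const.add (e.continuous_deriv α))
      (continuous_const.add (e'.continuous_deriv α))
  exact hclosed.closure_subset_iff.2 key hcl

end SmoothExpr

/-! ### Hadamard's lemma -/

open MeasureTheory in
-- The integral is the value at 0 of the convolution of the indicator of `(0, 1]` with `s ↦ F (y,
-- -s)`, cut off by a bump function to obtain compact support.
lemma contDiff_integral_param {E : Type*} [NormedAddCommGroup E] [NormedSpace ℝ E] {F : E × ℝ → ℝ}
    (hF : ContDiff ℝ ∞ F) : ContDiff ℝ ∞ fun y => ∫ t in (0 : ℝ)..1, F (y, t) := by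
  -- The bump equals 1 on `[-3/2, 1/2]`, which contains every `-t` with `t ∈ (0, 1]`.
  let χ : ContDiffBump (-(1 / 2) : ℝ) := ⟨1, 2, one_pos, one_lt_two⟩
  let f : ℝ → ℝ := indicator (Ioc 0 1) fun _ => 1
  have hf : LocallyIntegrable f volume :=
    ((integrable_indicator_iff measurableSet_Ioc).2
      (integrableOn_const (by simp))).locallyIntegrable
  have h := contDiffOn_convolution_right_with_param_comp (μ := volume) (n := ⊤)
    (ContinuousLinearMap.mul ℝ ℝ) (s := (univ : Set E)) (v := fun _ => (0 : ℝ)) contDiffOn_const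
    (f := f) (g := fun y s => χ s * F (y, -s)) isOpen_univ χ.hasCompactSupport.isCompact
    (fun y s _ hs => by rw [image_eq_zero_of_notMem_tsupport hs, zero_mul]) hf
    ((χ.contDiff.comp contDiff_snd).mul
      (hF.comp (contDiff_fst.prodMk contDiff_snd.neg))).contDiffOn
  rw [contDiffOn_univ] at h
  convert h using 2 with y
  rw [convolution_def, intervalIntegral.integral_of_le zero_le_one,
    ← integral_indicator measurableSet_Ioc]
  refine integral_congr_ae (Eventually.of_forall fun t => ?_)
  by_cases ht : t ∈ Ioc (0 : ℝ) 1
  · have hχ : χ (0 - t) = 1 := by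
      refine χ.one_of_mem_closedBall ?_
      rw [Metric.mem_closedBall, Real.dist_eq, abs_le]
      constructor <;> simp only [χ] <;> linarith [ht.1, ht.2]
    simp only [f, indicator_of_mem ht, ContinuousLinearMap.mul_apply', hχ]
    simp
  · simp [f, indicator_of_notMem ht]

/-- Hadamard's lemma. -/
theorem hadamard {ι : Type*} [Fintype ι] [DecidableEq ι] {g : (ι → ℝ) → ℝ} (hg : ContDiff ℝ ∞ g)
    (y₀ : ι → ℝ) : ∃ G : ι → (ι → ℝ) → ℝ, (∀ i, ContDiff ℝ ∞ (G i)) ∧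
      (∀ y, g y = g y₀ + ∑ i, (y i - y₀ i) * G i y) ∧
      ∀ i, G i y₀ = fderiv ℝ g y₀ (Pi.single i 1) := by
  have hdg : ContDiff ℝ ∞ (fderiv ℝ g) := hg.fderiv_right (by simp)
  have hsm : ∀ i, ContDiff ℝ ∞ fun p : (ι → ℝ) × ℝ =>
      fderiv ℝ g (y₀ + p.2 • (p.1 - y₀)) (Pi.single i 1) := fun i =>
    (hdg.comp (contDiff_const.add (contDiff_snd.smul (contDiff_fst.sub contDiff_const)))).clm_apply
      contDiff_const
  refine ⟨fun i y => ∫ t in (0 : ℝ)..1, fderiv ℝ g (y₀ + t • (y - y₀)) (Pi.single i 1),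
    fun i => contDiff_integral_param (hsm i), fun y => ?_, fun i => by simp⟩
  have hder : ∀ t ∈ uIcc (0 : ℝ) 1, HasDerivAt (fun t : ℝ => g (y₀ + t • (y - y₀)))
      (fderiv ℝ g (y₀ + t • (y - y₀)) (y - y₀)) t := fun t _ => by
    have h1 : HasDerivAt (fun t : ℝ => y₀ + t • (y - y₀)) (y - y₀) t := by
      simpa using ((hasDerivAt_id t).smul_const (y - y₀)).const_add y₀
    exact ((hg.differentiable (by simp)).differentiableAt).hasFDerivAt.comp_hasDerivAt t h1
  have hsum : ∀ t : ℝ, fderiv ℝ g (y₀ + t • (y - y₀)) (y - y₀) =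
      ∑ i, (y i - y₀ i) * fderiv ℝ g (y₀ + t • (y - y₀)) (Pi.single i 1) := fun t => by
    have h : ∀ L : (ι → ℝ) →L[ℝ] ℝ, L (y - y₀) = ∑ i, (y i - y₀ i) * L (Pi.single i 1) := fun L => by
      conv_lhs => rw [pi_eq_sum_univ' (y - y₀)]
      simp
    exact h _
  have hcont : ∀ i, Continuous fun t : ℝ =>
      fderiv ℝ g (y₀ + t • (y - y₀)) (Pi.single i 1) := fun i =>
    (hsm i).continuous.comp (Continuous.prodMk_right y)
  have h := intervalIntegral.integral_eq_sub_of_hasDerivAt hder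
    (Continuous.intervalIntegrable (by
      simp only [hsum]
      exact continuous_finsetSum _ fun i _ => continuous_const.mul (hcont i)) 0 1)
  simp only [hsum] at h
  rw [intervalIntegral.integral_finsetSum fun i _ => Continuous.intervalIntegrable
    (u := fun t : ℝ => (y i - y₀ i) * fderiv ℝ g (y₀ + t • (y - y₀)) (Pi.single i 1))
    (continuous_const.mul (hcont i)) 0 1] at h
  simp only [intervalIntegral.integral_const_mul, one_smul, zero_smul, add_zero,
    add_sub_cancel] at h
  linarith

/-- A globally defined smooth function that agrees with the logarithm near a positive number. -/
lemma exists_contDiff_eventuallyEq_log {s : ℝ} (hs : 0 < s) :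
    ∃ ψ : ℝ → ℝ, ContDiff ℝ ∞ ψ ∧ ∀ᶠ t in 𝓝 s, ψ t = Real.log t := by
  -- The cutoff vanishes below `s / 2`, hence near 0, the only place where `log` fails to be smooth.
  let χ : ContDiffBump s := ⟨s / 4, s / 2, by positivity, by linarith⟩
  refine ⟨fun t => χ t * Real.log t, contDiff_iff_contDiffAt.2 fun t => ?_, ?_⟩
  · by_cases ht : t = 0
    · have h0 : ∀ᶠ u in 𝓝 t, χ u * Real.log u = 0 := by
        have : ∀ᶠ u in 𝓝 t, u < s / 2 := gt_mem_nhds (by rw [ht]; positivity)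
        filter_upwards [this] with u hu
        rw [χ.zero_of_le_dist, zero_mul]
        rw [Real.dist_eq, abs_sub_comm, abs_of_pos (by linarith)]
        change s / 2 ≤ _
        linarith
      exact contDiffAt_const.congr_of_eventuallyEq h0
    · exact χ.contDiffAt.mul (Real.contDiffAt_log.2 ht)
  · filter_upwards [χ.eventuallyEq_one] with t ht
    rw [ht]
    simp

/-! ### Germs in coordinates -/

namespace GChart

variable {X : Type*} [TopologicalSpace X] {c : GChart X} {x : X}

lemma SmoothReal.comp_fintype {ι : Type*} [Fintype ι] {a : ι → X → ℝ}
    (ha : ∀ i, c.SmoothReal (a i) x) {g : (ι → ℝ) → ℝ} (hg : ContDiff ℝ ∞ g) {b : X → ℝ}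
    (hb : ∀ᶠ y in 𝓝 x, b y = g fun i => a i y) : c.SmoothReal b x := by
  let e := Fintype.equivFin ι
  refine SmoothReal.comp (a := fun i => a (e.symm i)) (fun i => ha _)
    (g := fun v => g fun i => v (e i))
    (hg.comp (contDiff_pi.2 fun i => contDiff_apply ℝ ℝ (e i))) ?_
  filter_upwards [hb] with y hy
  simpa using hy

lemma SmoothReal.exists_expr {a : X → ℝ} (ha : c.SmoothReal a x) :
    ∃ e : SmoothExpr c.P, ∀ᶠ y in 𝓝 x, a y = e.eval (c.coord y) := by
  obtain ⟨m, r, g, hg, h⟩ := ha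
  exact ⟨⟨Fin m, r, g, hg⟩, h⟩

lemma SmoothReal.of_expr {a : X → ℝ} (e : SmoothExpr c.P)
    (h : ∀ᶠ y in 𝓝 x, a y = e.eval (c.coord y)) : c.SmoothReal a x :=
  SmoothReal.of_fintype e.r e.g e.contDiff h

/-- A smooth function to `[0,∞)` is locally zero or of the form `λ_p · exp e`. -/
lemma SmoothNN.exists_rep {b : X → ℝ≥0} (hb : c.SmoothNN b x) (hc : c.IsValid)
    (hx : x ∈ c.source) : (∀ᶠ y in 𝓝 x, b y = 0) ∨ ∃ (p : c.P) (e : SmoothExpr c.P),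
      ∀ᶠ y in 𝓝 x, (b y : ℝ) = (c.coord y).toFun p * Real.exp (e.eval (c.coord y)) := by
  refine hb.imp_right ?_
  rintro ⟨p, h, hh, hh0, hb⟩
  obtain ⟨k, hk⟩ := hh.exists_expr
  obtain ⟨ψ, hψ, hlog⟩ := exists_contDiff_eventuallyEq_log hh0.self_of_nhds
  obtain ⟨e, he⟩ := (hh.comp₁ hψ (b := fun y => ψ (h y)) (Eventually.of_forall fun _ => rfl)).exists_expr
  -- Continuity of `h` keeps its values near `h x`, in the range where `ψ` is the logarithm.
  have hcont : Tendsto h (𝓝 x) (𝓝 (h x)) := by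
    rw [hk.self_of_nhds]
    exact ((k.continuous_eval.tendsto _).comp (hc.continuousAt hx)).congr'
      (hk.mono fun y hy => hy.symm)
  refine ⟨p, e, ?_⟩
  filter_upwards [hb, he, hh0, hcont.eventually hlog] with y h1 h2 h3 h4
  rw [h1, ← h2, h4, Real.exp_log h3]

end GChart

namespace SmoothExpr

variable {n : ℕ} {P : AddSubmonoid (Fin n → ℤ)}

instance : Zero (SmoothExpr P) := ⟨⟨Empty, Empty.elim, fun _ => 0, contDiff_const⟩⟩

@[simp] lemma eval_zero (u : ModelSpace P) : (0 : SmoothExpr P).eval u = 0 := rfl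

@[simp] lemma deriv_zero (α : P →+ ℝ) (u : ModelSpace P) : (0 : SmoothExpr P).deriv α u = 0 :=
  ((0 : SmoothExpr P).hasDerivAt α u).unique (hasDerivAt_const 0 (0 : ℝ))

end SmoothExpr

/-! ### Interior functions and their normal form `λ_p · exp e` on a manifold. -/

section Manifold

variable {X : Type*} [TopologicalSpace X] [GCAtlas X] [IsGCManifold X] {c d : GChart X} {x : X}

/-- Two charts induce the same order on strata near a common point. -/
lemma exists_nhds_supp_le_iff (hc : c ∈ GCAtlas.charts (X := X)) (hd : d ∈ GCAtlas.charts (X := X))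
    (hxc : x ∈ c.source) (hxd : x ∈ d.source) :
    ∃ V, IsOpen V ∧ x ∈ V ∧ V ⊆ c.source ∧ V ⊆ d.source ∧ ∀ y ∈ V, ∀ y' ∈ V,
      (c.coord y).supp ≤ (c.coord y').supp ↔ (d.coord y).supp ≤ (d.coord y').supp := by
  have hcv := IsGCManifold.isValid c hc
  have hdv := IsGCManifold.isValid d hd
  obtain ⟨V, hV, hxV, h1⟩ := c.exists_nhds_supp_le hdv.weaklyToric.fg
    (IsGCManifold.compatible c hc d hd x ⟨hxc, hxd⟩)
  obtain ⟨W, hW, hxW, h2⟩ := d.exists_nhds_supp_le hcv.weaklyToric.fg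
    (IsGCManifold.compatible d hd c hc x ⟨hxd, hxc⟩)
  exact ⟨V ∩ W ∩ (c.source ∩ d.source),
    (hV.inter hW).inter (hcv.isOpen_source.inter hdv.isOpen_source), ⟨⟨hxV, hxW⟩, hxc, hxd⟩,
    fun y hy => hy.2.1, fun y hy => hy.2.2, fun y hy y' hy' =>
      ⟨h1 y hy.1.1 y' hy'.1.1, h2 y hy.1.2 y' hy'.1.2⟩⟩

/-- The interior can be tested in any chart. -/
lemma mem_interiorPts_iff (hc : c ∈ GCAtlas.charts (X := X)) (hx : x ∈ c.source) :
    x ∈ interiorPts X ↔ (c.coord x).supp = c.P := by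
  have hcv := IsGCManifold.isValid c hc
  constructor
  · rintro ⟨d, hd, hxd, hpos⟩
    obtain ⟨V, hV, hxV, hVc, hVd, h⟩ := exists_nhds_supp_le_iff hc hd hx hxd
    obtain ⟨y, hyV, hy⟩ := mem_closure_iff_nhds.1 (hcv.mem_closure_faceStratum hx
      (IsFaceOf.refl c.P) (ModelSpace.supp_le _)) V (hV.mem_nhds hxV)
    refine le_antisymm (ModelSpace.supp_le _) ?_
    refine hy.2.ge.trans ((h y hyV x hxV).2 fun q hq => ?_)
    exact ⟨ModelSpace.supp_le _ hq, (hpos _).ne'⟩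
  · exact fun h => ⟨c, hc, hx, fun p => pos_iff_ne_zero.2 ((ModelSpace.mem_supp_iff p).1 (h.ge p.2))⟩

lemma mem_closure_interiorPts (x : X) : x ∈ closure (interiorPts X) := by
  obtain ⟨c, hc, hx⟩ := IsGCManifold.cover x
  refine closure_mono ?_ ((IsGCManifold.isValid c hc).mem_closure_faceStratum hx
    (IsFaceOf.refl c.P) (ModelSpace.supp_le _))
  exact fun y hy => (mem_interiorPts_iff hc hy.1).2 hy.2

/-- The interior is dense. This excludes the alternative `b = 0` in the definition of smoothness. -/
lemma InteriorFunAt.not_eventually_eq_zero {b : X → ℝ≥0} (hb : InteriorFunAt b x) :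
    ¬ ∀ᶠ y in 𝓝 x, b y = 0 := fun h => by
  obtain ⟨y, hy, hyi⟩ := mem_closure_iff_nhds.1 (mem_closure_interiorPts x) _ (hb.2.and h)
  exact (hy.1 hyi).ne' hy.2

/-- The coordinate functions of a chart are interior functions. -/
lemma interiorFunAt_coord (hc : c ∈ GCAtlas.charts (X := X)) (hx : x ∈ c.source) (p : c.P) :
    InteriorFunAt (fun y => (c.coord y).toFun p) x := by
  refine ⟨fun d hd hxd => IsGCManifold.compatible d hd c hc x ⟨hxd, hx⟩ p, ?_⟩
  filter_upwards [(IsGCManifold.isValid c hc).source_mem_nhds hx] with y hy hyi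
  exact pos_iff_ne_zero.2 ((ModelSpace.mem_supp_iff p).1
    (((mem_interiorPts_iff hc hy).1 hyi).ge p.2))

lemma smoothRealAt_eval (hc : c ∈ GCAtlas.charts (X := X)) (hx : x ∈ c.source)
    (e : SmoothExpr c.P) : SmoothRealAt (fun y => e.eval (c.coord y)) x := fun _ hd hxd =>
  GChart.SmoothReal.comp_fintype
    (fun i => ((interiorFunAt_coord hc hx (e.r i)).1 _ hd hxd).toReal) e.contDiff
    (Eventually.of_forall fun _ => rfl)

/-- The germs of the coordinate functions, as a homomorphism `P → I_x(X)`. -/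
noncomputable def coordGerm (hc : c ∈ GCAtlas.charts (X := X)) (hx : x ∈ c.source) :
    c.P →+ Additive (InteriorGerm x) where
  toFun p := Additive.ofMul ⟨((fun y => (c.coord y).toFun p : X → ℝ≥0) : Germ (𝓝 x) ℝ≥0), _,
    interiorFunAt_coord hc hx p, rfl⟩
  map_zero' := by
    refine congrArg Additive.ofMul (Subtype.ext ?_)
    exact congrArg Germ.ofFun (funext fun y => (c.coord y).map_zero)
  map_add' p q := by
    refine congrArg Additive.ofMul (Subtype.ext ?_)
    exact congrArg Germ.ofFun (funext fun y => (c.coord y).map_add p q)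

/-- The germ of a smooth expression in the coordinates. -/
noncomputable def exprGerm (hc : c ∈ GCAtlas.charts (X := X)) (hx : x ∈ c.source)
    (e : SmoothExpr c.P) : SmoothGerm x :=
  ⟨((fun y => e.eval (c.coord y) : X → ℝ) : Germ (𝓝 x) ℝ), _, smoothRealAt_eval hc hx e, rfl⟩

/-- The germ `λ_p · exp e`. -/
noncomputable def repGerm (hc : c ∈ GCAtlas.charts (X := X)) (hx : x ∈ c.source) (p : c.P)
    (e : SmoothExpr c.P) : InteriorGerm x :=
  (coordGerm hc hx p).toMul * SmoothGerm.exp (exprGerm hc hx e)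

lemma repGerm_eq_iff (hc : c ∈ GCAtlas.charts (X := X)) (hx : x ∈ c.source) (p : c.P)
    (e : SmoothExpr c.P) {b : X → ℝ≥0} (hb : (b : Germ (𝓝 x) ℝ≥0) ∈ InteriorGerm x) :
    (⟨b, hb⟩ : InteriorGerm x) = repGerm hc hx p e ↔
      ∀ᶠ y in 𝓝 x, (b y : ℝ) = (c.coord y).toFun p * Real.exp (e.eval (c.coord y)) := by
  rw [Subtype.ext_iff]
  change (b : Germ (𝓝 x) ℝ≥0) = ((fun y => (c.coord y).toFun p *
    ModelSpace.expNN (e.eval (c.coord y)) : X → ℝ≥0) : Germ (𝓝 x) ℝ≥0) ↔ _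
  rw [Germ.coe_eq]
  exact eventually_congr (Eventually.of_forall fun y => NNReal.eq_iff)

/-- This normal form reduces every homomorphism on `I_x(X)` to its values on the `λ_p` and on
exponentials. -/
lemma exists_eq_repGerm (hc : c ∈ GCAtlas.charts (X := X)) (hx : x ∈ c.source)
    (b : InteriorGerm x) : ∃ p e, b = repGerm hc hx p e := by
  obtain ⟨_, b, hb, rfl⟩ := b
  obtain ⟨p, e, h⟩ := ((hb.1 c hc hx).exists_rep (IsGCManifold.isValid c hc) hx).resolve_left
    hb.not_eventually_eq_zero
  exact ⟨p, e, (repGerm_eq_iff hc hx p e _).2 h⟩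

lemma exists_eq_exprGerm (hc : c ∈ GCAtlas.charts (X := X)) (hx : x ∈ c.source)
    (a : SmoothGerm x) : ∃ e, a = exprGerm hc hx e := by
  obtain ⟨_, a, ha, rfl⟩ := a
  obtain ⟨e, he⟩ := (ha c hc hx).exists_expr
  exact ⟨e, Subtype.ext (Germ.coe_eq.2 he)⟩

lemma repGerm_mul (hc : c ∈ GCAtlas.charts (X := X)) (hx : x ∈ c.source) (p p' : c.P)
    (e e' : SmoothExpr c.P) :
    repGerm hc hx p e * repGerm hc hx p' e' = repGerm hc hx (p + p') (e.add e') := by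
  refine (repGerm_eq_iff hc hx _ _ (Subtype.prop (repGerm hc hx p e * repGerm hc hx p' e'))).2
    (Eventually.of_forall fun y => ?_)
  simp only [SmoothExpr.eval_add, Real.exp_add, (c.coord y).map_add, NNReal.coe_mul]
  change _ * Real.exp _ * (_ * Real.exp _) = _
  ring

lemma logDeriv_eq_of_repGerm_eq (hc : c ∈ GCAtlas.charts (X := X)) (hx : x ∈ c.source)
    {p p' : c.P} {e e' : SmoothExpr c.P} (h : repGerm hc hx p e = repGerm hc hx p' e')
    (α : c.P →+ ℝ) :
    α p + e.deriv α (c.coord x) = α p' + e'.deriv α (c.coord x) := by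
  have hcv := IsGCManifold.isValid c hc
  refine SmoothExpr.logDeriv_unique hcv.weaklyToric.fg ?_ α
  rw [← hcv.eventually_coord hx (p := fun u => (u.toFun p : ℝ) * Real.exp (e.eval u) =
    u.toFun p' * Real.exp (e'.eval u))]
  exact (repGerm_eq_iff hc hx p' e' (repGerm hc hx p e).2).1 h

lemma ev_repGerm (hc : c ∈ GCAtlas.charts (X := X)) (hx : x ∈ c.source) (p : c.P)
    (e : SmoothExpr c.P) : (InteriorGerm.ev (repGerm hc hx p e) : ℝ) =
      (c.coord x).toFun p * Real.exp (e.eval (c.coord x)) := rfl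

lemma exp_exprGerm (hc : c ∈ GCAtlas.charts (X := X)) (hx : x ∈ c.source)
    (e : SmoothExpr c.P) : SmoothGerm.exp (exprGerm hc hx e) = repGerm hc hx 0 e := by
  rw [repGerm, map_zero, toMul_zero, one_mul]

lemma coordGerm_eq_repGerm (hc : c ∈ GCAtlas.charts (X := X)) (hx : x ∈ c.source) (p : c.P) :
    (coordGerm hc hx p).toMul = repGerm hc hx p 0 := by
  refine (repGerm_eq_iff hc hx _ _ (Subtype.prop (coordGerm hc hx p).toMul)).2
    (Eventually.of_forall fun y => ?_)
  simp

end Manifold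

/-! ### B-tangent spaces in coordinates -/

section Tangent

variable {X : Type*} [TopologicalSpace X] [GCAtlas X]

/-- The functions that are smooth near `x`. -/
def smoothFunctions (x : X) : Submodule ℝ (X → ℝ) where
  carrier := {f | SmoothRealAt f x}
  zero_mem' := fun _ _ _ => GChart.SmoothReal.const 0
  add_mem' := fun hf hg c hc hx => GChart.SmoothReal.comp₂ (hf c hc hx) (hg c hc hx)
    (g := fun v => v.1 + v.2) (contDiff_fst.add contDiff_snd) (Eventually.of_forall fun _ => rfl)
  smul_mem' := fun t _ hf c hc hx => GChart.SmoothReal.comp₁ (hf c hc hx)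
    (g := fun v => t * v) (contDiff_const.mul contDiff_id) (Eventually.of_forall fun _ => rfl)

lemma SmoothRealAt.mul {x : X} {f g : X → ℝ} (hf : SmoothRealAt f x) (hg : SmoothRealAt g x) :
    SmoothRealAt (fun y => f y * g y) x := fun c hc hx =>
  GChart.SmoothReal.comp₂ (hf c hc hx) (hg c hc hx) (g := fun v => v.1 * v.2)
    (contDiff_fst.mul contDiff_snd) (Eventually.of_forall fun _ => rfl)

/-- The germ of a smooth function. -/
def toSmoothGerm (x : X) : smoothFunctions x →ₗ[ℝ] SmoothGerm x where
  toFun f := ⟨(f : X → ℝ), f, f.2, rfl⟩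
  map_add' _ _ := rfl
  map_smul' _ _ := rfl

variable {x : X} {c : GChart X}

/-- The Leibniz rule applied to a first-order expansion: constants are killed because `1 · 1 = 1`,
and `u i - s i` vanishes at `x`, so only the derivatives of the `u i` survive. -/
lemma derivation_sum {ι : Type*} [Fintype ι] {v : SmoothGerm x →ₗ[ℝ] ℝ}
    (hv : ∀ a b, v (SmoothGerm.mul a b) = v a * SmoothGerm.ev b + SmoothGerm.ev a * v b)
    {f : X → ℝ} (hf : SmoothRealAt f x) (t : ℝ) (s : ι → ℝ) {u k : ι → X → ℝ}
    (hu : ∀ i, SmoothRealAt (u i) x) (hk : ∀ i, SmoothRealAt (k i) x)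
    (h : ∀ y, f y = t + ∑ i, (u i y - s i) * k i y) (hs : ∀ i, u i x = s i) :
    v ⟨f, f, hf, rfl⟩ = ∑ i, v ⟨u i, u i, hu i, rfl⟩ * k i x := by
  let one : smoothFunctions x := ⟨fun _ => 1, fun _ _ _ => GChart.SmoothReal.const 1⟩
  let D : smoothFunctions x →ₗ[ℝ] ℝ := v ∘ₗ toSmoothGerm x
  have hone : D one = 0 := by
    have h1 := hv (toSmoothGerm x one) (toSmoothGerm x one)
    have h2 : SmoothGerm.mul (toSmoothGerm x one) (toSmoothGerm x one) = toSmoothGerm x one :=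
      Subtype.ext (congrArg Germ.ofFun (funext fun y => one_mul (1 : ℝ)))
    have h3 : SmoothGerm.ev (toSmoothGerm x one) = 1 := rfl
    rw [h2, h3] at h1
    change v (toSmoothGerm x one) = 0
    linarith
  let w : ι → smoothFunctions x := fun i => ⟨u i, hu i⟩ - s i • one
  let wk : ι → smoothFunctions x := fun i => ⟨fun y => (w i : X → ℝ) y * k i y, (w i).2.mul (hk i)⟩
  have hf' : (⟨f, hf⟩ : smoothFunctions x) = t • one + ∑ i, wk i := by
    refine Subtype.ext (funext fun y => ?_)
    rw [Submodule.coe_add, Submodule.coe_sum, Pi.add_apply, Finset.sum_apply]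
    change f y = t * 1 + ∑ i, (u i y - s i * 1) * k i y
    simp only [mul_one]
    exact h y
  have hwk : ∀ i, D (wk i) = D ⟨u i, hu i⟩ * k i x := fun i => by
    have h1 : D (wk i) = D (w i) * k i x + (u i x - s i * 1) * D ⟨k i, hk i⟩ :=
      hv (toSmoothGerm x (w i)) (toSmoothGerm x ⟨k i, hk i⟩)
    rw [h1, hs i, map_sub, map_smul, hone]
    simp
  change D ⟨f, hf⟩ = ∑ i, D ⟨u i, hu i⟩ * k i x
  rw [hf', map_add, map_smul, hone, map_sum]
  simp [hwk]

variable [IsGCManifold X]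

/-- Hadamard's lemma provides the expansion, and the relation `v(λ_r) = λ_r(x) v'(λ_r)` turns
derivatives of coordinates into logarithmic ones. -/
lemma derivation_exprGerm (hc : c ∈ GCAtlas.charts (X := X)) (hx : x ∈ c.source)
    (v : BTangent x) (e : SmoothExpr c.P) :
    v.1.1 (exprGerm hc hx e) = e.deriv (v.1.2.comp (coordGerm hc hx)) (c.coord x) := by
  classical
  obtain ⟨hv1, -, hv3⟩ := v.2
  let y₀ : e.ι → ℝ := fun i => ((c.coord x).toFun (e.r i) : ℝ)
  obtain ⟨G, hG, hsum, hG₀⟩ := hadamard e.contDiff y₀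
  have hk : ∀ i, SmoothRealAt (fun y => G i fun j => ((c.coord y).toFun (e.r j) : ℝ)) x := fun i =>
    smoothRealAt_eval hc hx ⟨e.ι, e.r, G i, hG i⟩
  have hu : ∀ i, SmoothRealAt (fun y => ((c.coord y).toFun (e.r i) : ℝ)) x := fun i d hd hxd =>
    ((interiorFunAt_coord hc hx (e.r i)).1 d hd hxd).toReal
  have h1 := derivation_sum hv1 (smoothRealAt_eval hc hx e) (e.g y₀) y₀ hu hk
    (fun y => hsum _) (fun i => rfl)
  have h2 : ∀ i, v.1.1 ⟨_, _, hu i, rfl⟩ =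
      y₀ i * v.1.2 (coordGerm hc hx (e.r i)) := fun i => hv3 (coordGerm hc hx (e.r i)).toMul
  refine h1.trans ?_
  rw [SmoothExpr.deriv]
  conv_rhs => rw [pi_eq_sum_univ' (fun i => _ * _)]
  rw [map_sum]
  refine Finset.sum_congr rfl fun i _ => ?_
  rw [h2, map_smul, smul_eq_mul, ← hG₀]
  rfl

lemma bTangent_repGerm (hc : c ∈ GCAtlas.charts (X := X)) (hx : x ∈ c.source)
    (v : BTangent x) (p : c.P) (e : SmoothExpr c.P) :
    v.1.2 (Additive.ofMul (repGerm hc hx p e)) = v.1.2 (coordGerm hc hx p) +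
      e.deriv (v.1.2.comp (coordGerm hc hx)) (c.coord x) := by
  rw [← derivation_exprGerm, ← v.2.2.1, ← map_add]
  rfl

/-- With `exists_bTangent`, this identifies the b-tangent space with `Hom(P, ℝ)`. -/
lemma bTangent_ext (hc : c ∈ GCAtlas.charts (X := X)) (hx : x ∈ c.source) {v w : BTangent x}
    (h : v.1.2.comp (coordGerm hc hx) = w.1.2.comp (coordGerm hc hx)) : v = w := by
  refine Subtype.ext (Prod.ext (LinearMap.ext fun a => ?_) (AddMonoidHom.ext fun b => ?_))
  · obtain ⟨e, rfl⟩ := exists_eq_exprGerm hc hx a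
    rw [derivation_exprGerm, derivation_exprGerm, h]
  · obtain ⟨p, e, hb⟩ := exists_eq_repGerm hc hx b.toMul
    obtain rfl : b = Additive.ofMul (repGerm hc hx p e) := hb
    rw [bTangent_repGerm, bTangent_repGerm, h]
    exact congrArg (· + _) (DFunLike.congr_fun h p)

/-- Every homomorphism `P → ℝ` is the coordinate expression of a b-tangent vector. -/
lemma exists_bTangent (hc : c ∈ GCAtlas.charts (X := X)) (hx : x ∈ c.source) (α : c.P →+ ℝ) :
    ∃ v : BTangent x, v.1.2.comp (coordGerm hc hx) = α := by
  have hcv := IsGCManifold.isValid c hc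
  choose E hE using exists_eq_exprGerm hc hx
  choose B K hBK using exists_eq_repGerm hc hx
  let u := c.coord x
  -- The derivative along the flow depends only on the germ, so the chosen expression may be
  -- replaced by any function of the coordinates that represents it. Linearity and the product rule
  -- then come from calculus in one variable.
  have hexpr : ∀ {e : SmoothExpr c.P} {f : ModelSpace c.P → ℝ} {r : ℝ} {a : SmoothGerm x},
      a = exprGerm hc hx e →
      (a : Germ (𝓝 x) ℝ) = ((fun y => f (c.coord y) : X → ℝ) : Germ (𝓝 x) ℝ) →
      HasDerivAt (fun t => f (ModelSpace.flow α u t)) r 0 → e.deriv α u = r := by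
    intro e f r a ha haf hf
    refine (e.hasDerivAt α u).unique (hf.congr_of_eventuallyEq ?_)
    have h1 : ∀ᶠ y in 𝓝 x, e.eval (c.coord y) = f (c.coord y) :=
      Germ.coe_eq.1 ((Subtype.ext_iff.1 ha).symm.trans haf)
    rw [hcv.eventually_coord hx (p := fun w => e.eval w = f w)] at h1
    refine (ModelSpace.continuous_flow α u).continuousAt.eventually
      (p := fun w => e.eval w = f w) ?_
    rwa [ModelSpace.flow_zero]
  have hEcoe : ∀ a : SmoothGerm x, (a : Germ (𝓝 x) ℝ) =
      ((fun y => (E a).eval (c.coord y) : X → ℝ) : Germ (𝓝 x) ℝ) := fun a =>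
    Subtype.ext_iff.1 (hE a)
  have hrep : ∀ (b : InteriorGerm x) (p : c.P) (e : SmoothExpr c.P), b = repGerm hc hx p e →
      α (B b) + (K b).deriv α u = α p + e.deriv α u := fun b p e h =>
    logDeriv_eq_of_repGerm_eq hc hx ((hBK b).symm.trans h) α
  let v₁ : SmoothGerm x →ₗ[ℝ] ℝ :=
    { toFun := fun a => (E a).deriv α u
      map_add' := fun a b => hexpr (hE (a + b))
        (f := fun w => (E a).eval w + (E b).eval w) (by
          rw [Submodule.coe_add, hEcoe a, hEcoe b]; rfl)
        (((E a).hasDerivAt α u).add ((E b).hasDerivAt α u))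
      map_smul' := fun t a => hexpr (hE (t • a)) (f := fun w => t * (E a).eval w) (by
          rw [Submodule.coe_smul, hEcoe a]; rfl)
        (((E a).hasDerivAt α u).const_mul t) }
  let v₂ : Additive (InteriorGerm x) →+ ℝ := AddMonoidHom.mk'
    (fun b => α (B b.toMul) + (K b.toMul).deriv α u) fun b b' => by
      rw [hrep (b + b').toMul (B b.toMul + B b'.toMul) ((K b.toMul).add (K b'.toMul))
        (by rw [← repGerm_mul, ← hBK, ← hBK]; rfl), map_add, SmoothExpr.deriv_add]
      ring
  have hev : ∀ a : SmoothGerm x, (E a).eval (ModelSpace.flow α u 0) = SmoothGerm.ev a := fun a => by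
    conv_rhs => rw [hE a]
    rw [ModelSpace.flow_zero]
    rfl
  refine ⟨⟨(v₁, v₂), fun a b => ?_, fun a => ?_, fun b => ?_⟩, AddMonoidHom.ext fun p => ?_⟩
  · have h := ((E a).hasDerivAt α u).mul ((E b).hasDerivAt α u)
    rw [hev, hev] at h
    refine hexpr (hE (SmoothGerm.mul a b)) (f := fun w => (E a).eval w * (E b).eval w) ?_ h
    exact congrArg₂ (· * ·) (hEcoe a) (hEcoe b)
  · have h := hrep (SmoothGerm.exp a) 0 (E a) (by rw [← exp_exprGerm, ← hE])
    rw [map_zero, zero_add] at h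
    exact h
  · have h1 : HasDerivAt (fun t => ((ModelSpace.flow α u t).toFun (B b) : ℝ))
        (u.toFun (B b) * α (B b)) 0 := by
      simp only [ModelSpace.flow_apply]
      simpa using (((hasDerivAt_id (0 : ℝ)).mul_const (α (B b))).exp).const_mul
        (u.toFun (B b) : ℝ)
    have h2 := h1.mul ((K b).hasDerivAt α u).exp
    rw [ModelSpace.flow_zero] at h2
    have h3 : (InteriorGerm.ev b : ℝ) = u.toFun (B b) * Real.exp ((K b).eval u) := by
      conv_lhs => rw [hBK b]
      exact ev_repGerm hc hx _ _
    refine (hexpr (hE (InteriorGerm.inc b)) (f := fun w => (w.toFun (B b) : ℝ) *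
      Real.exp ((K b).eval w)) ?_ h2).trans ?_
    · conv_lhs => rw [hBK b]
      rfl
    · rw [h3]
      change _ = _ * (α (B b) + (K b).deriv α u)
      ring
  · have h := hrep (coordGerm hc hx p).toMul p 0 (coordGerm_eq_repGerm hc hx p)
    rw [SmoothExpr.deriv_zero, add_zero] at h
    exact h

/-! ### B-normal spaces and normal monoids in coordinates -/

lemma pos_germ_hom_eq_zero {M : Type*} [AddCommMonoid M] (hc : c ∈ GCAtlas.charts (X := X))
    (hx : x ∈ c.source) {α : Additive (InteriorGerm x) →+ M}
    (hα : ∀ b : InteriorGerm x, 0 < InteriorGerm.ev b → α (Additive.ofMul b) = 0) (p : c.P)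
    (hp : (c.coord x).toFun p ≠ 0) : α (coordGerm hc hx p) = 0 :=
  hα (coordGerm hc hx p).toMul (pos_iff_ne_zero.2 hp)

lemma hom_repGerm {M : Type*} [AddCommMonoid M] (hc : c ∈ GCAtlas.charts (X := X))
    (hx : x ∈ c.source) {α : Additive (InteriorGerm x) →+ M}
    (hα : ∀ b : InteriorGerm x, 0 < InteriorGerm.ev b → α (Additive.ofMul b) = 0) (p : c.P)
    (e : SmoothExpr c.P) :
    α (Additive.ofMul (repGerm hc hx p e)) = α (coordGerm hc hx p) := by
  have h : Additive.ofMul (repGerm hc hx p e) = coordGerm hc hx p +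
    Additive.ofMul (SmoothGerm.exp (exprGerm hc hx e)) := rfl
  have h0 : α (Additive.ofMul (SmoothGerm.exp (exprGerm hc hx e))) = 0 :=
    hα _ (NNReal.coe_pos.1 (Real.exp_pos _))
  rw [h, map_add, h0, add_zero]

lemma hom_ext_of_coordGerm {M : Type*} [AddCommMonoid M] (hc : c ∈ GCAtlas.charts (X := X))
    (hx : x ∈ c.source) {α β : Additive (InteriorGerm x) →+ M}
    (hα : ∀ b : InteriorGerm x, 0 < InteriorGerm.ev b → α (Additive.ofMul b) = 0)
    (hβ : ∀ b : InteriorGerm x, 0 < InteriorGerm.ev b → β (Additive.ofMul b) = 0)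
    (h : α.comp (coordGerm hc hx) = β.comp (coordGerm hc hx)) : α = β := by
  refine AddMonoidHom.ext fun b => ?_
  obtain ⟨p, e, hb⟩ := exists_eq_repGerm hc hx b.toMul
  obtain rfl : b = Additive.ofMul (repGerm hc hx p e) := hb
  rw [hom_repGerm hc hx hα, hom_repGerm hc hx hβ]
  exact DFunLike.congr_fun h p

/-- A homomorphism on `P` that vanishes on the support of `x`, with values in a monoid that embeds
into `ℝ`, extends to a homomorphism on germs that vanishes on positive germs. -/
lemma exists_hom_of_coordGerm {M : Type*} [AddCommMonoid M] (hc : c ∈ GCAtlas.charts (X := X))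
    (hx : x ∈ c.source) {j : M →+ ℝ} (hj : Function.Injective j) (θ : c.P →+ M)
    (hθ : ∀ p : c.P, (c.coord x).toFun p ≠ 0 → θ p = 0) :
    ∃ α : Additive (InteriorGerm x) →+ M,
      (∀ b : InteriorGerm x, 0 < InteriorGerm.ev b → α (Additive.ofMul b) = 0) ∧
      α.comp (coordGerm hc hx) = θ := by
  choose B K hBK using exists_eq_repGerm hc hx
  have hrep : ∀ (b : InteriorGerm x) (p : c.P) (e : SmoothExpr c.P), b = repGerm hc hx p e →
      θ (B b) = θ p := fun b p e h => by
    have h0 : ∀ p : c.P, (c.coord x).toFun p ≠ 0 → (j.comp θ) p = 0 := fun p hp => by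
      rw [AddMonoidHom.comp_apply, hθ p hp, map_zero]
    -- Since `θ` vanishes on the support, the terms from `exp e` drop out and `θ p` depends only on
    -- the germ.
    have := logDeriv_eq_of_repGerm_eq hc hx ((hBK b).symm.trans h) (j.comp θ)
    rw [SmoothExpr.deriv_eq_zero _ h0, SmoothExpr.deriv_eq_zero _ h0, add_zero, add_zero] at this
    exact hj this
  let α : Additive (InteriorGerm x) →+ M :=
    { toFun := fun b => θ (B b.toMul)
      map_zero' := by
        rw [hrep _ 0 0 (by rw [← coordGerm_eq_repGerm]; exact (coordGerm hc hx).map_zero.symm),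
          map_zero]
      map_add' := fun b b' => by
        rw [hrep (b + b').toMul (B b.toMul + B b'.toMul) ((K b.toMul).add (K b'.toMul))
          (by rw [← repGerm_mul, ← hBK, ← hBK]; rfl), map_add] }
  refine ⟨α, fun b hb => hθ _ fun (h : (c.coord x).toFun (B b) = 0) => ?_, AddMonoidHom.ext fun p =>
    hrep _ p 0 (coordGerm_eq_repGerm hc hx p)⟩
  have h1 := ev_repGerm hc hx (B b) (K b)
  rw [← hBK, h, NNReal.coe_zero, zero_mul] at h1
  exact hb.ne' (by exact_mod_cast h1)

/-! ### Depth -/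

/-- The b-normal space has dimension the depth in any chart. -/
lemma finrank_bNormal (hc : c ∈ GCAtlas.charts (X := X)) (hx : x ∈ c.source) :
    Module.finrank ℝ (BNormal x) = (c.coord x).depth := by
  let T : BNormal x →ₗ[ℝ] (c.P →+ ℝ) :=
    { toFun := fun α => α.1.comp (coordGerm hc hx)
      map_add' := fun _ _ => rfl
      map_smul' := fun _ _ => rfl }
  have hT : Function.Injective T := fun α β h =>
    Subtype.ext (hom_ext_of_coordGerm hc hx α.2 β.2 h)
  have hrange : LinearMap.range T = LinearMap.ker (restrictLinear (c.coord x).supp_le) := by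
    ext θ
    rw [LinearMap.mem_range, LinearMap.mem_ker]
    constructor
    · rintro ⟨α, rfl⟩
      exact AddMonoidHom.ext fun p => pos_germ_hom_eq_zero hc hx α.2 _
        ((ModelSpace.mem_supp_iff _).1 p.2)
    · intro h
      obtain ⟨α, hα, hαθ⟩ := exists_hom_of_coordGerm hc hx (j := AddMonoidHom.id ℝ)
        Function.injective_id θ fun p hp =>
          DFunLike.congr_fun h ⟨p, (ModelSpace.mem_supp_iff p).2 hp⟩
      exact ⟨⟨α, hα⟩, hαθ⟩
  rw [← LinearMap.finrank_range_of_inj hT, hrange, finrank_ker_restrictLinear]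
  rfl

/-- The depth can be computed in any chart. -/
lemma depth_eq (hc : c ∈ GCAtlas.charts (X := X)) (hx : x ∈ c.source) :
    depth x = rank c.P - rank (c.coord x).supp := by
  have h : {k | ∃ c ∈ GCAtlas.charts (X := X), x ∈ c.source ∧ (c.coord x).depth = k} =
      {(c.coord x).depth} := by
    ext k
    constructor
    · rintro ⟨d, hd, hxd, rfl⟩
      rw [← finrank_bNormal hd hxd, finrank_bNormal hc hx]
      rfl
    · rintro rfl
      exact ⟨c, hc, hx, rfl⟩
  rw [depth, h, csInf_singleton]
  rfl

end Tangent

/-! ### Local corner components in a chart -/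

section CornersInChart

variable {X : Type*} [TopologicalSpace X]

lemma IsPreconnected.eq_of_eventually_eq {T : Type*} {s : Set X} (hs : IsPreconnected s) {f : X → T}
    (hf : ∀ x ∈ s, ∀ᶠ y in 𝓝[s] x, f y = f x) {x y : X} (hx : x ∈ s) (hy : y ∈ s) : f x = f y :=
  hs.induction₂ (fun x y => f x = f y) (fun x hx => (hf x hx).mono fun _ h => h.symm)
    (fun _ _ _ _ _ _ => Eq.trans) (fun _ _ _ _ => Eq.symm) hx hy

variable [GCAtlas X]

namespace LocalCorner

variable {x : X} {k : ℕ} (γ : LocalCorner x k)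

lemma comp_subset (V : TopologicalSpace.OpenNhdsOf x) : γ.comp V ⊆ V ∩ stratum X k := by
  obtain ⟨w, -, h⟩ := γ.isComponent V
  rw [h]
  exact connectedComponentIn_subset _ _

lemma isPreconnected_comp (V : TopologicalSpace.OpenNhdsOf x) : IsPreconnected (γ.comp V) := by
  obtain ⟨w, -, h⟩ := γ.isComponent V
  rw [h]
  exact isPreconnected_connectedComponentIn

lemma comp_nonempty (V : TopologicalSpace.OpenNhdsOf x) : (γ.comp V).Nonempty := by
  obtain ⟨w, hw, h⟩ := γ.isComponent V
  rw [h]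
  exact ⟨w, mem_connectedComponentIn hw⟩

lemma subset_comp (V : TopologicalSpace.OpenNhdsOf x) {A : Set X} (hA : IsPreconnected A)
    (hAV : A ⊆ V ∩ stratum X k) (h : (A ∩ γ.comp V).Nonempty) : A ⊆ γ.comp V := by
  obtain ⟨w, -, hw⟩ := γ.isComponent V
  obtain ⟨y, hyA, hy⟩ := h
  rw [hw] at hy ⊢
  rw [connectedComponentIn_eq hy]
  exact hA.subset_connectedComponentIn hyA hAV

end LocalCorner

/-- In the chart `c`, the local corner component of `ξ` is the stratum of the face `F`. -/
def InFace (c : GChart X) (F : AddSubmonoid (Fin c.n → ℤ)) (ξ : Corners X) : Prop :=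
  ξ.pt ∈ c.source ∧ ∀ V, ξ.pt ∈ closure (ξ.comp.comp V ∩ c.faceStratum F)

variable {c d : GChart X} {F F' : AddSubmonoid (Fin c.n → ℤ)} {ξ ξ' : Corners X}

lemma InFace.mem_closure (h : InFace c F ξ) : ξ.pt ∈ closure (c.faceStratum F) :=
  closure_mono inter_subset_right (h.2 ⊤)

variable [IsGCManifold X]

/-- The domain of a chart as a neighbourhood. -/
def sourceNhd (hc : c ∈ GCAtlas.charts (X := X)) {x : X} (hx : x ∈ c.source) :
    TopologicalSpace.OpenNhdsOf x :=
  ⟨⟨c.source, (IsGCManifold.isValid c hc).isOpen_source⟩, hx⟩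

lemma depth_of_mem_faceStratum (hc : c ∈ GCAtlas.charts (X := X)) {y : X}
    (hy : y ∈ c.faceStratum F) : depth y = rank c.P - rank F := by
  rw [depth_eq hc hy.1, hy.2]

/-- Along a stratum of constant depth, the support in a chart is locally constant. -/
lemma eventually_supp_eq (hc : c ∈ GCAtlas.charts (X := X)) {y : X} (hy : y ∈ c.source) :
    ∀ᶠ z in 𝓝 y, depth z = depth y → (c.coord z).supp = (c.coord y).supp := by
  have hcv := IsGCManifold.isValid c hc
  filter_upwards [hcv.eventually_supp_le hy, hcv.source_mem_nhds hy] with z hz hzs h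
  rw [depth_eq hc hzs, depth_eq hc hy] at h
  have h1 := rank_mono (c.coord z).supp_le
  have h2 := rank_mono (c.coord y).supp_le
  exact (IsFaceOf.eq_of_rank_eq ((c.coord y).supp_isFaceOf.of_le (c.coord z).supp_isFaceOf hz)
    ((c.coord z).supp_isFaceOf.fg hcv.weaklyToric.fg) (by omega)).symm

lemma supp_eq_of_isPreconnected (hc : c ∈ GCAtlas.charts (X := X)) {A : Set X}
    (hA : IsPreconnected A) (hAc : A ⊆ c.source) {k : ℕ} (hAk : A ⊆ stratum X k) {y z : X}
    (hy : y ∈ A) (hz : z ∈ A) : (c.coord y).supp = (c.coord z).supp := by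
  refine IsPreconnected.eq_of_eventually_eq hA (f := fun y => (c.coord y).supp)
    (fun y hy => ?_) hy hz
  filter_upwards [mem_nhdsWithin_of_mem_nhds (eventually_supp_eq hc (hAc hy)),
    self_mem_nhdsWithin] with z hz hzA
  exact hz ((hAk hzA).trans (hAk hy).symm)

/-- A component of a depth stratum is connected, so its support is constant in a chart; one point of
support `F` decides. -/
lemma InFace.comp_subset (h : InFace c F ξ) (hc : c ∈ GCAtlas.charts (X := X))
    {V : TopologicalSpace.OpenNhdsOf ξ.pt} (hV : (V : Set X) ⊆ c.source) :
    ξ.comp.comp V ⊆ c.faceStratum F := fun y hy => by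
  obtain ⟨z, hz⟩ := closure_nonempty_iff.1 ⟨_, h.2 V⟩
  have hs := ξ.comp.comp_subset V
  exact ⟨hV (hs hy).1, (supp_eq_of_isPreconnected hc (ξ.comp.isPreconnected_comp V)
    (fun w hw => hV (hs hw).1) (fun w hw => (hs hw).2) hy hz.1).trans hz.2.2⟩

lemma exists_inFace (hc : c ∈ GCAtlas.charts (X := X)) (hx : ξ.pt ∈ c.source) :
    ∃ F, IsFaceOf F c.P ∧ InFace c F ξ := by
  obtain ⟨w, hw⟩ := ξ.comp.comp_nonempty (sourceNhd hc hx)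
  have hs := ξ.comp.comp_subset (sourceNhd hc hx)
  have hsub : ξ.comp.comp (sourceNhd hc hx) ⊆ c.faceStratum (c.coord w).supp := fun y hy =>
    ⟨(hs hy).1, supp_eq_of_isPreconnected hc (ξ.comp.isPreconnected_comp _)
      (fun w hw => (hs hw).1) (fun w hw => (hs hw).2) hy hw⟩
  exact ⟨_, (c.coord w).supp_isFaceOf, hx, fun V =>
    closure_mono (inter_subset_inter_right _ hsub) (ξ.comp.compatible V (sourceNhd hc hx))⟩

lemma InFace.unique (h : InFace c F ξ) (h' : InFace c F' ξ) (hc : c ∈ GCAtlas.charts (X := X)) :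
    F = F' := by
  obtain ⟨w, hw⟩ := ξ.comp.comp_nonempty (sourceNhd hc h.1)
  exact (h.comp_subset hc le_rfl hw).2.symm.trans (h'.comp_subset hc le_rfl hw).2

lemma InFace.supp_le (h : InFace c F ξ) (hc : c ∈ GCAtlas.charts (X := X)) :
    (c.coord ξ.pt).supp ≤ F :=
  (IsGCManifold.isValid c hc).supp_le_of_mem_closure h.1 h.mem_closure

lemma InFace.codim_eq (h : InFace c F ξ) (hc : c ∈ GCAtlas.charts (X := X)) :
    ξ.codim = rank c.P - rank F := by
  obtain ⟨w, hw⟩ := ξ.comp.comp_nonempty (sourceNhd hc h.1)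
  rw [← depth_of_mem_faceStratum hc (h.comp_subset hc le_rfl hw)]
  exact (ξ.comp.comp_subset _ hw).2.symm

/-- A connected piece of the stratum of `F` near the point has the right depth and meets the
component, so it is absorbed by it. -/
lemma InFace.inter_subset_comp (h : InFace c F ξ) (hc : c ∈ GCAtlas.charts (X := X))
    (V : TopologicalSpace.OpenNhdsOf ξ.pt) {W : Set X} (hW : W ∈ 𝓝 ξ.pt) (hWV : W ⊆ V)
    (hWF : IsPreconnected (W ∩ c.faceStratum F)) : W ∩ c.faceStratum F ⊆ ξ.comp.comp V := by
  refine ξ.comp.subset_comp V hWF (fun y hy => ⟨hWV hy.1, ?_⟩) ?_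
  · change depth y = _
    rw [h.codim_eq hc, depth_of_mem_faceStratum hc hy.2]
  · obtain ⟨y, hy, hy'⟩ := mem_closure_iff_nhds.1 (h.2 V) W hW
    exact ⟨y, ⟨hy, hy'.2⟩, hy'.1⟩

/-- For each `V`, both components contain the same nonempty connected piece of the stratum, hence
coincide. -/
lemma InFace.ext (h : InFace c F ξ) (h' : InFace c F ξ') (hc : c ∈ GCAtlas.charts (X := X))
    (hpt : ξ.pt = ξ'.pt) : ξ = ξ' := by
  have hcodim : ξ.codim = ξ'.codim := (h.codim_eq hc).trans (h'.codim_eq hc).symm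
  obtain ⟨x, k, γ⟩ := ξ
  obtain ⟨x', k', γ'⟩ := ξ'
  dsimp only at hpt hcodim
  subst hpt hcodim
  congr 1
  ext1
  funext V
  obtain ⟨W, hWV, -, hWo, hxW, hW⟩ := (IsGCManifold.isValid c hc).exists_nhds_isPreconnected h.1
    (V.isOpen.mem_nhds V.mem)
  have h1 := h.inter_subset_comp hc V (hWo.mem_nhds hxW) hWV (hW F)
  have h2 := h'.inter_subset_comp hc V (hWo.mem_nhds hxW) hWV (hW F)
  obtain ⟨y, hyW, hy⟩ := mem_closure_iff_nhds.1 h.mem_closure W (hWo.mem_nhds hxW)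
  exact Subset.antisymm
    (γ'.subset_comp V (γ.isPreconnected_comp V) (γ.comp_subset V) ⟨y, h1 ⟨hyW, hy⟩, h2 ⟨hyW, hy⟩⟩)
    (γ.subset_comp V (γ'.isPreconnected_comp V) (γ'.comp_subset V) ⟨y, h2 ⟨hyW, hy⟩, h1 ⟨hyW, hy⟩⟩)

/-- Over a point of the chart, each face containing the support gives a local corner component. -/
lemma exists_corner_inFace (hc : c ∈ GCAtlas.charts (X := X)) {x : X} (hx : x ∈ c.source)
    (hF : IsFaceOf F c.P) (h : (c.coord x).supp ≤ F) : ∃ ξ, InFace c F ξ ∧ ξ.pt = x := by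
  have hcv := IsGCManifold.isValid c hc
  have hcl := hcv.mem_closure_faceStratum hx hF h
  have hmeet : ∀ {V : Set X}, V ∈ 𝓝 x → ∃ y, y ∈ V ∧ y ∈ c.faceStratum F := fun hV =>
    mem_closure_iff_nhds.1 hcl _ hV
  choose W hWV hWc hWo hxW hW using fun V : TopologicalSpace.OpenNhdsOf x =>
    hcv.exists_nhds_isPreconnected hx (V.isOpen.mem_nhds V.mem)
  choose w hwW hwF using fun V => hmeet ((hWo V).mem_nhds (hxW V))
  have hsub : ∀ V, W V ∩ c.faceStratum F ⊆ V ∩ stratum X (rank c.P - rank F) := fun V y hy =>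
    ⟨hWV V hy.1, depth_of_mem_faceStratum hc hy.2⟩
  have hcomp : ∀ V : TopologicalSpace.OpenNhdsOf x, W V ∩ c.faceStratum F ⊆
      connectedComponentIn ((V : Set X) ∩ stratum X (rank c.P - rank F)) (w V) := fun V =>
    (hW V F).subset_connectedComponentIn ⟨hwW V, hwF V⟩ (hsub V)
  let γ : LocalCorner x (rank c.P - rank F) :=
    { comp := fun V => connectedComponentIn ((V : Set X) ∩ stratum X (rank c.P - rank F)) (w V)
      isComponent := fun V => ⟨w V, hsub V ⟨hwW V, hwF V⟩, rfl⟩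
      mem_closure := fun V => mem_closure_iff_nhds.2 fun O hO => by
        obtain ⟨y, hy, hyF⟩ := hmeet (inter_mem hO ((hWo V).mem_nhds (hxW V)))
        exact ⟨y, hy.1, hcomp V ⟨hy.2, hyF⟩⟩
      compatible := fun V V' => mem_closure_iff_nhds.2 fun O hO => by
        obtain ⟨y, hy, hyF⟩ := hmeet (inter_mem hO (inter_mem ((hWo V).mem_nhds (hxW V))
          ((hWo V').mem_nhds (hxW V'))))
        exact ⟨y, hy.1, hcomp V ⟨hy.2.1, hyF⟩, hcomp V' ⟨hy.2.2, hyF⟩⟩ }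
  refine ⟨⟨x, _, γ⟩, ⟨hx, fun V => mem_closure_iff_nhds.2 fun O hO => ?_⟩, rfl⟩
  obtain ⟨y, hy, hyF⟩ := hmeet (inter_mem hO ((hWo V).mem_nhds (hxW V)))
  exact ⟨y, hy.1, hcomp V ⟨hy.2, hyF⟩, hyF⟩

end CornersInChart

/-! ### Corners form a manifold with g-corners -/

section CornersManifold

variable {X : Type*} [TopologicalSpace X] [GCAtlas X] [IsGCManifold X] {c d : GChart X}
  {F : AddSubmonoid (Fin c.n → ℤ)} {F' : AddSubmonoid (Fin d.n → ℤ)} {ξ ξ' : Corners X}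

/-- Near the point both charts order the supports alike, and some point of the component has support
`F` in `c` and `F'` in `d`; so nearby the stratum of `F` lies in that of `F'`. -/
lemma InFace.exists_nhds_change (h : InFace c F ξ) (h' : InFace d F' ξ)
    (hc : c ∈ GCAtlas.charts (X := X)) (hd : d ∈ GCAtlas.charts (X := X)) :
    ∃ V ∈ 𝓝 ξ.pt, ∀ η : Corners X, η.pt ∈ V → InFace c F η → InFace d F' η := by
  obtain ⟨V, hV, hxV, -, hVd, hle⟩ := exists_nhds_supp_le_iff hc hd h.1 h'.1
  obtain ⟨y, hyV, hyc, hyd⟩ := mem_closure_iff_nhds.1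
    (ξ.comp.compatible (sourceNhd hc h.1) (sourceNhd hd h'.1)) V (hV.mem_nhds hxV)
  have hyc := h.comp_subset hc le_rfl hyc
  have hyd := h'.comp_subset hd le_rfl hyd
  have hsub : ∀ z ∈ V, z ∈ c.faceStratum F → z ∈ d.faceStratum F' := fun z hz hzF =>
    ⟨hVd hz, (le_antisymm ((hle z hz y hyV).1 (hzF.2.trans hyc.2.symm).le)
      ((hle y hyV z hz).1 (hyc.2.trans hzF.2.symm).le)).trans hyd.2⟩
  refine ⟨V, hV.mem_nhds hxV, fun η hη hηF => ⟨hVd hη, fun W => ?_⟩⟩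
  refine closure_mono ?_ (IsOpen.closure_inter hV ⟨hηF.2 W, hη⟩)
  rintro z ⟨⟨hz1, hz2⟩, hzV⟩
  exact ⟨hz1, hsub z hzV hz2⟩

lemma InFace.restrict_extendZero (h : InFace c F ξ) (hc : c ∈ GCAtlas.charts (X := X))
    (hF : IsFaceOf F c.P) :
    ModelSpace.extendZero hF ((c.coord ξ.pt).restrict hF.1) = c.coord ξ.pt :=
  ModelSpace.extendZero_restrict hF (h.supp_le hc)

/-- Neighbourhoods in the corners are the restrictions of neighbourhoods in the base to the
corner chart. -/
lemma nhds_corner (h : InFace c F ξ) (hc : c ∈ GCAtlas.charts (X := X)) (hF : IsFaceOf F c.P) :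
    𝓝 ξ = comap Corners.pt (𝓝 ξ.pt) ⊓ 𝓟 {η | InFace c F η} := by
  have hcv := IsGCManifold.isValid c hc
  have hopen : ∀ O : Set (ModelSpace F), IsOpen O →
      IsOpen ((cornerChart c F hF).source ∩ (cornerChart c F hF).coord ⁻¹' O) := fun O hO =>
    TopologicalSpace.isOpen_generateFrom_of_mem
      ⟨cornerChart c F hF, ⟨c, hc, F, hF, rfl⟩, O, hO, rfl⟩
  refine le_antisymm (le_inf (tendsto_iff_comap.1 ?_) (le_principal_iff.2 ?_)) ?_
  · intro V hV
    have h1 : c.coord '' (V ∩ c.source) ∈ 𝓝 (c.coord ξ.pt) := by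
      rw [← hcv.map_nhds h.1]
      exact image_mem_map (inter_mem hV (hcv.source_mem_nhds h.1))
    obtain ⟨O, hOV, hO, hξO⟩ := mem_nhds_iff.1 h1
    refine mem_map.2 (mem_of_superset ((hopen _ (hO.preimage
      (ModelSpace.continuous_extendZero hF))).mem_nhds ⟨h, ?_⟩) ?_)
    · change ModelSpace.extendZero hF ((c.coord ξ.pt).restrict hF.1) ∈ O
      rwa [h.restrict_extendZero hc]
    · rintro η ⟨hη : InFace c F η, hηO⟩
      change ModelSpace.extendZero hF ((c.coord η.pt).restrict hF.1) ∈ O at hηO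
      rw [hη.restrict_extendZero hc] at hηO
      obtain ⟨y, hy, hyη⟩ := hOV hηO
      change η.pt ∈ V
      rw [← hcv.injOn hy.2 hη.1 hyη]
      exact hy.1
  · exact mem_of_superset ((hopen univ isOpen_univ).mem_nhds ⟨h, mem_univ _⟩) inter_subset_left
  -- A generating open set may come from another chart `d`; close to `ξ`, corners in the face `F` of
  -- `c` also lie in the face `F'` of `d`.
  · rw [TopologicalSpace.nhds_generateFrom]
    refine le_iInf₂ fun S hS => le_principal_iff.2 ?_
    obtain ⟨hξS, _, ⟨d, hd, F', hF', rfl⟩, O, hO, rfl⟩ := hS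
    have hξd : InFace d F' ξ := hξS.1
    obtain ⟨V, hV, hVF⟩ := h.exists_nhds_change hξd hc hd
    have hcont : Tendsto (fun y => (d.coord y).restrict hF'.1) (𝓝 ξ.pt)
        (𝓝 ((d.coord ξ.pt).restrict hF'.1)) :=
      ((ModelSpace.continuous_restrict hF'.1).tendsto _).comp
        ((IsGCManifold.isValid d hd).continuousAt hξd.1)
    refine mem_of_superset (inter_mem (mem_inf_of_left (preimage_mem_comap
      (inter_mem hV (hcont (hO.mem_nhds hξS.2))))) (mem_inf_of_right (mem_principal_self _))) ?_
    rintro η ⟨⟨h1, h2⟩, h3⟩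
    exact ⟨hVF η h1 h3, h2⟩

lemma continuous_pt : Continuous (Corners.pt : Corners X → X) := by
  refine continuous_iff_continuousAt.2 fun ξ => ?_
  obtain ⟨c, hc, hx⟩ := IsGCManifold.cover ξ.pt
  obtain ⟨F, hF, h⟩ := exists_inFace hc hx
  rw [ContinuousAt, nhds_corner h hc hF]
  exact tendsto_comap.mono_left inf_le_left

lemma eventually_inFace (h : InFace c F ξ) (hc : c ∈ GCAtlas.charts (X := X))
    (hF : IsFaceOf F c.P) : ∀ᶠ η in 𝓝 ξ, InFace c F η := by
  rw [nhds_corner h hc hF]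
  exact mem_inf_of_right (mem_principal_self _)

lemma isValid_cornerChart (hc : c ∈ GCAtlas.charts (X := X)) (hF : IsFaceOf F c.P) :
    (cornerChart c F hF).IsValid := by
  have hcv := IsGCManifold.isValid c hc
  have hopen : IsOpen (cornerChart c F hF).source :=
    isOpen_iff_mem_nhds.2 fun ξ hξ => eventually_inFace hξ hc hF
  refine ⟨hF.isWeaklyToric hcv.weaklyToric, hopen, ?_⟩
  refine IsOpenEmbedding.of_continuous_injective_isOpenMap ?_ ?_ ?_
  · refine continuous_iff_continuousAt.2 fun ξ => ?_
    have h1 : ContinuousAt (cornerChart c F hF).coord ξ.1 :=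
      (ModelSpace.continuous_restrict hF.1).continuousAt.comp
        (ContinuousAt.comp (hcv.continuousAt ξ.2.1) continuous_pt.continuousAt)
    exact h1.comp continuous_subtype_val.continuousAt
  · rintro ⟨ξ, hξ : InFace c F ξ⟩ ⟨η, hη : InFace c F η⟩ h
    have h1 : (c.coord ξ.pt).restrict hF.1 = (c.coord η.pt).restrict hF.1 := h
    have h2 := congrArg (ModelSpace.extendZero hF) h1
    rw [hξ.restrict_extendZero hc, hη.restrict_extendZero hc] at h2
    exact Subtype.ext (hξ.ext hη hc (hcv.injOn hξ.1 hη.1 h2))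
  · refine isOpenMap_iff_nhds_le.2 fun ξ S hS => ?_
    have hξ : InFace c F ξ.1 := ξ.2
    rw [mem_map, nhds_subtype_eq_comap, mem_comap] at hS
    obtain ⟨T, hT, hTS⟩ := hS
    rw [nhds_corner hξ hc hF, mem_inf_principal, mem_comap] at hT
    obtain ⟨V, hV, hVT⟩ := hT
    have h1 : c.coord '' (V ∩ c.source) ∈ 𝓝 (ModelSpace.extendZero hF
        ((c.coord ξ.1.pt).restrict hF.1)) := by
      rw [hξ.restrict_extendZero hc, ← hcv.map_nhds hξ.1]
      exact image_mem_map (inter_mem hV (hcv.source_mem_nhds hξ.1))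
    have h2 := (ModelSpace.continuous_extendZero hF).continuousAt.preimage_mem_nhds h1
    refine mem_of_superset h2 ?_
    -- A point of `X_F` near the image, extended by zero, is the coordinate of some `y` with support
    -- in `F`, and the corner over `y` given by `F` maps to it.
    intro (w : ModelSpace F) ⟨y, hy, hyw⟩
    have hsupp : (c.coord y).supp ≤ F := by
      rw [hyw, ModelSpace.supp_extendZero]
      exact ModelSpace.supp_le _
    obtain ⟨η, hη, rfl⟩ := exists_corner_inFace hc hy.2 hF hsupp
    have hηw : (cornerChart c F hF).coord η = w := by
      change (c.coord η.pt).restrict hF.1 = w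
      rw [hyw, ModelSpace.restrict_extendZero]
    rw [← hηw]
    exact hTS (a := ⟨η, hη⟩) (hVT hy.1 hη)

lemma smoothReal_corner (h : InFace c F ξ) (hc : c ∈ GCAtlas.charts (X := X))
    (hF : IsFaceOf F c.P) {a : X → ℝ} (ha : c.SmoothReal a ξ.pt) :
    (cornerChart c F hF).SmoothReal (fun η => a η.pt) ξ := by
  obtain ⟨e, he⟩ := ha.exists_expr
  refine GChart.SmoothReal.of_expr (c := cornerChart c F hF) (e.restrict F) ?_
  filter_upwards [continuous_pt.continuousAt.eventually he, eventually_inFace h hc hF] with η h1 h2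
  rw [h1]
  refine .trans ?_ (SmoothExpr.eval_restrict hF e _).symm
  exact congrArg e.eval (h2.restrict_extendZero hc hF).symm

/-- The pullback of a smooth function to `[0,∞)` to the corners is smooth. -/
lemma smoothNN_corner (h : InFace c F ξ) (hc : c ∈ GCAtlas.charts (X := X))
    (hF : IsFaceOf F c.P) {b : X → ℝ≥0} (hb : c.SmoothNN b ξ.pt) :
    (cornerChart c F hF).SmoothNN (fun η => b η.pt) ξ := by
  have hpt : Tendsto Corners.pt (𝓝 ξ) (𝓝 ξ.pt) := continuous_pt.continuousAt
  rcases hb with hb | ⟨p, k, hk, hk0, hb⟩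
  · exact Or.inl (hpt.eventually hb)
  · by_cases hp : (p : Fin c.n → ℤ) ∈ F
    · exact Or.inr ⟨⟨(p : Fin c.n → ℤ), hp⟩, fun η => k η.pt, smoothReal_corner h hc hF hk, hpt.eventually hk0,
        hpt.eventually hb⟩
    · left
      filter_upwards [hpt.eventually hb, eventually_inFace h hc hF] with η h1 h2
      have h0 : (c.coord η.pt).toFun p = 0 :=
        ModelSpace.map_eq_zero fun h' => hp (h2.supp_le hc h')
      rw [h0] at h1
      simpa using h1

/-- Countably many charts cover `X`, each has countably many faces, and each corner chart embeds its
domain into a second countable model space. -/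
lemma secondCountable_corners : SecondCountableTopology (Corners X) := by
  have := IsGCManifold.secondCountable (X := X)
  choose c hc hx using IsGCManifold.cover (X := X)
  obtain ⟨s, hs, hsU⟩ := TopologicalSpace.countable_cover_nhds
    (f := fun x => (c x).source) fun x => (IsGCManifold.isValid _ (hc x)).source_mem_nhds (hx x)
  have hcount : ∀ x, {F | IsFaceOf F (c x).P}.Countable := fun x =>
    countable_faces (IsGCManifold.isValid _ (hc x)).weaklyToric.fg
  have := hs.to_subtype
  have : ∀ x, Countable {F | IsFaceOf F (c x).P} := fun x => (hcount x).to_subtype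
  have hval := fun i : Σ x : s, {F | IsFaceOf F (c x).P} => isValid_cornerChart (hc i.1) i.2.2
  have hsc : ∀ i : Σ x : s, {F | IsFaceOf F (c x).P}, SecondCountableTopology
      (cornerChart (c i.1) i.2.1 i.2.2).source := fun i =>
    (hval i).isOpenEmbedding.isEmbedding.secondCountableTopology
  refine TopologicalSpace.secondCountableTopology_of_countable_cover
    (fun i => (hval i).isOpen_source) ?_
  refine eq_univ_of_forall fun ξ => ?_
  obtain ⟨x, hxs, hξx⟩ := mem_iUnion₂.1 (hsU.ge (mem_univ ξ.pt))
  obtain ⟨F, hF, hξF⟩ := exists_inFace (hc x) hξx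
  exact mem_iUnion.2 ⟨⟨⟨x, hxs⟩, ⟨F, hF⟩⟩, hξF⟩

/-- Corners over different points are separated in `X`. Over one point, distinct corners belong to
distinct faces of a chart, whose corner chart domains are open and disjoint. -/
lemma t2_corners : T2Space (Corners X) := by
  have := IsGCManifold.t2 (X := X)
  refine t2_iff_nhds.2 fun {ξ η} hne => ?_
  obtain ⟨c, hc, hx⟩ := IsGCManifold.cover ξ.pt
  by_cases hpt : ξ.pt = η.pt
  · obtain ⟨F, hF, hξ⟩ := exists_inFace hc hx
    obtain ⟨G, hG, hη⟩ := exists_inFace hc (hpt ▸ hx)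
    have hev := (eventually_inFace hξ hc hF).filter_mono (inf_le_left (b := 𝓝 η))
    have hev' := (eventually_inFace hη hc hG).filter_mono (inf_le_right (a := 𝓝 ξ))
    obtain ⟨ζ, hζF, hζG⟩ := (hev.and hev').exists
    obtain rfl := hζF.unique hζG hc
    exact hξ.ext hη hc hpt
  · have h1 : Tendsto Corners.pt (𝓝 ξ ⊓ 𝓝 η) (𝓝 ξ.pt ⊓ 𝓝 η.pt) :=
      (continuous_pt.tendsto ξ).inf (continuous_pt.tendsto η)
    rw [disjoint_iff.1 (disjoint_nhds_nhds.2 hpt)] at h1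
    exact absurd (le_bot_iff.1 h1) (hne.map _).ne

instance : IsGCManifold (Corners X) where
  t2 := t2_corners
  secondCountable := secondCountable_corners
  isValid := by
    rintro _ ⟨c, hc, F, hF, rfl⟩
    exact isValid_cornerChart hc hF
  cover ξ := by
    obtain ⟨c, hc, hx⟩ := IsGCManifold.cover ξ.pt
    obtain ⟨F, hF, h⟩ := exists_inFace hc hx
    exact ⟨_, ⟨c, hc, F, hF, rfl⟩, h⟩
  compatible := by
    rintro _ ⟨c, hc, F, hF, rfl⟩ _ ⟨d, hd, G, hG, rfl⟩ ξ ⟨hξ, hξ'⟩ (q : G)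
    exact smoothNN_corner hξ hc hF
      (IsGCManifold.compatible c hc d hd ξ.pt ⟨hξ.1, hξ'.1⟩ ⟨(q : Fin d.n → ℤ), hG.1 q.2⟩)

end CornersManifold

/-! ### The corner map -/

section CornerMap

variable {X Z : Type*} [TopologicalSpace X] [GCAtlas X] [TopologicalSpace Z]
  [GCAtlas Z] {f : X → Z} {c : GChart X} {d : GChart Z}
  {F : AddSubmonoid (Fin c.n → ℤ)} {G : AddSubmonoid (Fin d.n → ℤ)} {ξ : Corners X} {η : Corners Z}

/-- Locates any pushforward, in particular the one chosen by `cornerMap`, in the face computed in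
charts; the test neighbourhood is `f ⁻¹' V'`. -/
lemma IsPushforward.inFace (h : IsPushforward f ξ η) (hf : Continuous f) (hξ : InFace c F ξ)
    (hz : f ξ.pt ∈ d.source)
    (hFG : ∀ᶠ y in 𝓝 ξ.pt, y ∈ c.faceStratum F → f y ∈ d.faceStratum G) : InFace d G η := by
  refine ⟨h.1 ▸ hz, fun V' => mem_closure_iff_nhds.2 fun O hO => ?_⟩
  have hV' : ξ.pt ∈ f ⁻¹' (V' : Set Z) := by
    rw [mem_preimage, h.1]
    exact V'.mem
  let V : TopologicalSpace.OpenNhdsOf ξ.pt := ⟨⟨f ⁻¹' V', V'.isOpen.preimage hf⟩, hV'⟩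
  have hO' : f ⁻¹' O ∈ 𝓝 ξ.pt := hf.continuousAt.preimage_mem_nhds (h.1 ▸ hO)
  obtain ⟨y, hyO, hyV, hyF⟩ := mem_closure_iff_nhds.1 (hξ.2 V) _ (inter_mem hO' hFG)
  exact ⟨f y, hyO.1, h.2 V V' (fun _ h => h) hyV, hyO.2 hyF⟩

variable [IsGCManifold X] [IsGCManifold Z]

/-- In charts, a smooth map respects the order of the strata near a point. -/
lemma IsSmoothMap.exists_nhds_supp_le (hf : IsSmoothMap f) (hc : c ∈ GCAtlas.charts (X := X))
    (hd : d ∈ GCAtlas.charts (X := Z)) {x : X} (hx : x ∈ c.source) (hz : f x ∈ d.source) :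
    ∃ V ∈ 𝓝 x, V ⊆ c.source ∧ V ⊆ f ⁻¹' d.source ∧ ∀ y ∈ V, ∀ y' ∈ V,
      (c.coord y).supp ≤ (c.coord y').supp → (d.coord (f y)).supp ≤ (d.coord (f y')).supp := by
  have hcv := IsGCManifold.isValid c hc
  have hdv := IsGCManifold.isValid d hd
  obtain ⟨V, hV, hxV, h⟩ := c.exists_nhds_supp_le (D := fun y => d.coord (f y))
    hdv.weaklyToric.fg (hf.smooth c hc d hd x hx hz)
  exact ⟨V ∩ (c.source ∩ f ⁻¹' d.source), inter_mem (hV.mem_nhds hxV)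
    (inter_mem (hcv.source_mem_nhds hx)
      (hf.continuous.continuousAt.preimage_mem_nhds (hdv.source_mem_nhds hz))),
    fun y hy => hy.2.1, fun y hy => hy.2.2, fun y hy y' hy' => h y hy.1 y' hy'.1⟩

/-- A smooth map sends each stratum near `x` into a single stratum. -/
lemma IsSmoothMap.exists_face (hf : IsSmoothMap f) (hc : c ∈ GCAtlas.charts (X := X))
    (hd : d ∈ GCAtlas.charts (X := Z)) (hF : IsFaceOf F c.P) {x : X} (hx : x ∈ c.source)
    (hz : f x ∈ d.source) (hle : (c.coord x).supp ≤ F) :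
    ∃ G, IsFaceOf G d.P ∧ (d.coord (f x)).supp ≤ G ∧
      ∀ᶠ y in 𝓝 x, y ∈ c.faceStratum F → f y ∈ d.faceStratum G := by
  obtain ⟨V, hV, hVc, hVd, h⟩ := hf.exists_nhds_supp_le hc hd hx hz
  obtain ⟨w, hwV, hw⟩ := mem_closure_iff_nhds.1
    ((IsGCManifold.isValid c hc).mem_closure_faceStratum hx hF hle) V hV
  refine ⟨(d.coord (f w)).supp, ModelSpace.supp_isFaceOf _,
    h x (mem_of_mem_nhds hV) w hwV (hle.trans_eq hw.2.symm), ?_⟩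
  filter_upwards [hV] with y hy hyF
  exact ⟨hVd hy, le_antisymm (h y hy w hwV (hyF.2.trans hw.2.symm).le)
    (h w hwV y hy (hw.2.trans hyF.2.symm).le)⟩

/-- A smooth map has locally constant depth along each depth stratum. -/
lemma IsSmoothMap.depth_eq_of_isPreconnected (hf : IsSmoothMap f) {A : Set X}
    (hA : IsPreconnected A) {k : ℕ} (hAk : A ⊆ stratum X k) {y z : X} (hy : y ∈ A) (hz : z ∈ A) :
    depth (f y) = depth (f z) := by
  refine IsPreconnected.eq_of_eventually_eq hA (f := fun y => depth (f y)) (fun y hy => ?_) hy hz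
  obtain ⟨c, hc, hyc⟩ := IsGCManifold.cover y
  obtain ⟨d, hd, hyd⟩ := IsGCManifold.cover (f y)
  obtain ⟨V, hV, hVc, hVd, h⟩ := hf.exists_nhds_supp_le hc hd hyc hyd
  filter_upwards [mem_nhdsWithin_of_mem_nhds (eventually_supp_eq hc hyc),
    mem_nhdsWithin_of_mem_nhds hV, self_mem_nhdsWithin] with w hw hwV hwA
  have hsupp := hw ((hAk hwA).trans (hAk hy).symm)
  have hyV := mem_of_mem_nhds hV
  rw [depth_eq hd (hVd hwV), depth_eq hd (hVd hyV),
    le_antisymm (h w hwV y hyV hsupp.le) (h y hyV w hwV hsupp.ge)]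

/-- One point of the component near `ξ.pt` lands in the target component. Connectedness and
constancy of the depth of the image carry this to the whole component, even for large `V`. -/
lemma IsSmoothMap.isPushforward (hf : IsSmoothMap f) (hξ : InFace c F ξ)
    (hη : InFace d G η) (hd : d ∈ GCAtlas.charts (X := Z)) (hpt : f ξ.pt = η.pt)
    (hFG : ∀ᶠ y in 𝓝 ξ.pt, y ∈ c.faceStratum F → f y ∈ d.faceStratum G) :
    IsPushforward f ξ η := by
  refine ⟨hpt, fun V V' hVV' => ?_⟩
  obtain ⟨W, hWV, -, hWo, hzW, hW⟩ := (IsGCManifold.isValid d hd).exists_nhds_isPreconnected hη.1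
    (V'.isOpen.mem_nhds V'.mem)
  have hsub := hη.inter_subset_comp hd V' (hWo.mem_nhds hzW) hWV (hW G)
  have hfW : f ⁻¹' W ∈ 𝓝 ξ.pt :=
    hf.continuous.continuousAt.preimage_mem_nhds (hpt ▸ hWo.mem_nhds hzW)
  obtain ⟨y, hyW, hyV, hyF⟩ := mem_closure_iff_nhds.1 (hξ.2 V) _ (inter_mem hfW hFG)
  have hfy : f y ∈ η.comp.comp V' := hsub ⟨hyW.1, hyW.2 hyF⟩
  have hs := ξ.comp.comp_subset V
  rw [mapsTo_iff_image_subset]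
  refine η.comp.subset_comp V' ((ξ.comp.isPreconnected_comp V).image f hf.continuous.continuousOn)
    ?_ ⟨f y, mem_image_of_mem f hyV, hfy⟩
  rintro _ ⟨w, hw, rfl⟩
  refine ⟨hVV' (hs hw).1, ?_⟩
  exact (hf.depth_eq_of_isPreconnected (ξ.comp.isPreconnected_comp V) (fun w hw => (hs hw).2)
    hw hyV).trans (η.comp.comp_subset V' hfy).2

lemma IsSmoothMap.isPushforward_cornerMap (hf : IsSmoothMap f) (ξ : Corners X) :
    IsPushforward f ξ (cornerMap f ξ) := by
  have hex : ∃ η, IsPushforward f ξ η := by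
    obtain ⟨c, hc, hx⟩ := IsGCManifold.cover ξ.pt
    obtain ⟨d, hd, hz⟩ := IsGCManifold.cover (f ξ.pt)
    obtain ⟨F, hF, hξ⟩ := exists_inFace hc hx
    obtain ⟨G, hG, hle, hFG⟩ := hf.exists_face hc hd hF hx hz (hξ.supp_le hc)
    obtain ⟨η, hη, hpt⟩ := exists_corner_inFace hd hz hG hle
    exact ⟨η, hf.isPushforward hξ hη hd hpt.symm hFG⟩
  rw [cornerMap, dif_pos hex]
  exact hex.choose_spec

lemma IsSmoothMap.cornerMap_pt (hf : IsSmoothMap f) (ξ : Corners X) :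
    (cornerMap f ξ).pt = f ξ.pt := (hf.isPushforward_cornerMap ξ).1.symm

lemma IsSmoothMap.exists_inFace_cornerMap (hf : IsSmoothMap f)
    (hc : c ∈ GCAtlas.charts (X := X)) (hd : d ∈ GCAtlas.charts (X := Z)) (hF : IsFaceOf F c.P)
    (hξ : InFace c F ξ) (hz : f ξ.pt ∈ d.source) :
    ∃ G, IsFaceOf G d.P ∧ (∀ᶠ ζ in 𝓝 ξ, InFace d G (cornerMap f ζ)) ∧
      ∀ᶠ y in 𝓝 ξ.pt, y ∈ c.faceStratum F → f y ∈ d.faceStratum G := by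
  obtain ⟨G, hG, hle, hFG⟩ := hf.exists_face hc hd hF hξ.1 hz (hξ.supp_le hc)
  refine ⟨G, hG, ?_, hFG⟩
  have hd' : ∀ᶠ y in 𝓝 ξ.pt, f y ∈ d.source :=
    hf.continuous.continuousAt.preimage_mem_nhds ((IsGCManifold.isValid d hd).source_mem_nhds hz)
  filter_upwards [eventually_inFace hξ hc hF, continuous_pt.continuousAt.eventually hd',
    continuous_pt.continuousAt.eventually (eventually_eventually_nhds.2 hFG)] with ζ h1 h2 h3
  exact (hf.isPushforward_cornerMap ζ).inFace hf.continuous h1 h2 h3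

theorem IsSmoothMap.isInteriorMap_cornerMap (hf : IsSmoothMap f) : IsInteriorMap (cornerMap f) where
  continuous := by
    refine continuous_iff_continuousAt.2 fun ξ => ?_
    obtain ⟨c, hc, hx⟩ := IsGCManifold.cover ξ.pt
    obtain ⟨d, hd, hz⟩ := IsGCManifold.cover (f ξ.pt)
    obtain ⟨F, hF, hξ⟩ := exists_inFace hc hx
    obtain ⟨G, hG, hev, -⟩ := hf.exists_inFace_cornerMap hc hd hF hξ hz
    rw [ContinuousAt, nhds_corner hev.self_of_nhds hd hG, tendsto_inf, tendsto_comap_iff,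
      tendsto_principal, hf.cornerMap_pt]
    refine ⟨?_, hev⟩
    have : Corners.pt ∘ cornerMap f = f ∘ Corners.pt := funext hf.cornerMap_pt
    rw [this]
    exact (hf.continuous.tendsto _).comp (continuous_pt.tendsto ξ)
  smooth := by
    rintro _ ⟨c, hc, F, hF, rfl⟩ _ ⟨d, hd, G, hG, rfl⟩ ξ hξ hη (q : G)
    have hξ' : InFace c F ξ := hξ
    have hη' : InFace d G (cornerMap f ξ) := hη
    have h := smoothNN_corner hξ' hc hF
      (hf.smooth c hc d hd ξ.pt hξ'.1 (hf.cornerMap_pt ξ ▸ hη'.1) ⟨(q : Fin d.n → ℤ), hG.1 q.2⟩)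
    have heq : (fun ζ : Corners X => (d.coord (f ζ.pt)).toFun ⟨(q : Fin d.n → ℤ), hG.1 q.2⟩) =
        fun ζ => (d.coord (cornerMap f ζ).pt).toFun ⟨(q : Fin d.n → ℤ), hG.1 q.2⟩ :=
      funext fun ζ => by rw [hf.cornerMap_pt]
    rw [heq] at h
    exact h
  mapsTo := by
    rintro ξ ⟨_, ⟨c, hc, F, hF, rfl⟩, hξ, hpos⟩
    have hξ' : InFace c F ξ := hξ
    obtain ⟨d, hd, hz⟩ := IsGCManifold.cover (f ξ.pt)
    obtain ⟨G, hG, hev, hFG⟩ := hf.exists_inFace_cornerMap hc hd hF hξ' hz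
    -- An interior point of the corner chart has its base point on the stratum of `F` itself, so
    -- `hFG` applies at that point.
    have hsupp : (c.coord ξ.pt).supp = F :=
      le_antisymm (hξ'.supp_le hc) fun p hp => ⟨hF.1 hp, (hpos ⟨p, hp⟩).ne'⟩
    refine ⟨_, ⟨d, hd, G, hG, rfl⟩, hev.self_of_nhds, fun (q : G) => pos_iff_ne_zero.2 ?_⟩
    change (d.coord (cornerMap f ξ).pt).toFun ⟨(q : Fin d.n → ℤ), hG.1 q.2⟩ ≠ 0
    rw [hf.cornerMap_pt]
    exact (ModelSpace.mem_supp_iff (⟨(q : Fin d.n → ℤ), hG.1 q.2⟩ : d.P)).1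
      ((hFG.self_of_nhds ⟨hξ'.1, hsupp⟩).2.ge q.2)

end CornerMap

/-! ### Tangent and normal data of corners -/

section CornerTangent

variable {X Z : Type*} [TopologicalSpace X] [GCAtlas X] [TopologicalSpace Z]
  [GCAtlas Z] {f : X → Z} {c : GChart X} {d : GChart Z}
  {F : AddSubmonoid (Fin c.n → ℤ)} {G : AddSubmonoid (Fin d.n → ℤ)} {ξ : Corners X} {ζ : Corners Z}

lemma cornerChart_mem (hc : c ∈ GCAtlas.charts (X := X)) (hF : IsFaceOf F c.P) :
    cornerChart c F hF ∈ GCAtlas.charts (X := Corners X) := ⟨c, hc, F, hF, rfl⟩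

lemma InFace.mem_source (h : InFace c F ξ) (hF : IsFaceOf F c.P) :
    ξ ∈ (cornerChart c F hF).source := h

variable [IsGCManifold X] [IsGCManifold Z]

/-- The germs of the coordinate functions of a corner chart. -/
noncomputable def cornerGerm (hc : c ∈ GCAtlas.charts (X := X)) (hF : IsFaceOf F c.P)
    (hξ : InFace c F ξ) : F →+ Additive (InteriorGerm ξ) :=
  coordGerm (cornerChart_mem hc hF) (hξ.mem_source hF)

/-- The germ `λ_p · exp e` in a corner chart. -/
noncomputable def cornerRepGerm (hc : c ∈ GCAtlas.charts (X := X)) (hF : IsFaceOf F c.P)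
    (hξ : InFace c F ξ) (p : F) (e : SmoothExpr F) : InteriorGerm ξ :=
  repGerm (cornerChart_mem hc hF) (hξ.mem_source hF) p e

lemma bTangent_cornerRepGerm (hc : c ∈ GCAtlas.charts (X := X)) (hF : IsFaceOf F c.P)
    (hξ : InFace c F ξ) (v : BTangent ξ) (p : F) (e : SmoothExpr F) :
    v.1.2 (Additive.ofMul (cornerRepGerm hc hF hξ p e)) = v.1.2 (cornerGerm hc hF hξ p) +
      e.deriv (v.1.2.comp (cornerGerm hc hF hξ)) ((c.coord ξ.pt).restrict hF.1) :=
  bTangent_repGerm (cornerChart_mem hc hF) (hξ.mem_source hF) v p e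

lemma hom_cornerRepGerm {M : Type*} [AddCommMonoid M] (hc : c ∈ GCAtlas.charts (X := X))
    (hF : IsFaceOf F c.P) (hξ : InFace c F ξ) {α : Additive (InteriorGerm ξ) →+ M}
    (hα : ∀ b : InteriorGerm ξ, 0 < InteriorGerm.ev b → α (Additive.ofMul b) = 0) (p : F)
    (e : SmoothExpr F) :
    α (Additive.ofMul (cornerRepGerm hc hF hξ p e)) = α (cornerGerm hc hF hξ p) :=
  hom_repGerm (cornerChart_mem hc hF) (hξ.mem_source hF) hα p e

lemma hom_ext_of_cornerGerm {M : Type*} [AddCommMonoid M] (hc : c ∈ GCAtlas.charts (X := X))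
    (hF : IsFaceOf F c.P) (hξ : InFace c F ξ) {α β : Additive (InteriorGerm ξ) →+ M}
    (hα : ∀ b : InteriorGerm ξ, 0 < InteriorGerm.ev b → α (Additive.ofMul b) = 0)
    (hβ : ∀ b : InteriorGerm ξ, 0 < InteriorGerm.ev b → β (Additive.ofMul b) = 0)
    (h : α.comp (cornerGerm hc hF hξ) = β.comp (cornerGerm hc hF hξ)) : α = β :=
  hom_ext_of_coordGerm (cornerChart_mem hc hF) (hξ.mem_source hF) hα hβ h

/-- If `p` were outside `F`, then `λ_p` would vanish on all corners near `ξ`, and the interior map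
`cornerMap f` would pull an interior function back to zero. -/
lemma pull_coordGerm_corner (hf : IsInteriorMap f) (hCf : IsInteriorMap (cornerMap f))
    (hc : c ∈ GCAtlas.charts (X := X)) (hF : IsFaceOf F c.P) (hξ : InFace c F ξ)
    (hd : d ∈ GCAtlas.charts (X := Z)) (hG : IsFaceOf G d.P) (hζ : InFace d G ζ)
    (hpt : f ξ.pt = ζ.pt) (hmap : cornerMap f ξ = ζ) (q : G) {p : c.P} {e : SmoothExpr c.P}
    (h : pullInterior hf hpt (coordGerm hd hζ.1 ⟨q, hG.1 q.2⟩).toMul = repGerm hc hξ.1 p e) :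
    ∃ hp : (p : Fin c.n → ℤ) ∈ F, pullInterior hCf hmap (cornerGerm hd hG hζ q).toMul =
      cornerRepGerm hc hF hξ ⟨p, hp⟩ (e.restrict F) := by
  have h1 : ∀ᶠ η in 𝓝 ξ, ((d.coord (cornerMap f η).pt).toFun ⟨q, hG.1 q.2⟩ : ℝ) =
      (c.coord η.pt).toFun p * Real.exp (e.eval (c.coord η.pt)) := by
    have h2 := (repGerm_eq_iff hc hξ.1 p e (Subtype.prop (pullInterior hf hpt
      (coordGerm hd hζ.1 ⟨q, hG.1 q.2⟩).toMul))).1 h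
    filter_upwards [continuous_pt.continuousAt.eventually h2] with η hη
    rw [hf.toIsSmoothMap.cornerMap_pt]
    exact hη
  have hp : (p : Fin c.n → ℤ) ∈ F := by
    by_contra hp
    have hint := hCf.interiorFunAt_comp hmap (interiorFunAt_coord (cornerChart_mem hd hG)
      (hζ.mem_source hG) q)
    refine hint.not_eventually_eq_zero ?_
    filter_upwards [h1, eventually_inFace hξ hc hF] with η hη hηF
    have h0 : (c.coord η.pt).toFun p = 0 :=
      ModelSpace.map_eq_zero fun h' => hp (hηF.supp_le hc h')
    rw [h0, NNReal.coe_zero, zero_mul] at hη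
    exact NNReal.coe_eq_zero.1 hη
  refine ⟨hp, (repGerm_eq_iff (cornerChart_mem hc hF) _ (⟨p, hp⟩ : F) (e.restrict F)
    (Subtype.prop (pullInterior hCf hmap (cornerGerm hd hG hζ q).toMul))).2 ?_⟩
  filter_upwards [h1, eventually_inFace hξ hc hF] with η hη hηF
  refine hη.trans ?_
  have h3 := SmoothExpr.eval_restrict hF e ((c.coord η.pt).restrict hF.1)
  rw [hηF.restrict_extendZero hc hF] at h3
  rw [← h3]
  rfl

/-- The square formed by the b-tangent maps of `f` and `C(f)` and the restrictions to `F` and `G`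
commutes. -/
lemma coords_bTangentMap_corner (hf : IsInteriorMap f) (hCf : IsInteriorMap (cornerMap f))
    (hc : c ∈ GCAtlas.charts (X := X)) (hF : IsFaceOf F c.P) (hξ : InFace c F ξ)
    (hd : d ∈ GCAtlas.charts (X := Z)) (hG : IsFaceOf G d.P) (hζ : InFace d G ζ)
    (hpt : f ξ.pt = ζ.pt) (hmap : cornerMap f ξ = ζ) {v : BTangent ξ.pt} {w : BTangent ξ}
    (hvw : w.1.2.comp (cornerGerm hc hF hξ) = restrictHom hF.1 (v.1.2.comp (coordGerm hc hξ.1))) :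
    (bTangentMap hCf hmap w).1.2.comp (cornerGerm hd hG hζ) =
      restrictHom hG.1 ((bTangentMap hf hpt v).1.2.comp (coordGerm hd hζ.1)) := by
  refine AddMonoidHom.ext fun q => ?_
  obtain ⟨p, e, h⟩ := exists_eq_repGerm hc hξ.1
    (pullInterior hf hpt (coordGerm hd hζ.1 ⟨q, hG.1 q.2⟩).toMul)
  obtain ⟨hp, h'⟩ := pull_coordGerm_corner hf hCf hc hF hξ hd hG hζ hpt hmap q h
  change w.1.2 (Additive.ofMul (pullInterior hCf hmap (cornerGerm hd hG hζ q).toMul)) =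
    v.1.2 (Additive.ofMul (pullInterior hf hpt (coordGerm hd hζ.1 ⟨q, hG.1 q.2⟩).toMul))
  rw [h, h', bTangent_repGerm, bTangent_cornerRepGerm]
  refine congrArg₂ (· + ·) (DFunLike.congr_fun hvw (⟨p, hp⟩ : F)) ?_
  have h3 := SmoothExpr.deriv_restrict hF e (v.1.2.comp (coordGerm hc hξ.1))
    ((c.coord ξ.pt).restrict hF.1)
  rw [hξ.restrict_extendZero hc hF, ← hvw] at h3
  exact h3

lemma coords_pull_corner {M : Type*} [AddCommMonoid M] (hf : IsInteriorMap f)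
    (hCf : IsInteriorMap (cornerMap f))
    (hc : c ∈ GCAtlas.charts (X := X)) (hF : IsFaceOf F c.P) (hξ : InFace c F ξ)
    (hd : d ∈ GCAtlas.charts (X := Z)) (hG : IsFaceOf G d.P) (hζ : InFace d G ζ)
    (hpt : f ξ.pt = ζ.pt) (hmap : cornerMap f ξ = ζ)
    {α : Additive (InteriorGerm ξ.pt) →+ M} {β : Additive (InteriorGerm ξ) →+ M}
    (hα : ∀ b : InteriorGerm ξ.pt, 0 < InteriorGerm.ev b → α (Additive.ofMul b) = 0)
    (hβ : ∀ b : InteriorGerm ξ, 0 < InteriorGerm.ev b → β (Additive.ofMul b) = 0)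
    (hαβ : β.comp (cornerGerm hc hF hξ) = restrictHom hF.1 (α.comp (coordGerm hc hξ.1))) :
    (β.comp (pullInterior hCf hmap).toAdditive).comp (cornerGerm hd hG hζ) =
      restrictHom hG.1 ((α.comp (pullInterior hf hpt).toAdditive).comp (coordGerm hd hζ.1)) := by
  refine AddMonoidHom.ext fun q => ?_
  obtain ⟨p, e, h⟩ := exists_eq_repGerm hc hξ.1
    (pullInterior hf hpt (coordGerm hd hζ.1 ⟨q, hG.1 q.2⟩).toMul)
  obtain ⟨hp, h'⟩ := pull_coordGerm_corner hf hCf hc hF hξ hd hG hζ hpt hmap q h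
  change β (Additive.ofMul (pullInterior hCf hmap (cornerGerm hd hG hζ q).toMul)) =
    α (Additive.ofMul (pullInterior hf hpt (coordGerm hd hζ.1 ⟨q, hG.1 q.2⟩).toMul))
  rw [h, h', hom_repGerm _ _ hα, hom_cornerRepGerm _ _ _ hβ]
  exact DFunLike.congr_fun hαβ (⟨p, hp⟩ : F)

lemma exists_bTangent_corner (hc : c ∈ GCAtlas.charts (X := X)) (hF : IsFaceOf F c.P)
    (hξ : InFace c F ξ) (v : BTangent ξ.pt) : ∃ w : BTangent ξ,
      w.1.2.comp (cornerGerm hc hF hξ) = restrictHom hF.1 (v.1.2.comp (coordGerm hc hξ.1)) :=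
  have h (θ : F →+ ℝ) := exists_bTangent (cornerChart_mem hc hF) (hξ.mem_source hF) θ
  h _

lemma exists_hom_corner {M : Type*} [AddCommMonoid M] {j : M →+ ℝ} (hj : Function.Injective j)
    (hc : c ∈ GCAtlas.charts (X := X)) (hF : IsFaceOf F c.P) (hξ : InFace c F ξ)
    {α : Additive (InteriorGerm ξ.pt) →+ M}
    (hα : ∀ b : InteriorGerm ξ.pt, 0 < InteriorGerm.ev b → α (Additive.ofMul b) = 0) :
    ∃ β : Additive (InteriorGerm ξ) →+ M,
      (∀ b : InteriorGerm ξ, 0 < InteriorGerm.ev b → β (Additive.ofMul b) = 0) ∧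
      β.comp (cornerGerm hc hF hξ) = restrictHom hF.1 (α.comp (coordGerm hc hξ.1)) :=
  have h (θ : F →+ M) := exists_hom_of_coordGerm (cornerChart_mem hc hF) (hξ.mem_source hF) hj θ
  h _ fun (p : F) hp => pos_germ_hom_eq_zero hc hξ.1 hα ⟨p, hF.1 p.2⟩ hp

/-- The restriction homomorphism between normal monoids. -/
lemma exists_normalMonoid_corner (hc : c ∈ GCAtlas.charts (X := X)) (hF : IsFaceOf F c.P)
    (hξ : InFace c F ξ) : ∃ Ψ : NormalMonoid ξ.pt →+ NormalMonoid ξ, ∀ α,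
      (Ψ α).1.comp (cornerGerm hc hF hξ) = restrictHom hF.1 (α.1.comp (coordGerm hc hξ.1)) := by
  choose β hβ hβα using fun α : NormalMonoid ξ.pt =>
    exists_hom_corner (j := Nat.castAddMonoidHom ℝ) Nat.cast_injective hc hF hξ α.2
  refine ⟨⟨⟨fun α => ⟨β α, hβ α⟩, Subtype.ext ?_⟩, fun α α' => Subtype.ext ?_⟩, hβα⟩
  · exact hom_ext_of_cornerGerm hc hF hξ (hβ 0) (0 : NormalMonoid ξ).2 (hβα 0)
  · refine hom_ext_of_cornerGerm hc hF hξ (hβ (α + α'))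
      ((NormalMonoid ξ).add_mem (hβ α) (hβ α')) ((hβα (α + α')).trans ?_)
    exact (congrArg₂ (· + ·) (hβα α) (hβα α')).symm

/-- Normal monoids of corners consist of restrictions, up to multiples. -/
lemma exists_nsmul_eq_normalMonoid_corner (hc : c ∈ GCAtlas.charts (X := X))
    (hF : IsFaceOf F c.P) (hξ : InFace c F ξ) {Ψ : NormalMonoid ξ.pt →+ NormalMonoid ξ}
    (hΨ : ∀ α, (Ψ α).1.comp (cornerGerm hc hF hξ) =
      restrictHom hF.1 (α.1.comp (coordGerm hc hξ.1))) (β : NormalMonoid ξ) :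
    ∃ k : ℕ, 0 < k ∧ ∃ α, Ψ α = k • β := by
  have hcv := IsGCManifold.isValid c hc
  obtain ⟨k, hk, θ, hθ⟩ := hF.exists_nat_extension hcv.weaklyToric.fg
    (β.1.comp (cornerGerm hc hF hξ))
  obtain ⟨α, hα, hαθ⟩ := exists_hom_of_coordGerm hc hξ.1 (j := Nat.castAddMonoidHom ℝ)
    Nat.cast_injective θ fun p hp => by
      -- The extension still vanishes on the support, because the support lies in `F`, where the
      -- extension is a multiple of the given homomorphism.
      have hpF := hξ.supp_le hc ((ModelSpace.mem_supp_iff p).2 hp)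
      refine (DFunLike.congr_fun hθ ⟨p, hpF⟩).trans ?_
      have h0 : β.1 (cornerGerm hc hF hξ ⟨p, hpF⟩) = 0 :=
        pos_germ_hom_eq_zero (cornerChart_mem hc hF)
          (hξ.mem_source hF) β.2 (⟨p, hpF⟩ : F) hp
      rw [AddMonoidHom.nsmul_apply, AddMonoidHom.comp_apply, h0, smul_zero]
  refine ⟨k, hk, ⟨α, hα⟩, Subtype.ext ?_⟩
  refine hom_ext_of_cornerGerm hc hF hξ (Ψ ⟨α, hα⟩).2 (k • β).2 ?_
  refine (hΨ ⟨α, hα⟩).trans ?_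
  rw [show (⟨α, hα⟩ : NormalMonoid ξ.pt).1 = α from rfl, hαθ, hθ]
  rfl

end CornerTangent

/-! ### Transversality of corner maps -/

section CornerTransverse

variable {X Y Z : Type*} [TopologicalSpace X] [GCAtlas X] [IsGCManifold X]
  [TopologicalSpace Y] [GCAtlas Y] [IsGCManifold Y] [TopologicalSpace Z] [GCAtlas Z]
  [IsGCManifold Z] {g : X → Z} {h : Y → Z}

/-- Extend the target vector from `G` to the whole monoid, solve at the base points, and restrict
the solutions to the faces. -/
theorem BTransverse.corner {hg : IsInteriorMap g} {hh : IsInteriorMap h}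
    (H : BTransverse hg hh) (hCg : IsInteriorMap (cornerMap g))
    (hCh : IsInteriorMap (cornerMap h)) : BTransverse hCg hCh := by
  intro ξ υ ζ hξζ hυζ w
  have hx : g ξ.pt = ζ.pt := by rw [← hξζ, hg.toIsSmoothMap.cornerMap_pt]
  have hy : h υ.pt = ζ.pt := by rw [← hυζ, hh.toIsSmoothMap.cornerMap_pt]
  obtain ⟨c, hc, hxc⟩ := IsGCManifold.cover ξ.pt
  obtain ⟨c', hc', hyc⟩ := IsGCManifold.cover υ.pt
  obtain ⟨d, hd, hzd⟩ := IsGCManifold.cover ζ.pt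
  obtain ⟨F, hF, hξ⟩ := exists_inFace hc hxc
  obtain ⟨F', hF', hυ⟩ := exists_inFace hc' hyc
  obtain ⟨G, hG, hζ⟩ := exists_inFace hd hzd
  obtain ⟨θ, hθ⟩ := restrictHom_surjective hG.1 (w.1.2.comp (cornerGerm hd hG hζ))
  obtain ⟨w', hw'⟩ := exists_bTangent hd hζ.1 θ
  obtain ⟨⟨v, u⟩, hvu⟩ := H ξ.pt υ.pt ζ.pt hx hy w'
  obtain ⟨v', hv'⟩ := exists_bTangent_corner hc hF hξ v
  obtain ⟨u', hu'⟩ := exists_bTangent_corner hc' hF' hυ u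
  refine ⟨(v', u'), bTangent_ext (cornerChart_mem hd hG)
    (hζ.mem_source hG) ?_⟩
  have h1 := coords_bTangentMap_corner hg hCg hc hF hξ hd hG hζ hx hξζ hv'
  have h2 := coords_bTangentMap_corner hh hCh hc' hF' hυ hd hG hζ hy hυζ hu'
  refine Eq.trans ?_ hθ
  rw [← hw', ← hvu]
  exact congrArg₂ (· + ·) h1 h2

theorem CTransverse.corner {hg : IsInteriorMap g} {hh : IsInteriorMap h}
    (H : CTransverse hg hh) (hCg : IsInteriorMap (cornerMap g))
    (hCh : IsInteriorMap (cornerMap h)) : CTransverse hCg hCh := by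
  refine ⟨H.1.corner hCg hCh, fun ξ υ ζ hξζ hυζ => ?_⟩
  have hx : g ξ.pt = ζ.pt := by rw [← hξζ, hg.toIsSmoothMap.cornerMap_pt]
  have hy : h υ.pt = ζ.pt := by rw [← hυζ, hh.toIsSmoothMap.cornerMap_pt]
  obtain ⟨c, hc, hxc⟩ := IsGCManifold.cover ξ.pt
  obtain ⟨c', hc', hyc⟩ := IsGCManifold.cover υ.pt
  obtain ⟨d, hd, hzd⟩ := IsGCManifold.cover ζ.pt
  obtain ⟨F, hF, hξ⟩ := exists_inFace hc hxc
  obtain ⟨F', hF', hυ⟩ := exists_inFace hc' hyc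
  obtain ⟨G, hG, hζ⟩ := exists_inFace hd hzd
  obtain ⟨H1, H2⟩ := H.2 ξ.pt υ.pt ζ.pt hx hy
  refine ⟨fun w => ?_, fun K hK hKS => ?_⟩
  · obtain ⟨θ, hθ⟩ := restrictHom_surjective hG.1 (w.1.comp (cornerGerm hd hG hζ))
    obtain ⟨w', hw'0, hw'⟩ := exists_hom_of_coordGerm hd hζ.1 (j := AddMonoidHom.id ℝ)
      Function.injective_id θ fun q hq => by
        have hqG := hζ.supp_le hd ((ModelSpace.mem_supp_iff q).2 hq)
        refine (DFunLike.congr_fun hθ ⟨q, hqG⟩).trans ?_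
        exact pos_germ_hom_eq_zero (cornerChart_mem hd hG) (hζ.mem_source hG) w.2 (⟨q, hqG⟩ : G) hq
    obtain ⟨⟨v, u⟩, hvu⟩ := H1 ⟨w', hw'0⟩
    obtain ⟨v', hv'0, hv'⟩ := exists_hom_corner (j := AddMonoidHom.id ℝ) Function.injective_id
      hc hF hξ v.2
    obtain ⟨u', hu'0, hu'⟩ := exists_hom_corner (j := AddMonoidHom.id ℝ) Function.injective_id
      hc' hF' hυ u.2
    refine ⟨(⟨v', hv'0⟩, ⟨u', hu'0⟩), Subtype.ext
      (hom_ext_of_cornerGerm hd hG hζ ((bNormalMap hCg hξζ).coprod (bNormalMap hCh hυζ)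
        (⟨v', hv'0⟩, ⟨u', hu'0⟩)).2 w.2 ?_)⟩
    have h1 := coords_pull_corner hg hCg hc hF hξ hd hG hζ hx hξζ v.2 hv'0 hv'
    have h2 := coords_pull_corner hh hCh hc' hF' hυ hd hG hζ hy hυζ u.2 hu'0 hu'
    refine Eq.trans ?_ hθ
    rw [← hw', show w' = ((bNormalMap hg hx).coprod (bNormalMap hh hy) (v, u)).1 by rw [hvu]]
    exact congrArg₂ (· + ·) h1 h2
  · obtain ⟨Ψ, hΨ⟩ := exists_normalMonoid_corner hc hF hξ
    obtain ⟨Φ, hΦ⟩ := exists_normalMonoid_corner hc' hF' hυ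
    -- The preimage of `K` under restriction is a face. It contains the fibre product at the base
    -- points, because restriction maps that fibre product into the one at the corners.
    have hface : IsFaceOf (K.comap (Ψ.prodMap Φ)) ⊤ :=
      ⟨le_top, fun p _ q _ hpq => hK.2 _ trivial _ trivial (by rw [← map_add]; exact hpq)⟩
    have htop := H2 _ hface fun p hp => by
      refine hKS _ (Subtype.ext (hom_ext_of_cornerGerm hd hG hζ
        (normalMonoidMap hCg hξζ (Ψ p.1)).2 (normalMonoidMap hCh hυζ (Φ p.2)).2 ?_))
      have h1 := coords_pull_corner hg hCg hc hF hξ hd hG hζ hx hξζ p.1.2 (Ψ p.1).2 (hΨ p.1)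
      have h2 := coords_pull_corner hh hCh hc' hF' hυ hd hG hζ hy hυζ p.2.2 (Φ p.2).2 (hΦ p.2)
      refine h1.trans (Eq.trans ?_ h2.symm)
      exact congrArg (fun α : NormalMonoid ζ.pt => restrictHom hG.1
        (α.1.comp (coordGerm hd hζ.1))) hp
    have hmem : ∀ p, Ψ.prodMap Φ p ∈ K := fun p => by
      have : p ∈ K.comap (Ψ.prodMap Φ) := htop ▸ trivial
      exact this
    -- Faces are closed under division, which compensates for restriction being surjective only up
    -- to multiples.
    have hdiv : ∀ (p : NormalMonoid ξ × NormalMonoid υ) (k : ℕ), 0 < k → k • p ∈ K → p ∈ K := by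
      intro p k hk hp
      obtain ⟨m, rfl⟩ : ∃ m, k = m + 1 := ⟨k - 1, by omega⟩
      rw [add_smul, one_smul] at hp
      exact (hK.2 _ trivial _ trivial hp).2
    refine eq_top_iff.2 fun p _ => ?_
    obtain ⟨k, hk, α, hα⟩ := exists_nsmul_eq_normalMonoid_corner hc hF hξ hΨ p.1
    obtain ⟨m, hm, β, hβ⟩ := exists_nsmul_eq_normalMonoid_corner hc' hF' hυ hΦ p.2
    -- The two components need different multiples, so they are treated separately and then added.
    have h1 : (p.1, 0) ∈ K := hdiv _ k hk (by
      have := hmem (α, 0)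
      rw [AddMonoidHom.prodMap_def] at this
      simpa [hα] using this)
    have h2 : (0, p.2) ∈ K := hdiv _ m hm (by
      have := hmem (0, β)
      rw [AddMonoidHom.prodMap_def] at this
      simpa [hβ] using this)
    simpa using K.add_mem h1 h2

end CornerTransverse

end GCorners

open GCorners in
theorem theorem4p26 {X Y Z : Type*}
    [TopologicalSpace X] [GCAtlas X] [IsGCManifold X]
    [TopologicalSpace Y] [GCAtlas Y] [IsGCManifold Y]
    [TopologicalSpace Z] [GCAtlas Z] [IsGCManifold Z]
    (g : X → Z) (h : Y → Z) (hg : IsInteriorMap g) (hh : IsInteriorMap h) :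
    ∃ (_ : IsGCManifold (Corners X)) (_ : IsGCManifold (Corners Y)) (_ : IsGCManifold (Corners Z))
      (hCg : IsInteriorMap (cornerMap g)) (hCh : IsInteriorMap (cornerMap h)),
      (BTransverse hg hh → BTransverse hCg hCh) ∧ (CTransverse hg hh → CTransverse hCg hCh) :=
  have hCg := hg.toIsSmoothMap.isInteriorMap_cornerMap
  have hCh := hh.toIsSmoothMap.isInteriorMap_cornerMap
  ⟨inferInstance, inferInstance, inferInstance, hCg, hCh, fun H => H.corner hCg hCh,
    fun H => H.corner hCg hCh⟩
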